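/- Let $X$ be a set and $\mathcal H$ a collection of functions from $X$ to $\{0,1\}$. We say that $\mathcal H$ shatters a finite set $C\subset X$ if every function $C\to\{0,1\}$ is the restriction to $C$ of some element of $\mathcal H$; the VC-dimension of $\mathcal H$ is the supremum of the sizes of the finite subsets of $X$ that are shattered by $\mathcal H$. For $E\subset\mathbb R^d$ and $t>0$, let $\mathcal H_t^d(E)=\{h_y : y\in E\}$, where $h_y:E\to\{0,1\}$ is defined by $h_y(x)=1$ if $|x-y|=t$ and $h_y(x)=0$ otherwise, $|\cdot|$ being the Euclidean norm. Theorem. Let $d\ge 2$ and let $E\subset\mathbb R^d$ be a compact set whose Hausdorff dimension satisfies $\dim E>\max\left(\frac{d+1}{2},\,d-1\right)$. Then there exists a non-degenerate interval $I\subset(0,\infty)$ such that for every $t\in I$, the VC-dimension of $\mathcal H_t^d(E)$ is at least $2$. -/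

import Mathlib

namespace VCSpheres

/-- A class `H` of functions from `X` to `{0,1}` shatters a finite set `C` if the restrictions to
`C` of the functions in `H` yield every function from `C` to `{0,1}`. -/
def Shatters {X : Type*} (H : Set (X → Fin 2)) (C : Finset X) : Prop :=
  ∀ g : C → Fin 2, ∃ h ∈ H, ∀ x : C, h x = g x

/-- The VC-dimension of a class `H` of functions from `X` to `{0,1}`: the supremum (in `ℕ∞`) of the
sizes of the finite subsets of `X` that are shattered by `H`. -/
noncomputable def vcDim {X : Type*} (H : Set (X → Fin 2)) : ℕ∞ :=
  ⨆ (C : Finset X) (_ : Shatters H C), (C.card : ℕ∞)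

open Classical in
/-- The function `h_y` on `E ⊆ ℝ^d`: it is `1` at the points of `E` at Euclidean distance `t`
from `y`, and `0` at the other points of `E`. -/
noncomputable def sphereIndicator {d : ℕ} (E : Set (EuclideanSpace ℝ (Fin d))) (t : ℝ)
    (y : EuclideanSpace ℝ (Fin d)) : E → Fin 2 :=
  fun x => if ‖(x : EuclideanSpace ℝ (Fin d)) - y‖ = t then 1 else 0

/-- The class `ℋ_t^d(E) = {h_y : y ∈ E}` of functions from `E` to `{0,1}`. -/
def sphereClass {d : ℕ} (E : Set (EuclideanSpace ℝ (Fin d))) (t : ℝ) : Set (E → Fin 2) :=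
  {h | ∃ y ∈ E, h = sphereIndicator E t y}

end VCSpheres

/-!
Write `d = n + 2` and `N x = {y ∈ E | ‖x - y‖ = t}`. Two points `x₁, x₂` of some `N y` are
shattered as soon as neither of `N x₁`, `N x₂` contains the other: `y` lies on both spheres, a
point of `N x₁ \ N x₂` and one of `N x₂ \ N x₁` on exactly one, and a point of `E` on neither
exists because spheres have dimension `d - 1 < dim E` (`two_le_vcDim_sphereClass`). So it is enough
to exclude that the sets `N x`, `x ∈ N y`, form a chain.

This is linear algebra, provided that the sets in question span enough
(`exists_not_subset_of_not_subset_affine`). Let `k = ⌊d / 2⌋`. In a chain, the smallest of the sets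
`N x`, for `x` in a finite affine basis of a part `A` of `N y`, is contained in all the others;
hence the directions of the affine span of `A` and those of the affine span of this smallest set
are orthogonal. If no set `N x`, `x ∈ A`, lies in an affine subspace of dimension `k`, and `A` does
not either, both direction spaces have dimension at least `k + 1`, and `2 (k + 1) > d`.

The sets `N x` are large for measure-theoretic reasons. Choose `s` with
`max ((d + 1) / 2, d - 1) < s < dim E` and a measure `μ` on `E` with bounded potential of order `s`
(`exists_frostman_measure`). The Fourier transform of the sphere decays like `|ξ| ^ (-(d - 1) / 2)`
(`exists_abs_besselInt_le`), and `s > (d + 1) / 2` makes the integral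
`∫ |μ̂ ξ| ^ 2 |ξ| ^ (-(d - 1) / 2) dξ` finite. So the distribution of `‖x - y‖` under `μ × μ` has a
continuous density on `(0, ∞)`, not identically zero (`continuousOn_sphericalForm`,
`exists_sphericalForm_ne_zero`). At a distance `t` where it is nonzero, the restrictions of `μ × μ`
to thin shells `‖x - y‖ ≈ t` converge, after normalisation, to a nonzero symmetric measure `ν` on
the pairs of points of `E` at distance `t`, and for `g` supported in a set of diameter `r`
`∫ f(x) g(y) dν(x, y) ≤ C r ^ ((2 s - d - 1) / 2) ‖f‖ ‖g‖`, with norms in `L²(μ)`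
(`exists_pair_measure`). This forces the fibres of `ν` over almost all `x`, which live on `N x`, to
vanish on all sets of dimension less than `2 s - d - 1` (`ae_condKernel_eq_zero_of_dimH_lt`). Now
`2 s - d - 1 > max (0, d - 3) ≥ k - 1`, while an affine subspace of dimension `k` meets a sphere in
dimension at most `k - 1`. Therefore almost every `N x` lies in no affine subspace of dimension
`k`, and, `ν` being symmetric, neither does the set `A` of those points of `N y` for which this
holds (`exists_not_subset_affine`).
-/

/-! ### Integrals of Bessel type and their decay -/

namespace VCSpheres

open MeasureTheory Real Set Filter Topology

/-- The integral `∫_0^π cos (a cos θ) sin ^ n θ dθ`. Up to a constant, `besselInt n |ξ|` is the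
integral of `exp (i ⟪x, ξ⟫)` over the surface measure of the unit sphere of `ℝ ^ (n + 2)`, that is,
`|ξ| ^ (-n / 2)` times the Bessel function of order `n / 2`. -/
noncomputable def besselInt (n : ℕ) (a : ℝ) : ℝ :=
  ∫ θ in (0:ℝ)..π, cos (a * cos θ) * sin θ ^ n

/-- The derivative of `besselInt n`, as an integral. -/
noncomputable def besselInt' (n : ℕ) (a : ℝ) : ℝ :=
  ∫ θ in (0:ℝ)..π, -(sin (a * cos θ) * cos θ) * sin θ ^ n

lemma abs_besselInt_le (n : ℕ) (a : ℝ) : |besselInt n a| ≤ π := by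
  have := intervalIntegral.norm_integral_le_of_norm_le_const (a := (0:ℝ)) (b := π) (C := 1)
    (f := fun θ => cos (a * cos θ) * sin θ ^ n) ?_
  · simpa [besselInt, abs_of_pos pi_pos] using this
  · intro θ _
    rw [norm_mul, norm_pow]
    exact mul_le_one₀ (abs_cos_le_one _) (by positivity)
      (pow_le_one₀ (norm_nonneg _) (abs_sin_le_one _))

lemma hasDerivAt_besselInt (n : ℕ) (a : ℝ) : HasDerivAt (besselInt n) (besselInt' n a) a := by
  refine (intervalIntegral.hasDerivAt_integral_of_dominated_loc_of_deriv_le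
    (μ := volume) (s := univ) (bound := fun _ => 1)
    (F := fun a θ => cos (a * cos θ) * sin θ ^ n)
    (F' := fun a θ => -(sin (a * cos θ) * cos θ) * sin θ ^ n) Filter.univ_mem ?_ ?_ ?_ ?_ ?_ ?_).2
  · exact Eventually.of_forall fun x => (by fun_prop : Continuous _).aestronglyMeasurable
  · exact (by fun_prop : Continuous _).intervalIntegrable _ _
  · exact (by fun_prop : Continuous _).aestronglyMeasurable
  · refine Eventually.of_forall fun θ _ x _ => ?_
    rw [norm_mul, norm_pow, norm_neg, norm_mul]
    exact mul_le_one₀ (mul_le_one₀ (abs_sin_le_one _) (by positivity) (abs_cos_le_one _))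
      (by positivity) (pow_le_one₀ (norm_nonneg _) (abs_sin_le_one _))
  · exact intervalIntegrable_const
  · refine Eventually.of_forall fun θ _ x _ => ?_
    have := ((hasDerivAt_id x).mul_const (cos θ)).cos.mul_const (sin θ ^ n)
    simpa using this

/-- The Bessel equation `J'' = -J - ((n + 1) / a) J'`. -/
lemma hasDerivAt_besselInt' (n : ℕ) {a : ℝ} (ha : a ≠ 0) :
    HasDerivAt (besselInt' n) (-(besselInt n a) - (n + 1) / a * besselInt' n a) a := by
  have h1 : HasDerivAt (besselInt' n)
      (∫ θ in (0:ℝ)..π, -(cos (a * cos θ) * cos θ * cos θ) * sin θ ^ n) a := by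
    refine (intervalIntegral.hasDerivAt_integral_of_dominated_loc_of_deriv_le
      (μ := volume) (s := univ) (bound := fun _ => 1)
      (F := fun a θ => -(sin (a * cos θ) * cos θ) * sin θ ^ n)
      (F' := fun a θ => -(cos (a * cos θ) * cos θ * cos θ) * sin θ ^ n)
      Filter.univ_mem ?_ ?_ ?_ ?_ ?_ ?_).2
    · exact Eventually.of_forall fun x => (by fun_prop : Continuous _).aestronglyMeasurable
    · exact (by fun_prop : Continuous _).intervalIntegrable _ _
    · exact (by fun_prop : Continuous _).aestronglyMeasurable
    · refine Eventually.of_forall fun θ _ x _ => ?_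
      rw [norm_mul, norm_pow, norm_neg, norm_mul, norm_mul]
      exact mul_le_one₀ (mul_le_one₀ (mul_le_one₀ (abs_cos_le_one _) (by positivity)
        (abs_cos_le_one _)) (by positivity) (abs_cos_le_one _))
        (by positivity) (pow_le_one₀ (norm_nonneg _) (abs_sin_le_one _))
    · exact intervalIntegrable_const
    · refine Eventually.of_forall fun θ _ x _ => ?_
      have := ((((hasDerivAt_id x).mul_const (cos θ)).sin.mul_const (cos θ)).neg).mul_const
        (sin θ ^ n)
      simpa using this
  convert h1 using 1
  -- integrate `∂θ (sin (a cos θ) · sin θ ^ (n + 1))`, which vanishes at both ends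
  have h2 : ∫ θ in (0:ℝ)..π, (-(a * (cos (a * cos θ) * sin θ ^ (n + 2)))
      - (n + 1) * (-(sin (a * cos θ) * cos θ) * sin θ ^ n)) = 0 := by
    rw [intervalIntegral.integral_eq_sub_of_hasDerivAt
      (f := fun θ => sin (a * cos θ) * sin θ ^ (n + 1))]
    · simp
    · intro θ _
      have := (((hasDerivAt_cos θ).const_mul a).sin).mul ((hasDerivAt_sin θ).pow (n + 1))
      refine this.congr_deriv ?_
      simp; ring
    · exact (by fun_prop : Continuous _).intervalIntegrable _ _
  rw [intervalIntegral.integral_sub (by exact (by fun_prop : Continuous _).intervalIntegrable _ _)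
    (by exact (by fun_prop : Continuous _).intervalIntegrable _ _),
    intervalIntegral.integral_neg, intervalIntegral.integral_const_mul,
    intervalIntegral.integral_const_mul] at h2
  have h3 : ∫ θ in (0:ℝ)..π, cos (a * cos θ) * sin θ ^ (n + 2) =
      besselInt n a + ∫ θ in (0:ℝ)..π, -(cos (a * cos θ) * cos θ * cos θ) * sin θ ^ n := by
    rw [besselInt, ← intervalIntegral.integral_add
      (by exact (by fun_prop : Continuous _).intervalIntegrable _ _)
      (by exact (by fun_prop : Continuous _).intervalIntegrable _ _)]
    congr 1; ext θ
    rw [pow_add, sin_sq]; ring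
  rw [h3] at h2
  change -(a * (_ + _)) - ((n:ℝ) + 1) * besselInt' n a = 0 at h2
  generalize (∫ θ in (0:ℝ)..π, -(cos (a * cos θ) * cos θ * cos θ) * sin θ ^ n) = I at h2 ⊢
  field_simp
  linear_combination h2

lemma continuous_besselInt (n : ℕ) : Continuous (besselInt n) :=
  continuous_iff_continuousAt.2 fun a => (hasDerivAt_besselInt n a).continuousAt

/-- Let `m = n + 1`. With `w = J' + m J / (2 a)`, the energy `G = a ^ m (w ^ 2 + J ^ 2)` of the
Bessel equation has a derivative of size at most `(c / a ^ 2) G`, so `G exp (c / a)` is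
nonincreasing and `G` stays bounded as `a → ∞`. -/
lemma exists_besselInt_sq_le (n : ℕ) :
    ∃ C : ℝ, 0 < C ∧ ∀ a : ℝ, 0 < a → a ^ (n + 1) * besselInt n a ^ 2 ≤ C := by
  set m : ℝ := n + 1 with hm
  set c : ℝ := |m / 2 * (m / 2 - 1)| with hc
  set G : ℝ → ℝ := fun a => a ^ (n + 1) *
    ((besselInt' n a + m / (2 * a) * besselInt n a) ^ 2 + besselInt n a ^ 2) with hG
  have hGnn : ∀ a, 0 < a → 0 ≤ G a := fun a ha => by positivity
  set G' : ℝ → ℝ := fun a => a ^ (n + 1) * (2 * (m / 2 * (m / 2 - 1)) / a ^ 2 *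
    ((besselInt' n a + m / (2 * a) * besselInt n a) * besselInt n a)) with hG'
  have hder : ∀ a, 0 < a → HasDerivAt G (G' a) a := by
    intro a ha
    have h1 := hasDerivAt_besselInt n a
    have h2 := hasDerivAt_besselInt' n ha.ne'
    have h3 : HasDerivAt (fun a : ℝ => m / (2 * a)) (-(m / (2 * a ^ 2))) a := by
      have := (((hasDerivAt_id a).const_mul 2).inv (by simpa using ha.ne')).const_mul m
      refine this.congr_deriv ?_
      simp; field_simp
    have := ((hasDerivAt_id a).pow (n + 1)).mul
      ((((h2.add (h3.mul h1))).pow 2).add (h1.pow 2))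
    refine this.congr_deriv ?_
    simp [hG']
    rw [← hm]
    rw [show (a ^ (n+1)) = a ^ n * a from pow_succ a n]
    field_simp
    ring
  set H : ℝ → ℝ := fun a => G a * exp (c / a) with hH
  have hHder : ∀ a, 0 < a → HasDerivAt H ((G' a - c / a ^ 2 * G a) * exp (c / a)) a := by
    intro a ha
    have h3 : HasDerivAt (fun a : ℝ => c / a) (-(c / a ^ 2)) a := by
      have := ((hasDerivAt_id a).inv ha.ne').const_mul c
      refine this.congr_deriv ?_
      simp; field_simp
    refine ((hder a ha).mul h3.exp).congr_deriv ?_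
    ring
  have hanti : AntitoneOn H (Ici 1) := by
    apply antitoneOn_of_deriv_nonpos (convex_Ici 1)
    · exact fun a ha => (hHder a (lt_of_lt_of_le one_pos ha)).continuousAt.continuousWithinAt
    · intro a ha
      rw [interior_Ici] at ha
      exact (hHder a (one_pos.trans ha)).differentiableAt.differentiableWithinAt
    · intro a ha
      rw [interior_Ici] at ha
      have ha0 : 0 < a := one_pos.trans ha
      rw [(hHder a ha0).deriv]
      apply mul_nonpos_of_nonpos_of_nonneg _ (exp_pos _).le
      rw [sub_nonpos]
      set w := besselInt' n a + m / (2 * a) * besselInt n a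
      set v := besselInt n a
      have key : m / 2 * (m / 2 - 1) * (2 * (w * v)) ≤ c * (w ^ 2 + v ^ 2) := by
        calc m / 2 * (m / 2 - 1) * (2 * (w * v)) ≤ |m / 2 * (m / 2 - 1) * (2 * (w * v))| :=
              le_abs_self _
          _ = c * |2 * (w * v)| := by rw [abs_mul]
          _ ≤ c * (w ^ 2 + v ^ 2) := by
              gcongr
              rw [abs_le]
              constructor <;> nlinarith [sq_nonneg (w - v), sq_nonneg (w + v)]
      have : 0 < a ^ (n + 1) / a ^ 2 := by positivity
      calc G' a = a ^ (n + 1) / a ^ 2 * (m / 2 * (m / 2 - 1) * (2 * (w * v))) := by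
            simp only [hG']; ring
        _ ≤ a ^ (n + 1) / a ^ 2 * (c * (w ^ 2 + v ^ 2)) := by gcongr
        _ = c / a ^ 2 * G a := by simp only [hG]; ring
  -- `H 1` bounds the energy on `[1, ∞)`, and `π` bounds `besselInt` everywhere
  refine ⟨H 1 + π ^ 2, ?_, fun a ha => ?_⟩
  · have : 0 ≤ H 1 := mul_nonneg (hGnn 1 one_pos) (exp_pos _).le
    positivity
  · rcases le_total 1 a with h | h
    · have h1 := hanti (mem_Ici.2 le_rfl) (mem_Ici.2 h) h
      have h2 : G a ≤ H a := by
        refine le_mul_of_one_le_right (hGnn a ha) (one_le_exp ?_)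
        positivity
      have h3 : a ^ (n + 1) * besselInt n a ^ 2 ≤ G a := by
        simp only [hG]; gcongr; nlinarith [sq_nonneg (besselInt' n a + m / (2 * a) * besselInt n a)]
      nlinarith [sq_nonneg π]
    · have h1 : a ^ (n + 1) ≤ 1 := pow_le_one₀ ha.le h
      have h2 : besselInt n a ^ 2 ≤ π ^ 2 := by
        rw [← sq_abs]; gcongr; exact abs_besselInt_le n a
      have : 0 ≤ H 1 := mul_nonneg (hGnn 1 one_pos) (exp_pos _).le
      nlinarith [sq_nonneg (besselInt n a)]

/-- The decay `|ξ| ^ (-(d - 1) / 2)` of the Fourier transform of the sphere, `d = n + 2`. -/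
lemma exists_abs_besselInt_le (n : ℕ) :
    ∃ C : ℝ, 0 < C ∧ ∀ a : ℝ, 0 < a → |besselInt n a| ≤ C * a ^ (-((n + 1 : ℝ) / 2)) := by
  obtain ⟨C, hC, h⟩ := exists_besselInt_sq_le n
  refine ⟨√C, by positivity, fun a ha => ?_⟩
  rw [rpow_neg ha.le, ← div_eq_mul_inv, le_div_iff₀ (by positivity)]
  refine abs_le_of_sq_le_sq' ?_ (by positivity) |>.2
  rw [mul_pow, sq_abs, ← rpow_natCast (a ^ _), ← rpow_mul ha.le, sq_sqrt hC.le]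
  have h1 : a ^ ((n + 1 : ℝ) / 2 * (2 : ℕ)) = a ^ (n + 1) := by
    rw [← rpow_natCast]; congr 1; push_cast; ring
  rw [h1, mul_comm]
  exact h a ha

end VCSpheres

/-! ### The Fourier transform of a radial function -/

namespace VCSpheres

open MeasureTheory Real Set Filter Topology

/-- Fubini for the splitting `ℝ ^ (m + 1) = ℝ × ℝ ^ m` by the first coordinate. -/
lemma integral_euclidean_succ (m : ℕ) (f : ℝ → ℝ → ℝ)
    (hf : Integrable (fun p : ℝ × EuclideanSpace ℝ (Fin m) => f p.1 (p.1 ^ 2 + ‖p.2‖ ^ 2))) :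
    ∫ x : EuclideanSpace ℝ (Fin (m + 1)), f (x 0) (‖x‖ ^ 2) =
      ∫ u : ℝ, ∫ w : EuclideanSpace ℝ (Fin m), f u (u ^ 2 + ‖w‖ ^ 2) := by
  have e1 := (PiLp.volume_preserving_toLp (Fin (m + 1))).integral_comp
    (MeasurableEquiv.toLp 2 _).measurableEmbedding
    (fun x : EuclideanSpace ℝ (Fin (m + 1)) => f (x 0) (‖x‖ ^ 2))
  have e2 := (volume_preserving_piFinSuccAbove (fun _ : Fin (m + 1) => ℝ) 0).symm.integral_comp
    (MeasurableEquiv.measurableEmbedding _)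
    (fun x => f (WithLp.toLp 2 x 0) (‖WithLp.toLp 2 x‖ ^ 2))
  have e3 := ((MeasurePreserving.id (volume : Measure ℝ)).prod
    (PiLp.volume_preserving_toLp (Fin m))).integral_comp
    ((MeasurableEquiv.refl ℝ).prodCongr (MeasurableEquiv.toLp 2 (Fin m → ℝ))).measurableEmbedding
    (fun p : ℝ × EuclideanSpace ℝ (Fin m) => f p.1 (p.1 ^ 2 + ‖p.2‖ ^ 2))
  rw [← integral_prod _ hf, ← e1, ← e2]
  refine Eq.trans ?_ e3
  refine integral_congr_ae (Eventually.of_forall fun p => ?_)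
  simp [EuclideanSpace.norm_sq_eq, Fin.sum_univ_succ, MeasurableEquiv.piFinSuccAbove]

/-- Integration of a radial function in polar coordinates. -/
lemma exists_integral_norm_sq (n : ℕ) : ∃ c : ℝ, 0 < c ∧ ∀ Φ : ℝ → ℝ,
    ∫ w : EuclideanSpace ℝ (Fin (n + 1)), Φ (‖w‖ ^ 2) =
      c * ∫ v in Ioi (0 : ℝ), v ^ n * Φ (v ^ 2) := by
  refine ⟨(n + 1) * volume.real (Metric.ball (0 : EuclideanSpace ℝ (Fin (n + 1))) 1), ?_, ?_⟩
  · have : 0 < volume.real (Metric.ball (0 : EuclideanSpace ℝ (Fin (n + 1))) 1) := by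
      rw [measureReal_def]
      exact ENNReal.toReal_pos (Metric.measure_ball_pos _ _ one_pos).ne' measure_ball_lt_top.ne
    positivity
  · intro Φ
    have := integral_fun_norm_addHaar (volume : Measure (EuclideanSpace ℝ (Fin (n + 1))))
      (fun r => Φ (r ^ 2))
    rw [this]
    simp [mul_assoc]

lemma hasCompactSupport_comp_norm_sq {E : Type*} [NormedAddCommGroup E] [ProperSpace E]
    {Φ : ℝ → ℝ} (h : HasCompactSupport Φ) : HasCompactSupport (fun x : E => Φ (‖x‖ ^ 2)) := by
  obtain ⟨R, hR⟩ := h.isCompact.isBounded.subset_closedBall 0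
  refine HasCompactSupport.of_support_subset_isCompact (isCompact_closedBall (0 : E) (|R| + 1)) ?_
  intro x hx
  have := hR (subset_tsupport _ (Function.mem_support.2 hx))
  simp only [Metric.mem_closedBall, dist_zero_right, norm_eq_abs] at this ⊢
  rw [abs_of_nonneg (by positivity)] at this
  nlinarith [le_abs_self R, abs_nonneg R, norm_nonneg x]

/-- Polar coordinates in the half-plane `v > 0`. -/
lemma integral_polar_half (n : ℕ) {Φ : ℝ → ℝ} (hΦ : Continuous Φ) (hc : HasCompactSupport Φ)
    (ρ : ℝ) :
    ∫ u : ℝ, ∫ v in Ioi (0:ℝ), cos (ρ * u) * (v ^ n * Φ (u ^ 2 + v ^ 2)) =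
      ∫ r in Ioi (0:ℝ), Φ (r ^ 2) * r ^ (n + 1) * besselInt n (ρ * r) := by
  have hcs : HasCompactSupport (fun p : ℝ × ℝ =>
      cos (ρ * p.1) * (p.2 ^ n * Φ (p.1 ^ 2 + p.2 ^ 2))) := by
    have h1 : HasCompactSupport (fun p : ℝ × ℝ => Φ (p.1 ^ 2 + p.2 ^ 2)) := by
      obtain ⟨R, hR⟩ := hc.isCompact.isBounded.subset_closedBall 0
      refine HasCompactSupport.of_support_subset_isCompact
        (isCompact_closedBall (0 : ℝ × ℝ) (|R| + 1)) ?_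
      intro x hx
      have := hR (subset_tsupport _ (Function.mem_support.2 hx))
      simp only [Metric.mem_closedBall, dist_zero_right, norm_eq_abs] at this ⊢
      rw [abs_of_nonneg (by positivity)] at this
      rw [Prod.norm_def, max_le_iff, norm_eq_abs, norm_eq_abs]
      constructor <;> apply abs_le_of_sq_le_sq _ (by positivity) <;>
        nlinarith [le_abs_self R, abs_nonneg R, sq_nonneg x.1, sq_nonneg x.2]
    exact h1.mul_left.mul_left
  have hint : Integrable (fun p : ℝ × ℝ => cos (ρ * p.1) * (p.2 ^ n * Φ (p.1 ^ 2 + p.2 ^ 2))) :=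
    (by fun_prop : Continuous _).integrable_of_hasCompactSupport hcs
  set f : ℝ × ℝ → ℝ := (univ ×ˢ Ioi (0:ℝ)).indicator
    (fun p => cos (ρ * p.1) * (p.2 ^ n * Φ (p.1 ^ 2 + p.2 ^ 2))) with hf
  have hfi : Integrable f := hint.indicator (MeasurableSet.univ.prod measurableSet_Ioi)
  have h1 : ∫ u : ℝ, ∫ v in Ioi (0:ℝ), cos (ρ * u) * (v ^ n * Φ (u ^ 2 + v ^ 2)) = ∫ p, f p := by
    rw [Measure.volume_eq_prod, integral_prod _ (by rwa [← Measure.volume_eq_prod])]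
    refine integral_congr_ae (Eventually.of_forall fun u => ?_)
    simp only
    rw [← integral_indicator measurableSet_Ioi]
    refine integral_congr_ae (Eventually.of_forall fun v => ?_)
    by_cases hv : 0 < v <;> simp [hf, indicator, hv]
  rw [h1, ← integral_comp_polarCoord_symm]
  set g : ℝ × ℝ → ℝ := fun p => (Φ (p.1 ^ 2) * p.1 ^ (n + 1)) *
      (cos (ρ * p.1 * cos p.2) * sin p.2 ^ n)
    with hg
  have h2 : ∫ p in polarCoord.target, p.1 • f (polarCoord.symm p) =
      ∫ p in Ioi (0:ℝ) ×ˢ Ioo (-π) π, (univ ×ˢ Ioo 0 π).indicator g p := by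
    refine setIntegral_congr_fun (polarCoord.open_target.measurableSet) ?_
    rintro ⟨r, θ⟩ ⟨hr, hθ⟩
    simp only [mem_Ioi, mem_Ioo] at hr hθ
    simp only [hf, hg, polarCoord_symm_apply, indicator, mem_prod, mem_univ, true_and, mem_Ioi,
      mem_Ioo, smul_eq_mul]
    have : 0 < r * sin θ ↔ 0 < θ ∧ θ < π := by
      rw [mul_pos_iff_of_pos_left hr]
      constructor
      · intro h
        refine ⟨?_, hθ.2⟩
        by_contra! h0
        exact absurd (sin_nonpos_of_nonpos_of_neg_pi_le h0 hθ.1.le) (not_le.2 h)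
      · exact fun h => sin_pos_of_pos_of_lt_pi h.1 h.2
    simp only [this]
    split_ifs with h
    · rw [show (r * cos θ) ^ 2 + (r * sin θ) ^ 2 = r ^ 2 by
        linear_combination r ^ 2 * (sin_sq_add_cos_sq θ)]
      rw [mul_pow]; ring_nf
    · simp
  rw [h2, setIntegral_indicator (MeasurableSet.univ.prod measurableSet_Ioo)]
  have h3 : (Ioi (0:ℝ) ×ˢ Ioo (-π) π) ∩ (univ ×ˢ Ioo 0 π) = Ioi (0:ℝ) ×ˢ Ioo 0 π := by
    ext ⟨r, θ⟩
    simp only [mem_inter_iff, mem_prod, mem_Ioi, mem_Ioo, mem_univ, true_and]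
    have := pi_pos
    constructor
    · rintro ⟨⟨a, b⟩, c⟩; exact ⟨a, c⟩
    · rintro ⟨a, c⟩; exact ⟨⟨a, by linarith [c.1], c.2⟩, c⟩
  rw [h3, Measure.volume_eq_prod, setIntegral_prod]
  · refine setIntegral_congr_fun measurableSet_Ioi fun r _ => ?_
    simp only [hg]
    rw [integral_const_mul, besselInt, intervalIntegral.integral_of_le pi_pos.le,
      integral_Ioc_eq_integral_Ioo]
  · rw [← Measure.volume_eq_prod]
    obtain ⟨R, hR⟩ :=
      (hasCompactSupport_comp_norm_sq (E := ℝ) hc).isCompact.isBounded.subset_closedBall 0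
    have hgc : Continuous g := by fun_prop
    have hK : IsCompact (Metric.closedBall (0:ℝ) R ×ˢ Icc 0 π) :=
      (isCompact_closedBall _ _).prod isCompact_Icc
    have := hgc.continuousOn.integrableOn_compact (μ := volume) hK
    refine (this.of_forall_sdiff_eq_zero
      (measurableSet_Ioi.prod measurableSet_Ioo) ?_)
    rintro ⟨r, θ⟩ ⟨⟨_, hθ⟩, h2⟩
    have : Φ (r ^ 2) = 0 := by
      by_contra h
      apply h2
      refine ⟨hR (subset_tsupport _ ?_), hθ.1.le, hθ.2.le⟩
      simpa using h
    simp [hg, this]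

/-- The Fourier transform of a radial function as an integral over the radius. Rotate `ξ` to the
first axis, use polar coordinates in the orthogonal hyperplane and then in the half-plane that
remains. -/
lemma exists_integral_radial_mul_cos (n : ℕ) : ∃ c : ℝ, 0 < c ∧ ∀ Φ : ℝ → ℝ, Continuous Φ →
    HasCompactSupport Φ → ∀ ξ : EuclideanSpace ℝ (Fin (n + 2)),
    ∫ x : EuclideanSpace ℝ (Fin (n + 2)), Φ (‖x‖ ^ 2) * cos (2 * π * inner ℝ x ξ) =
      c * ∫ r in Ioi (0:ℝ), Φ (r ^ 2) * r ^ (n + 1) * besselInt n (2 * π * ‖ξ‖ * r) := by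
  obtain ⟨c, hc, h⟩ := exists_integral_norm_sq n
  refine ⟨c, hc, fun Φ hΦ hΦc ξ => ?_⟩
  -- rotate `ξ` to the first coordinate axis
  set e : EuclideanSpace ℝ (Fin (n + 2)) := EuclideanSpace.single 0 ‖ξ‖ with he
  set R := Submodule.reflection (Submodule.span ℝ {ξ - e})ᗮ with hR
  have hRξ : R ξ = e := Submodule.reflection_sub (by simp [he])
  have h1 := R.measurePreserving.integral_comp R.toHomeomorph.measurableEmbedding
    (fun x => Φ (‖x‖ ^ 2) * cos (2 * π * inner ℝ x e))
  have h2 : ∀ x, inner ℝ (R x) e = inner ℝ x ξ := fun x => by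
    rw [← hRξ, R.inner_map_map]
  simp only [h2, R.norm_map] at h1
  rw [h1]
  have h3 : ∀ x : EuclideanSpace ℝ (Fin (n + 2)), inner ℝ x e = ‖ξ‖ * x 0 := fun x => by
    simp [he, EuclideanSpace.inner_single_right]
  simp only [h3]
  rw [integral_euclidean_succ (n + 1) (fun u s => Φ s * cos (2 * π * (‖ξ‖ * u)))]
  · rw [← integral_polar_half n hΦ hΦc, ← integral_const_mul]
    refine integral_congr_ae (Eventually.of_forall fun u => ?_)
    simp only
    rw [h (fun s => Φ (u ^ 2 + s) * cos (2 * π * (‖ξ‖ * u)))]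
    congr 1
    refine integral_congr_ae (Eventually.of_forall fun v => ?_)
    simp only
    rw [← mul_assoc (2 * π)]; ring
  · refine (by fun_prop : Continuous _).integrable_of_hasCompactSupport ?_
    refine HasCompactSupport.mul_right ?_
    obtain ⟨M, hM⟩ := hΦc.isCompact.isBounded.subset_closedBall 0
    refine HasCompactSupport.of_support_subset_isCompact
      (isCompact_closedBall (0 : ℝ × EuclideanSpace ℝ (Fin (n + 1))) (|M| + 1)) ?_
    intro x hx
    have := hM (subset_tsupport _ (Function.mem_support.2 hx))
    simp only [Metric.mem_closedBall, dist_zero_right, norm_eq_abs] at this ⊢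
    rw [abs_of_nonneg (by positivity)] at this
    rw [Prod.norm_def, max_le_iff]
    have h4 : ‖x.1‖ ^ 2 = x.1 ^ 2 := by rw [norm_eq_abs, sq_abs]
    constructor <;> apply abs_le_of_sq_le_sq' _ (by positivity) |>.2 <;>
      nlinarith [le_abs_self M, abs_nonneg M, sq_nonneg x.1, sq_nonneg ‖x.2‖]

end VCSpheres

/-! ### Fourier transforms of measures and Riesz energies -/

namespace VCSpheres

open MeasureTheory Real Set Filter Topology
open scoped ENNReal FourierTransform ComplexConjugate

section Fourier
variable {V : Type*} [NormedAddCommGroup V] [InnerProductSpace ℝ V] [MeasurableSpace V]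
  [BorelSpace V]

/-- The Fourier transform of a finite measure, normalised as `∫ exp (2 π i ⟪x, ξ⟫) dρ x`. -/
noncomputable def measureFT (ρ : Measure V) (ξ : V) : ℂ := charFun ρ ((2 * π) • ξ)

lemma measurable_measureFT [SecondCountableTopology V] (ρ : Measure V) [SFinite ρ] :
    Measurable (measureFT ρ) :=
  measurable_charFun.comp (measurable_const_smul _)

lemma integral_cos_sub_eq_re [SecondCountableTopology V] (ρ₁ ρ₂ : Measure V) [IsFiniteMeasure ρ₁]
    [IsFiniteMeasure ρ₂] (ξ : V) :
    ∫ p : V × V, cos (2 * π * inner ℝ (p.1 - p.2) ξ) ∂(ρ₁.prod ρ₂) =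
      (measureFT ρ₁ ξ * conj (measureFT ρ₂ ξ)).re := by
  have h1 : measureFT ρ₁ ξ * conj (measureFT ρ₂ ξ) =
      ∫ p : V × V, Complex.exp ((2 * π * inner ℝ (p.1 - p.2) ξ : ℝ) * Complex.I) ∂(ρ₁.prod ρ₂) := by
    rw [measureFT, measureFT, ← charFun_neg, charFun_apply, charFun_apply, ← integral_prod_mul]
    refine integral_congr_ae (Eventually.of_forall fun p => ?_)
    simp only [← Complex.exp_add]
    congr 1
    rw [inner_neg_right, inner_smul_right, inner_smul_right, inner_sub_left]
    push_cast; ring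
  rw [h1, ← RCLike.re_eq_complex_re, ← integral_re]
  · refine integral_congr_ae (Eventually.of_forall fun p => ?_)
    simp only [RCLike.re_eq_complex_re]
    rw [Complex.exp_ofReal_mul_I_re]
  · refine Integrable.of_bound (C := 1) ?_ ?_
    · exact (by fun_prop : Continuous _).aestronglyMeasurable
    · exact Eventually.of_forall fun p => by rw [Complex.norm_exp_ofReal_mul_I]

lemma integral_prod_eq_integral_fourier [FiniteDimensional ℝ V]
    {ψ Ψ : V → ℝ} (hΨ : Integrable Ψ) (h : ∀ x, ψ x = ∫ ξ, Ψ ξ * cos (2 * π * inner ℝ x ξ))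
    (ρ₁ ρ₂ : Measure V) [IsFiniteMeasure ρ₁] [IsFiniteMeasure ρ₂] :
    ∫ p : V × V, ψ (p.1 - p.2) ∂(ρ₁.prod ρ₂) =
      ∫ ξ, Ψ ξ * (measureFT ρ₁ ξ * conj (measureFT ρ₂ ξ)).re := by
  simp only [h]
  rw [integral_integral_swap]
  · refine integral_congr_ae (Eventually.of_forall fun ξ => ?_)
    simp only
    rw [integral_const_mul, integral_cos_sub_eq_re]
  · have h1 : Integrable (fun q : (V × V) × V => Ψ q.2) ((ρ₁.prod ρ₂).prod volume) := hΨ.comp_snd _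
    refine h1.mono ?_ ?_
    · refine h1.aestronglyMeasurable.mul ?_
      exact (by fun_prop : Continuous (fun q : (V × V) × V =>
        cos (2 * π * inner ℝ (q.1.1 - q.1.2) q.2))).aestronglyMeasurable
    · refine Eventually.of_forall fun q => ?_
      simp only [Function.uncurry]
      rw [norm_mul]
      exact mul_le_of_le_one_right (norm_nonneg _) (abs_cos_le_one _)

lemma abs_re_mul_conj_le (z w : ℂ) : |(z * conj w).re| ≤ ‖z‖ * ‖w‖ := by
  refine (Complex.abs_re_le_norm _).trans ?_
  rw [norm_mul, RCLike.norm_conj]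

lemma re_mul_conj_self (z : ℂ) : (z * conj z).re = ‖z‖ ^ 2 := by
  rw [Complex.mul_conj, Complex.normSq_eq_norm_sq, Complex.ofReal_re]

lemma integrable_exp_neg_mul_norm_sq [FiniteDimensional ℝ V] {b : ℝ} (hb : 0 < b) :
    Integrable (fun v : V => exp (-b * ‖v‖ ^ 2)) := by
  have h := (GaussianFourier.integrable_cexp_neg_mul_sq_norm_add (V := V) (b := (b : ℂ))
    (by simpa using hb) 0 0).norm
  refine h.congr (Eventually.of_forall fun v => ?_)
  simp only [zero_mul, add_zero, Complex.norm_exp]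
  norm_cast

lemma gaussian_eq_integral_cos [FiniteDimensional ℝ V] {b : ℝ} (hb : 0 < b) (x : V) :
    (π / b) ^ (Module.finrank ℝ V / 2 : ℝ) * exp (-π ^ 2 * ‖x‖ ^ 2 / b) =
      ∫ ξ, exp (-b * ‖ξ‖ ^ 2) * cos (2 * π * inner ℝ x ξ) := by
  have h1 := fourier_gaussian_innerProductSpace (V := V) (b := (b : ℂ)) (by simpa using hb) x
  rw [Real.fourier_eq'] at h1
  have h2 : ∀ v : V, (Complex.exp (↑(-2 * π * inner ℝ v x) * Complex.I) •
      Complex.exp (-(b:ℂ) * (‖v‖:ℂ) ^ 2)).re = exp (-b * ‖v‖ ^ 2) * cos (2 * π * inner ℝ x v) := by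
    intro v
    have : Complex.exp (-(b:ℂ) * (‖v‖:ℂ) ^ 2) = ((exp (-b * ‖v‖ ^ 2) : ℝ) : ℂ) := by
      push_cast; rfl
    rw [this, smul_eq_mul, Complex.re_mul_ofReal, Complex.exp_ofReal_mul_I_re, real_inner_comm]
    rw [show -2 * π * inner ℝ x v = -(2 * π * inner ℝ x v) by ring, cos_neg]; ring
  have h3 := congrArg Complex.re h1
  rw [← RCLike.re_eq_complex_re, ← integral_re] at h3
  · simp only [RCLike.re_eq_complex_re] at h3
    simp only [h2] at h3
    rw [h3]
    have : ((π / b : ℂ) ^ (Module.finrank ℝ V / 2 : ℂ) *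
        Complex.exp (-(π:ℂ) ^ 2 * (‖x‖:ℂ) ^ 2 / b)) =
       (((π / b) ^ (Module.finrank ℝ V / 2 : ℝ) * exp (-π ^ 2 * ‖x‖ ^ 2 / b) : ℝ) : ℂ) := by
      push_cast
      rw [Complex.ofReal_cpow (by positivity)]
      push_cast; rfl
    rw [this, Complex.ofReal_re]
  · refine (integrable_exp_neg_mul_norm_sq hb).mono' ?_ ?_
    · exact (by fun_prop : Continuous _).aestronglyMeasurable
    · refine Eventually.of_forall fun v => ?_
      rw [smul_eq_mul, norm_mul, Complex.norm_exp_ofReal_mul_I, one_mul, Complex.norm_exp]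
      norm_cast

/-- The energy identity for a Gaussian kernel. -/
lemma lintegral_gaussian_mul_normSq [FiniteDimensional ℝ V] {b : ℝ} (hb : 0 < b)
    (ρ : Measure V) [IsFiniteMeasure ρ] :
    ∫⁻ ξ, ENNReal.ofReal (exp (-b * ‖ξ‖ ^ 2) * ‖measureFT ρ ξ‖ ^ 2) =
      ∫⁻ x, ∫⁻ y, ENNReal.ofReal ((π / b) ^ (Module.finrank ℝ V / 2 : ℝ) *
        exp (-π ^ 2 * ‖x - y‖ ^ 2 / b)) ∂ρ ∂ρ := by
  have hint : Integrable (fun ξ : V => exp (-b * ‖ξ‖ ^ 2)) := integrable_exp_neg_mul_norm_sq hb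
  have h := integral_prod_eq_integral_fourier hint (gaussian_eq_integral_cos hb) ρ ρ
  simp only [re_mul_conj_self] at h
  have h1 : Integrable (fun ξ : V => exp (-b * ‖ξ‖ ^ 2) * ‖measureFT ρ ξ‖ ^ 2) := by
    refine hint.mul_bdd (c := (ρ.real univ) ^ 2) ?_ ?_
    · exact ((measurable_measureFT ρ).norm.pow_const 2).aestronglyMeasurable
    · refine Eventually.of_forall fun ξ => ?_
      rw [norm_pow, norm_norm]
      gcongr
      exact norm_charFun_le _
  rw [← ofReal_integral_eq_lintegral_ofReal h1 (Eventually.of_forall fun ξ => by positivity), ← h,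
    ofReal_integral_eq_lintegral_ofReal _ (Eventually.of_forall fun ξ => by positivity),
    lintegral_prod]
  · exact (by fun_prop : Measurable _).aemeasurable
  · refine Integrable.of_bound (C := (π / b) ^ (Module.finrank ℝ V / 2 : ℝ)) ?_ ?_
    · exact (by fun_prop : Continuous _).aestronglyMeasurable
    · refine Eventually.of_forall fun p => ?_
      rw [norm_of_nonneg (by positivity)]
      refine mul_le_of_le_one_right (by positivity) (exp_le_one_iff.2 ?_)
      rw [neg_mul, neg_div, neg_nonpos]; positivity

lemma lintegral_rpow_mul_exp {α r : ℝ} (hα : 0 < α) (hr : 0 < r) :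
    ∫⁻ b in Ioi (0:ℝ), ENNReal.ofReal (b ^ (α - 1) * exp (-(r * b))) =
      ENNReal.ofReal (r ^ (-α) * Gamma α) := by
  have h1 := integral_rpow_mul_exp_neg_mul_Ioi hα hr
  rw [← ofReal_integral_eq_lintegral_ofReal, h1, one_div, inv_rpow hr.le, rpow_neg hr.le]
  · by_contra h
    rw [integral_undef h] at h1
    have : 0 < (1 / r) ^ α * Gamma α := mul_pos (by positivity) (Gamma_pos_of_pos hα)
    exact absurd h1 this.ne
  · refine (ae_restrict_iff' measurableSet_Ioi).2 (Eventually.of_forall fun b hb => ?_)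
    have : (0:ℝ) < b := hb
    positivity

lemma lintegral_rpow_mul_exp_inv {α r : ℝ} (hα : 0 < α) (hr : 0 < r) :
    ∫⁻ b in Ioi (0:ℝ), ENNReal.ofReal (b ^ (-α - 1) * exp (-(r / b))) =
      ENNReal.ofReal (r ^ (-α) * Gamma α) := by
  have h1 := integral_rpow_mul_exp_neg_mul_Ioi hα hr
  have h2 := integral_comp_rpow_Ioi (fun t : ℝ => t ^ (α - 1) * exp (-(r * t))) (p := -1)
    (by norm_num)
  have h3 : ∀ x ∈ Ioi (0:ℝ), (|(-1:ℝ)| * x ^ ((-1:ℝ) - 1)) • ((x ^ (-1:ℝ)) ^ (α - 1) *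
      exp (-(r * x ^ (-1 : ℝ)))) = x ^ (-α - 1) * exp (-(r / x)) := by
    intro x hx
    have hx : 0 < x := hx
    rw [← rpow_mul hx.le, smul_eq_mul, abs_neg, abs_one, one_mul, ← mul_assoc, ← rpow_add hx,
      rpow_neg_one]
    congr 2
    ring
  rw [setIntegral_congr_fun measurableSet_Ioi h3, h1] at h2
  rw [← ofReal_integral_eq_lintegral_ofReal, h2, one_div, inv_rpow hr.le, rpow_neg hr.le]
  · by_contra h
    rw [integral_undef h] at h2
    have : 0 < (1 / r) ^ α * Gamma α := mul_pos (by positivity) (Gamma_pos_of_pos hα)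
    exact absurd h2 this.ne
  · refine (ae_restrict_iff' measurableSet_Ioi).2 (Eventually.of_forall fun b hb => ?_)
    have : (0:ℝ) < b := hb
    positivity

/-- The weighted `L²` norm of the Fourier transform is bounded by the Riesz energy with the dual
exponent: both power kernels are superpositions of Gaussians, for which
`lintegral_gaussian_mul_normSq` holds. -/
theorem exists_lintegral_measureFT_le [FiniteDimensional ℝ V] {a : ℝ} (ha : 0 < a)
    (had : a < Module.finrank ℝ V) :
    ∃ C : ℝ≥0∞, C ≠ ∞ ∧ ∀ (ρ : Measure V) [IsFiniteMeasure ρ],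
      ∫⁻ ξ, ENNReal.ofReal (‖ξ‖ ^ (-a) * ‖measureFT ρ ξ‖ ^ 2) ≤
        C * ∫⁻ x, ∫⁻ y, edist x y ^ (a - Module.finrank ℝ V) ∂ρ ∂ρ := by
  set d : ℝ := (Module.finrank ℝ V : ℝ) with hd
  set γ : ℝ := d / 2 - a / 2 with hγ
  have hγ0 : 0 < γ := by rw [hγ]; linarith
  set K : ℝ := π ^ (d / 2) * ((π ^ 2) ^ (-γ) * Gamma γ) with hK
  have hG : 0 < Gamma (a / 2) := Gamma_pos_of_pos (by linarith)
  have hGγ : 0 < Gamma γ := Gamma_pos_of_pos hγ0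
  have hK0 : 0 < K := by positivity
  refine ⟨ENNReal.ofReal K / ENNReal.ofReal (Gamma (a / 2)),
    ENNReal.div_ne_top ENNReal.ofReal_ne_top (by simpa using hG), fun ρ _ => ?_⟩
  rw [← ENNReal.mul_div_right_comm, ENNReal.le_div_iff_mul_le]
  rotate_left
  · left; simpa using hG
  · left; exact ENNReal.ofReal_ne_top
  calc (∫⁻ ξ, ENNReal.ofReal (‖ξ‖ ^ (-a) * ‖measureFT ρ ξ‖ ^ 2)) * ENNReal.ofReal (Gamma (a / 2))
      ≤ ∫⁻ ξ, ∫⁻ b in Ioi (0:ℝ), ENNReal.ofReal (b ^ (a / 2 - 1)) *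
        ENNReal.ofReal (exp (-b * ‖ξ‖ ^ 2) * ‖measureFT ρ ξ‖ ^ 2) := by
        rw [← lintegral_mul_const']
        swap
        · exact ENNReal.ofReal_ne_top
        refine lintegral_mono fun ξ => ?_
        simp only
        -- at `ξ = 0` the left-hand side is `0`, by the convention `0 ^ (-a) = 0`
        rcases eq_or_ne ξ 0 with rfl | hξ
        · simp [zero_rpow (neg_ne_zero.2 ha.ne')]
        have hξ' : 0 < ‖ξ‖ := norm_pos_iff.2 hξ
        have h1 := lintegral_rpow_mul_exp (α := a / 2) (by linarith) (r := ‖ξ‖ ^ 2) (by positivity)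
        calc _ = ENNReal.ofReal ((‖ξ‖ ^ 2) ^ (-(a / 2)) * Gamma (a / 2)) *
              ENNReal.ofReal (‖measureFT ρ ξ‖ ^ 2) := by
              rw [← ENNReal.ofReal_mul (by positivity), ← ENNReal.ofReal_mul (by positivity)]
              congr 1
              rw [← rpow_natCast ‖ξ‖, ← rpow_mul hξ'.le]
              rw [show ((2:ℕ):ℝ) * -(a / 2) = -a by push_cast; ring]; ring
          _ ≤ _ := by
              rw [← h1, ← lintegral_mul_const']
              swap
              · exact ENNReal.ofReal_ne_top
              refine (setLIntegral_congr_fun measurableSet_Ioi fun b hb => ?_).le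
              have hb : (0:ℝ) < b := hb
              rw [← ENNReal.ofReal_mul (by positivity), ← ENNReal.ofReal_mul (by positivity)]
              congr 1
              rw [mul_assoc]
              congr 3
              ring
    _ = ∫⁻ b in Ioi (0:ℝ), ENNReal.ofReal (b ^ (a / 2 - 1)) *
          ∫⁻ x, ∫⁻ y, ENNReal.ofReal
            ((π / b) ^ (d / 2) * exp (-π ^ 2 * ‖x - y‖ ^ 2 / b)) ∂ρ ∂ρ := by
        rw [lintegral_lintegral_swap]
        · refine setLIntegral_congr_fun measurableSet_Ioi fun b hb => ?_
          rw [lintegral_const_mul' _ _ ENNReal.ofReal_ne_top, lintegral_gaussian_mul_normSq hb]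
        · have := measurable_measureFT ρ
          exact (by fun_prop : Measurable _).aemeasurable
    _ = ∫⁻ x, ∫⁻ y, (∫⁻ b in Ioi (0:ℝ), ENNReal.ofReal (b ^ (a / 2 - 1)) *
          ENNReal.ofReal ((π / b) ^ (d / 2) * exp (-π ^ 2 * ‖x - y‖ ^ 2 / b))) ∂ρ ∂ρ := by
        simp_rw [← lintegral_const_mul' _ _ ENNReal.ofReal_ne_top]
        rw [lintegral_lintegral_swap]
        · refine lintegral_congr fun x => ?_
          rw [lintegral_lintegral_swap]
          exact (by fun_prop : Measurable _).aemeasurable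
        · refine Measurable.aemeasurable ?_
          refine Measurable.lintegral_prod_right' (f := fun q : (ℝ × V) × V =>
            ENNReal.ofReal (q.1.1 ^ (a / 2 - 1)) *
            ENNReal.ofReal ((π / q.1.1) ^ (d / 2) * exp (-π ^ 2 * ‖q.1.2 - q.2‖ ^ 2 / q.1.1))) ?_
          fun_prop
    _ ≤ ∫⁻ x, ∫⁻ y, ENNReal.ofReal K * edist x y ^ (a - d) ∂ρ ∂ρ := by
        refine lintegral_mono fun x => lintegral_mono fun y => ?_
        simp only
        rcases eq_or_ne x y with rfl | hxy
        · rw [edist_self, ENNReal.zero_rpow_of_neg (by linarith), ENNReal.mul_top]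
          · exact le_top
          · simpa using hK0
        have hxy' : 0 < ‖x - y‖ := norm_pos_iff.2 (sub_ne_zero.2 hxy)
        have h1 := lintegral_rpow_mul_exp_inv hγ0 (r := π ^ 2 * ‖x - y‖ ^ 2) (by positivity)
        calc _ = ∫⁻ b in Ioi (0:ℝ), ENNReal.ofReal (π ^ (d / 2)) *
              ENNReal.ofReal (b ^ (-γ - 1) * exp (-(π ^ 2 * ‖x - y‖ ^ 2 / b))) := by
              refine setLIntegral_congr_fun measurableSet_Ioi fun b hb => ?_
              have hb : (0:ℝ) < b := hb
              rw [← ENNReal.ofReal_mul (by positivity), ← ENNReal.ofReal_mul (by positivity)]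
              congr 1
              rw [div_rpow pi_pos.le hb.le, neg_mul, neg_div,
                show -γ - 1 = (a / 2 - 1) - d / 2 by rw [hγ]; ring, rpow_sub hb (a / 2 - 1)]
              ring
          _ ≤ _ := by
              rw [lintegral_const_mul' _ _ ENNReal.ofReal_ne_top, h1, edist_dist, dist_eq_norm,
                ENNReal.ofReal_rpow_of_pos hxy', ← ENNReal.ofReal_mul (by positivity),
                ← ENNReal.ofReal_mul (by positivity)]
              apply le_of_eq
              congr 1
              rw [hK, mul_rpow (by positivity) (by positivity), ← rpow_natCast (‖x - y‖),
                ← rpow_mul (norm_nonneg _)]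
              rw [show ((2:ℕ):ℝ) * -γ = a - d by rw [hγ]; push_cast; ring]; ring
    _ = _ := by
        simp_rw [lintegral_const_mul' _ _ ENNReal.ofReal_ne_top]

end Fourier
end VCSpheres

/-! ### Frostman measures -/

namespace VCSpheres

open MeasureTheory Real Set Filter Topology
open scoped ENNReal NNReal

section Frostman
variable {X : Type*} [MetricSpace X]

lemma edist_rpow_neg_le_tsum {s : ℝ} (hs : 0 < s) (x y : X) :
    edist x y ^ (-s) ≤ 1 + ∑' j : ℕ, ENNReal.ofReal (((1 / 2 : ℝ) ^ (j + 1)) ^ (-s)) *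
      (Metric.closedBall x ((1 / 2 : ℝ) ^ j)).indicator 1 y := by
  rcases eq_or_ne x y with rfl | hxy
  · have : ∑' j : ℕ, ENNReal.ofReal (((1 / 2 : ℝ) ^ (j + 1)) ^ (-s)) *
      (Metric.closedBall x ((1 / 2 : ℝ) ^ j)).indicator 1 x = ∞ := by
      rw [← top_le_iff, ← ENNReal.tsum_const_eq_top_of_ne_zero (α := ℕ) one_ne_zero]
      refine ENNReal.tsum_le_tsum fun j => ?_
      rw [indicator_of_mem (Metric.mem_closedBall_self (by positivity)), Pi.one_apply, mul_one,
        ENNReal.one_le_ofReal]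
      exact one_le_rpow_of_pos_of_le_one_of_nonpos (by positivity)
        (pow_le_one₀ (by norm_num) (by norm_num)) (by linarith)
    rw [this]; simp
  have h0 : 0 < dist x y := dist_pos.2 hxy
  rw [edist_dist, ENNReal.ofReal_rpow_of_pos h0]
  rcases le_total 1 (dist x y) with h1 | h1
  · refine le_trans ?_ le_self_add
    rw [ENNReal.ofReal_le_one]
    exact rpow_le_one_of_one_le_of_nonpos h1 (by linarith)
  · obtain ⟨j, hj1, hj2⟩ := exists_nat_pow_near_of_lt_one h0 h1
      (by norm_num : (0:ℝ) < 1 / 2) (by norm_num)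
    refine le_trans ?_ le_add_self
    refine le_trans ?_ (ENNReal.le_tsum j)
    rw [indicator_of_mem (by rwa [Metric.mem_closedBall, dist_comm]), Pi.one_apply, mul_one]
    exact ENNReal.ofReal_le_ofReal (rpow_le_rpow_of_nonpos (by positivity) hj1.le (by linarith))

variable [MeasurableSpace X] [BorelSpace X]

/-- If the balls centred at `x` of radius `r ≤ 1` have measure at most `η r ^ q` with `q > s`, then
the potential of order `s` at `x` is bounded in terms of `η` and the total mass. -/
lemma exists_lintegral_edist_rpow_le {s q : ℝ} (hs : 0 < s) (hq : s < q) :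
    ∃ K : ℝ≥0∞, K ≠ ∞ ∧ ∀ (η : ℝ≥0∞) (ρ : Measure X) (x : X),
      (∀ r : ℝ, 0 < r → r ≤ 1 → ρ (Metric.closedBall x r) ≤ η * ENNReal.ofReal (r ^ q)) →
      ∫⁻ y, edist x y ^ (-s) ∂ρ ≤ ρ univ + η * K := by
  refine ⟨∑' j : ℕ, ENNReal.ofReal (2 ^ s * (2 ^ (s - q)) ^ j), ?_, fun η ρ x h => ?_⟩
  · refine Summable.tsum_ofReal_ne_top (Summable.mul_left _ ?_)
    refine summable_geometric_of_lt_one (by positivity) ?_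
    exact rpow_lt_one_of_one_lt_of_neg (by norm_num) (by linarith)
  · calc ∫⁻ y, edist x y ^ (-s) ∂ρ ≤ ∫⁻ y, (1 + ∑' j : ℕ,
          ENNReal.ofReal (((1 / 2 : ℝ) ^ (j + 1)) ^ (-s)) *
          (Metric.closedBall x ((1 / 2 : ℝ) ^ j)).indicator 1 y) ∂ρ :=
          lintegral_mono fun y => edist_rpow_neg_le_tsum hs x y
      _ = ρ univ + ∑' j : ℕ, ENNReal.ofReal (((1 / 2 : ℝ) ^ (j + 1)) ^ (-s)) *
          ρ (Metric.closedBall x ((1 / 2 : ℝ) ^ j)) := by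
          have hm : ∀ j : ℕ, Measurable ((Metric.closedBall x ((1 / 2 : ℝ) ^ j)).indicator
            (1 : X → ℝ≥0∞)) := fun j => measurable_one.indicator
              Metric.isClosed_closedBall.measurableSet
          rw [lintegral_add_left measurable_const, lintegral_one, lintegral_tsum]
          · congr 2; ext j
            rw [lintegral_const_mul _ (hm j), lintegral_indicator_one
              Metric.isClosed_closedBall.measurableSet]
          · exact fun j => ((hm j).const_mul _).aemeasurable
      _ ≤ _ := by
          gcongr
          rw [← ENNReal.tsum_mul_left]
          refine ENNReal.tsum_le_tsum fun j => ?_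
          have h1 := h ((1 / 2) ^ j) (by positivity) (pow_le_one₀ (by norm_num) (by norm_num))
          grw [h1]
          rw [mul_left_comm, ← ENNReal.ofReal_mul (by positivity)]
          apply le_of_eq
          congr 2
          rw [one_div, inv_pow, inv_pow, ← rpow_natCast, ← rpow_natCast, ← rpow_natCast,
            ← rpow_neg (by norm_num), ← rpow_neg (by norm_num), ← rpow_mul (by norm_num),
            ← rpow_mul (by norm_num), ← rpow_mul (by norm_num), ← rpow_add (by norm_num),
            ← rpow_add (by norm_num)]
          congr 1; push_cast; ring

/-- If each point of `E` is the centre of a ball of radius `r ≤ 1` and of measure at least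
`η r ^ q`, then Vitali's covering lemma yields a countable cover of `E` whose `q`-dimensional sum
is at most `10 ^ q / η`. -/
lemma exists_countable_cover_of_measure_closedBall {E : Set X} {q : ℝ} (hq : 0 < q) {η : ℝ}
    (hη : 0 < η) (ρ : Measure X) [IsProbabilityMeasure ρ]
    (h : ∀ x ∈ E, ∃ r : ℝ, 0 < r ∧ r ≤ 1 ∧
      ENNReal.ofReal (η * r ^ q) ≤ ρ (Metric.closedBall x r)) :
    ∃ u : Set X, u.Countable ∧ ∃ t : X → Set X, E ⊆ ⋃ i : u, t i ∧
      (∑' i : u, Metric.ediam (t i) ^ q ≤ ENNReal.ofReal (10 ^ q / η)) := by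
  choose! r hr0 hr1 hr using h
  obtain ⟨u, huE, hdisj, hcov⟩ := Vitali.exists_disjoint_subfamily_covering_enlargement_closedBall
    E id r 1 hr1 5 (by norm_num)
  have hpos : ∀ x ∈ E, 0 < ρ (Metric.closedBall x (r x)) := fun x hx =>
    lt_of_lt_of_le (ENNReal.ofReal_pos.2 (mul_pos hη (rpow_pos_of_pos (hr0 x hx) _))) (hr x hx)
  have hd : Pairwise (Function.onFun Disjoint fun i : u => Metric.closedBall (i : X) (r i)) := by
    intro i j hij
    exact hdisj i.2 j.2 (fun h => hij (Subtype.ext h))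
  have hm : ∀ i : u, MeasurableSet (Metric.closedBall (i : X) (r i)) :=
    fun i => Metric.isClosed_closedBall.measurableSet
  have hcount : u.Countable := by
    have h1 := Measure.countable_meas_pos_of_disjoint_iUnion (μ := ρ) hm hd
    have h2 : {i : u | 0 < ρ (Metric.closedBall (i : X) (r i))} = univ :=
      eq_univ_of_forall fun i => hpos i (huE i.2)
    rw [h2] at h1
    exact countable_coe_iff.1 (countable_univ_iff.1 h1)
  have := hcount.to_subtype
  refine ⟨u, hcount, fun x => Metric.closedBall x (5 * r x), ?_, ?_⟩
  · intro x hx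
    obtain ⟨b, hb, hsub⟩ := hcov x hx
    exact mem_iUnion.2 ⟨⟨b, hb⟩, hsub (Metric.mem_closedBall_self (hr0 x hx).le)⟩
  · calc ∑' i : u, Metric.ediam (Metric.closedBall (i : X) (5 * r i)) ^ q
        ≤ ∑' i : u, ENNReal.ofReal (10 ^ q / η) * ρ (Metric.closedBall (i : X) (r i)) := by
          refine ENNReal.tsum_le_tsum fun i => ?_
          have hri := hr0 i (huE i.2)
          have h1 : Metric.ediam (Metric.closedBall (i : X) (5 * r i)) ≤
              ENNReal.ofReal (10 * r i) := by
            rw [← Metric.closedEBall_ofReal (by positivity)]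
            refine Metric.ediam_closedEBall_le.trans ?_
            rw [← ENNReal.ofReal_ofNat 2, ← ENNReal.ofReal_mul (by norm_num)]
            exact ENNReal.ofReal_le_ofReal (by linarith)
          grw [h1, ← hr i (huE i.2)]
          rw [ENNReal.ofReal_rpow_of_pos (by positivity), ← ENNReal.ofReal_mul (by positivity)]
          refine ENNReal.ofReal_le_ofReal (le_of_eq ?_)
          rw [mul_rpow (by norm_num) hri.le]; field_simp
      _ = ENNReal.ofReal (10 ^ q / η) * ρ (⋃ i : u, Metric.closedBall (i : X) (r i)) := by
          rw [ENNReal.tsum_mul_left, measure_iUnion hd hm]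
      _ ≤ _ := by
          grw [prob_le_one]; simp

open Measure in
lemma hausdorffMeasure_eq_zero_of_forall_cover {E : Set X} {q : ℝ} (hq : 0 < q)
    (h : ∀ ε : ℝ≥0∞, 0 < ε → ∃ u : Set X, u.Countable ∧ ∃ t : X → Set X, E ⊆ ⋃ i : u, t i ∧
      (∑' i : u, Metric.ediam (t i) ^ q ≤ ε)) : μH[q] E = 0 := by
  choose u hu t ht hsum using fun n : ℕ => h ((1 / 2 : ℝ≥0∞) ^ n)
    (ENNReal.pow_pos (by simp) n)
  have : ∀ n, Countable (u n) := fun n => (hu n).to_subtype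
  have htend : Tendsto (fun n : ℕ => (1 / 2 : ℝ≥0∞) ^ n) atTop (𝓝 0) :=
    ENNReal.tendsto_pow_atTop_nhds_zero_of_lt_one (by simp)
  have htend' : Tendsto (fun n : ℕ => ((1 / 2 : ℝ≥0∞) ^ n) ^ q⁻¹) atTop (𝓝 0) := by
    have := (ENNReal.continuous_rpow_const (y := q⁻¹)).tendsto 0
    rw [ENNReal.zero_rpow_of_pos (by positivity)] at this
    exact this.comp htend
  have h1 := hausdorffMeasure_le_liminf_tsum q E _ htend' (fun n (i : u n) => t n i)
    (Eventually.of_forall fun n i => ?_) (Eventually.of_forall ht)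
  · rw [← nonpos_iff_eq_zero]
    refine h1.trans ?_
    rw [← htend.liminf_eq]
    exact liminf_le_liminf (Eventually.of_forall hsum)
  · rw [← ENNReal.rpow_rpow_inv hq.ne' (Metric.ediam (t n i))]
    gcongr
    exact (ENNReal.le_tsum i).trans (hsum n)

variable {Y : Type*} [MetricSpace Y] [CompactSpace Y] [MeasurableSpace Y] [BorelSpace Y]

/-- A minimax alternative for the kernel `edist x y ^ (-s)` on a compact space: either some nonzero
finite measure has a bounded potential, or some probability measure has a potential that exceeds
`C` everywhere. It comes from separating, in the space of continuous functions, the open convex set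
of functions greater than `C` from the convex hull of the functions dominated by some
`edist y x ^ (-s)`; a separating functional is, up to sign, a measure of the first kind, and a
common element is a finite combination of point masses of the second kind. -/
lemma exists_measure_lintegral_edist_le_or (s C : ℝ) (hC : 0 ≤ C) [Nonempty Y] :
    (∃ μ : Measure Y, IsFiniteMeasure μ ∧ μ ≠ 0 ∧ ∃ D : ℝ≥0∞, D ≠ ∞ ∧
      ∀ y, ∫⁻ x, edist y x ^ (-s) ∂μ ≤ D) ∨
    (∃ ρ : Measure Y, IsProbabilityMeasure ρ ∧
      ∀ x, ENNReal.ofReal C < ∫⁻ y, edist x y ^ (-s) ∂ρ) := by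
  set S : Set C(Y, ℝ) := {f | ∃ y, ∀ x, ENNReal.ofReal (f x) ≤ edist y x ^ (-s)} with hS
  set O : Set C(Y, ℝ) := {f | ∀ x, C < f x} with hO
  by_cases hdisj : Disjoint O (convexHull ℝ S)
  · left
    have hOc : Convex ℝ O := by
      intro f hf g hg a b ha hb hab x
      have h1 := hf x
      have h2 := hg x
      simp only [ContinuousMap.add_apply, ContinuousMap.smul_apply, smul_eq_mul]
      rcases eq_or_lt_of_le ha with rfl | ha'
      · have : b = 1 := by linarith
        simp [this, h2]
      · nlinarith
    have hOo : IsOpen O := by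
      have : O = {f : C(Y, ℝ) | MapsTo f univ (Ioi C)} := by
        ext f; simp [hO, MapsTo]
      rw [this]
      exact ContinuousMap.isOpen_setOfPred_mapsTo isCompact_univ isOpen_Ioi
    obtain ⟨L, u, hLO, hLS⟩ := geometric_hahn_banach_open hOc hOo (convex_convexHull ℝ S) hdisj
    have hu : u ≤ 0 := by
      have : (0 : C(Y, ℝ)) ∈ convexHull ℝ S := subset_convexHull ℝ S
        ⟨Classical.arbitrary Y, fun x => by simp⟩
      simpa using hLS 0 this
    set c : C(Y, ℝ) := ContinuousMap.const Y (C + 1) with hc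
    have hcO : ∀ (g : C(Y, ℝ)), 0 ≤ g → ∀ n : ℝ, 0 ≤ n → L c + n * L g < u := by
      intro g hg n hn
      have : c + n • g ∈ O := by
        intro x
        have : 0 ≤ g x := hg x
        simp only [hc, ContinuousMap.add_apply, ContinuousMap.smul_apply, smul_eq_mul,
          ContinuousMap.const_apply]
        nlinarith [mul_nonneg hn this]
      simpa using hLO _ this
    -- `O` is stable under addition of nonnegative functions, on which `L` is therefore nonpositive
    have hLneg : ∀ g : C(Y, ℝ), 0 ≤ g → L g ≤ 0 := by
      intro g hg
      by_contra! hpos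
      have := hcO g hg ((u - L c) / L g) (div_nonneg (by linarith [hcO g hg 0 le_rfl]) hpos.le)
      rw [div_mul_cancel₀ _ hpos.ne'] at this
      linarith
    let Λ : CompactlySupportedContinuousMap Y ℝ →ₚ[ℝ] ℝ := PositiveLinearMap.mk₀
      { toFun := fun f => -(L f.toContinuousMap)
        map_add' := fun f g => by
          have : (f + g).toContinuousMap = f.toContinuousMap + g.toContinuousMap := rfl
          rw [this, map_add]; ring
        map_smul' := fun r f => by
          have : (r • f).toContinuousMap = r • f.toContinuousMap := rfl
          rw [this, map_smul]; simp }
      (fun f hf => by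
        have := hLneg f.toContinuousMap hf
        change 0 ≤ -(L f.toContinuousMap)
        linarith)
    have hΛ : ∀ f : C(Y, ℝ), ∫ x, f x ∂(RealRMK.rieszMeasure Λ) = -(L f) := fun f =>
      RealRMK.integral_rieszMeasure Λ ⟨f, HasCompactSupport.of_compactSpace _⟩
    refine ⟨RealRMK.rieszMeasure Λ, inferInstance, ?_, ENNReal.ofReal (-u),
      ENNReal.ofReal_ne_top, ?_⟩
    · intro h0
      have h1 := hΛ c
      rw [h0, integral_zero_measure] at h1
      have := hcO 0 le_rfl 0 le_rfl
      simp at this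
      linarith
    · intro y
      have hlim : ∀ x : Y, edist y x ^ (-s) = ⨆ n : ℕ, min (edist y x ^ (-s)) n := by
        intro x
        rw [← inf_iSup_eq, ENNReal.iSup_natCast, inf_top_eq]
      have hcont : ∀ n : ℕ, Continuous (fun x : Y => min (edist y x ^ (-s)) (n : ℝ≥0∞)) := fun n =>
        (ENNReal.continuous_rpow_const.comp (continuous_const.edist continuous_id)).min
          continuous_const
      have hne : ∀ (n : ℕ) x, min (edist y x ^ (-s)) (n : ℝ≥0∞) ≠ ∞ := fun n x =>
        ne_top_of_le_ne_top (ENNReal.natCast_ne_top n) (min_le_right _ _)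
      -- the truncations of the potential are continuous functions in `S`
      rw [lintegral_congr hlim]
      rw [lintegral_iSup (fun n => (hcont n).measurable)]
      · refine iSup_le fun n => ?_
        let f : C(Y, ℝ) := ⟨fun x => (min (edist y x ^ (-s)) (n : ℝ≥0∞)).toReal,
          continuous_iff_continuousAt.2 fun x =>
            (ENNReal.tendsto_toReal (hne n x)).comp (hcont n).continuousAt⟩
        have hf : ∀ x, ENNReal.ofReal (f x) = min (edist y x ^ (-s)) n := fun x =>
          ENNReal.ofReal_toReal (hne n x)
        have hfS : f ∈ convexHull ℝ S := subset_convexHull ℝ S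
          ⟨y, fun x => by rw [hf]; exact min_le_left _ _⟩
        simp_rw [← hf]
        rw [← ofReal_integral_eq_lintegral_ofReal, hΛ]
        · exact ENNReal.ofReal_le_ofReal (neg_le_neg (hLS f hfS))
        · exact (BoundedContinuousFunction.mkOfCompact f).integrable _
        · exact Eventually.of_forall fun x => ENNReal.toReal_nonneg
      · intro m n hmn x
        exact min_le_min le_rfl (by exact_mod_cast hmn)
  · right
    obtain ⟨f, hfO, hfS⟩ := not_disjoint_iff.1 hdisj
    obtain ⟨ι, _, w, z, hw0, hw1, hz, rfl⟩ := mem_convexHull_iff_exists_fintype.1 hfS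
    choose y hy using hz
    refine ⟨∑ i, ENNReal.ofReal (w i) • Measure.dirac (y i), ⟨?_⟩, fun x => ?_⟩
    · simp only [Measure.coe_finsetSum, Measure.coe_smul, Finset.sum_apply, Pi.smul_apply,
        measure_univ, smul_eq_mul, mul_one]
      rw [← ENNReal.ofReal_sum_of_nonneg (fun i _ => hw0 i), hw1, ENNReal.ofReal_one]
    · rw [lintegral_finsetSum_measure]
      simp only [lintegral_smul_measure, smul_eq_mul]
      have hlt : C < ∑ i, w i * z i x := by simpa using hfO x
      calc ENNReal.ofReal C < ENNReal.ofReal (∑ i, w i * z i x) :=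
            (ENNReal.ofReal_lt_ofReal_iff_of_nonneg hC).2 hlt
        _ ≤ ∑ i, ENNReal.ofReal (w i) * ENNReal.ofReal (z i x) := by
            simp_rw [← fun i => ENNReal.ofReal_mul (hw0 i) (q := z i x)]
            exact Finset.le_sum_of_subadditive _ ENNReal.ofReal_zero.le
              (fun _ _ => ENNReal.ofReal_add_le) _ _
        _ ≤ _ := by
            refine Finset.sum_le_sum fun i _ => ?_
            gcongr
            rw [lintegral_dirac' _ (by fun_prop), edist_comm]
            exact hy i x

/-- **Frostman's lemma**, in its potential form: a compact set of dimension greater than `s`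
carries a nonzero finite measure whose potential of order `s` is bounded on the set. Otherwise the
minimax alternative provides probability measures with arbitrarily large potentials at all points
of the set, hence with balls of large measure around all points, and covers which show that the
Hausdorff measure of some dimension `q > s` is zero. -/
theorem exists_frostman_measure {E : Set X} (hE : IsCompact E) {s : ℝ} (hs : 0 < s)
    (hdim : ENNReal.ofReal s < dimH E) :
    ∃ μ : Measure X, IsFiniteMeasure μ ∧ μ ≠ 0 ∧ μ Eᶜ = 0 ∧ ∃ D : ℝ≥0∞, D ≠ ∞ ∧
      ∀ y ∈ E, ∫⁻ x, edist y x ^ (-s) ∂μ ≤ D := by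
  have hne : E.Nonempty := by
    by_contra h
    rw [not_nonempty_iff_eq_empty.1 h] at hdim
    simp at hdim
  have := hne.to_subtype
  have := isCompact_iff_compactSpace.1 hE
  by_cases hex : ∃ μ : Measure E, IsFiniteMeasure μ ∧ μ ≠ 0 ∧ ∃ D : ℝ≥0∞, D ≠ ∞ ∧
      ∀ y, ∫⁻ x, edist y x ^ (-s) ∂μ ≤ D
  · obtain ⟨μ, hfin, hμ0, D, hD, h⟩ := hex
    have hemb := MeasurableEmbedding.subtype_coe hE.measurableSet
    refine ⟨μ.map Subtype.val, inferInstance, ?_, ?_, D, hD, fun y hy => ?_⟩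
    · rwa [Ne, Measure.map_eq_zero_iff hemb.measurable.aemeasurable]
    · rw [hemb.map_apply]; simp
    · rw [hemb.lintegral_map]
      exact h ⟨y, hy⟩
  exfalso
  obtain ⟨q', hq1, hq2⟩ := ENNReal.lt_iff_exists_nnreal_btwn.1 hdim
  set q : ℝ := (q' : ℝ) with hq
  have hsq : s < q := by
    rw [ENNReal.ofReal_lt_coe_iff hs.le] at hq1
    exact hq1
  have hq0 : 0 < q := hs.trans hsq
  obtain ⟨K, hK, hball⟩ := exists_lintegral_edist_rpow_le (X := E) hs hsq
  have hzero : Measure.hausdorffMeasure q (univ : Set E) = 0 := by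
    refine hausdorffMeasure_eq_zero_of_forall_cover hq0 fun ε hε => ?_
    -- balls of measure `η r ^ q` give a cover with `q`-dimensional sum `10 ^ q / η ≤ ε`
    obtain ⟨η, hη, hηε⟩ : ∃ η : ℝ, 0 < η ∧ ENNReal.ofReal (10 ^ q / η) ≤ ε := by
      rcases eq_or_ne ε ∞ with rfl | hε'
      · exact ⟨1, one_pos, le_top⟩
      · have h1 : 0 < ε.toReal := ENNReal.toReal_pos hε.ne' hε'
        refine ⟨10 ^ q / ε.toReal, by positivity, ?_⟩
        rw [div_div_cancel₀ (by positivity), ENNReal.ofReal_toReal hε']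
    rcases exists_measure_lintegral_edist_le_or (Y := E) s (1 + ENNReal.ofReal η * K).toReal
      ENNReal.toReal_nonneg with h | ⟨ρ, hρ, h⟩
    · exact absurd h hex
    obtain ⟨u, hu, t, ht, hsum⟩ := exists_countable_cover_of_measure_closedBall
      (E := (univ : Set E)) hq0 hη ρ fun x _ => by
        by_contra! hcon
        have h2 := hball (ENNReal.ofReal η) ρ x fun r hr0 hr1 => by
          rw [← ENNReal.ofReal_mul hη.le]
          exact (hcon r hr0 hr1).le
        have h3 := h x
        rw [ENNReal.ofReal_toReal (ENNReal.add_ne_top.2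
          ⟨ENNReal.one_ne_top, ENNReal.mul_ne_top ENNReal.ofReal_ne_top hK⟩)] at h3
        rw [measure_univ] at h2
        exact absurd h2 (not_le.2 h3)
    exact ⟨u, hu, t, ht, hsum.trans hηε⟩
  have h1 : dimH (univ : Set E) ≤ q' := by
    apply dimH_le_of_hausdorffMeasure_ne_top
    rw [← hq, hzero]; simp
  have h2 : dimH E = dimH (univ : Set E) := by
    conv_lhs => rw [← Subtype.range_coe (s := E), ← image_univ]
    exact isometry_subtype_coe.dimH_image _
  rw [h2] at hq2
  exact absurd h1 (not_le.2 hq2)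

end Frostman
end VCSpheres

/-! ### Fourier inversion for radial functions; estimates for Riesz energies -/

namespace VCSpheres

open MeasureTheory Real Set Filter Topology
open scoped ENNReal NNReal FourierTransform ComplexConjugate ContDiff

section RadialFourier
variable {V : Type*} [NormedAddCommGroup V] [InnerProductSpace ℝ V] [MeasurableSpace V]
  [BorelSpace V] [FiniteDimensional ℝ V]

/-- Fourier inversion for smooth compactly supported functions of `‖x‖ ^ 2`, with cosines. -/
lemma fourier_inversion_radial {Φ : ℝ → ℝ} (hΦ : ContDiff ℝ ∞ Φ) (hc : HasCompactSupport Φ) :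
    Integrable (fun ξ : V => ∫ x : V, Φ (‖x‖ ^ 2) * cos (2 * π * inner ℝ x ξ)) ∧
    ∀ x : V, Φ (‖x‖ ^ 2) =
      ∫ ξ : V, (∫ y : V, Φ (‖y‖ ^ 2) * cos (2 * π * inner ℝ y ξ)) * cos (2 * π * inner ℝ x ξ) := by
  have hsm : ContDiff ℝ ∞ (fun x : V => ((Φ (‖x‖ ^ 2) : ℝ) : ℂ)) :=
    Complex.ofRealCLM.contDiff.comp (hΦ.comp (contDiff_norm_sq ℝ))
  have hcs : HasCompactSupport (fun x : V => ((Φ (‖x‖ ^ 2) : ℝ) : ℂ)) :=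
    (hasCompactSupport_comp_norm_sq hc).comp_left (g := fun r : ℝ => (r : ℂ)) (by simp)
  set f : SchwartzMap V ℂ := hcs.toSchwartzMap hsm with hf
  have hfx : ∀ x, f x = ((Φ (‖x‖ ^ 2) : ℝ) : ℂ) := fun x => rfl
  set Ψ : V → ℝ := fun ξ => ∫ x : V, Φ (‖x‖ ^ 2) * cos (2 * π * inner ℝ x ξ) with hΨ
  have hcont : Continuous (fun x : V => Φ (‖x‖ ^ 2)) := by
    have := hΦ.continuous; fun_prop
  have hFT : ∀ ξ, 𝓕 (f : V → ℂ) ξ = (Ψ ξ : ℂ) := by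
    intro ξ
    rw [Real.fourier_eq']
    have h1 : Integrable (fun x : V => Φ (‖x‖ ^ 2) * cos (2 * π * inner ℝ x ξ)) :=
      (by fun_prop : Continuous _).integrable_of_hasCompactSupport
        (hasCompactSupport_comp_norm_sq hc).mul_right
    have h2 : Integrable (fun x : V => Φ (‖x‖ ^ 2) * sin (2 * π * inner ℝ x ξ)) :=
      (by fun_prop : Continuous _).integrable_of_hasCompactSupport
        (hasCompactSupport_comp_norm_sq hc).mul_right
    -- the sine transform of an even function vanishes
    have h3 : ∫ x : V, Φ (‖x‖ ^ 2) * sin (2 * π * inner ℝ x ξ) = 0 := by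
      have h := integral_neg_eq_self (fun x : V => Φ (‖x‖ ^ 2) * sin (2 * π * inner ℝ x ξ)) volume
      simp only [norm_neg, inner_neg_left, mul_neg, sin_neg, integral_neg] at h
      linarith
    have h4 : ∀ x : V, Complex.exp (↑(-2 * π * inner ℝ x ξ) * Complex.I) • f x =
        ((Φ (‖x‖ ^ 2) * cos (2 * π * inner ℝ x ξ) : ℝ) : ℂ) -
          ((Φ (‖x‖ ^ 2) * sin (2 * π * inner ℝ x ξ) : ℝ) : ℂ) * Complex.I := by
      intro x
      rw [hfx, Complex.exp_mul_I, ← Complex.ofReal_cos, ← Complex.ofReal_sin,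
        show -2 * π * inner ℝ x ξ = -(2 * π * inner ℝ x ξ) by ring, cos_neg, sin_neg, smul_eq_mul]
      push_cast; ring
    simp_rw [h4]
    rw [integral_sub h1.ofReal (h2.ofReal.mul_const _), integral_mul_const, integral_complex_ofReal,
      integral_complex_ofReal, h3]
    simp [hΨ]
  have hint : Integrable (𝓕 (f : V → ℂ)) := by
    rw [← SchwartzMap.fourier_coe]
    exact SchwartzMap.integrable _
  have hΨint : Integrable Ψ := by
    refine hint.re.congr (Eventually.of_forall fun ξ => ?_)
    simp [hFT]
  refine ⟨hΨint, fun x => ?_⟩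
  have hinv := congrFun (Continuous.fourierInv_fourier_eq f.continuous f.integrable hint) x
  rw [Real.fourierInv_eq'] at hinv
  have h5 := congrArg Complex.re hinv
  rw [hfx, Complex.ofReal_re] at h5
  rw [← h5, ← RCLike.re_eq_complex_re, ← integral_re]
  · refine integral_congr_ae (Eventually.of_forall fun ξ => ?_)
    simp only [RCLike.re_eq_complex_re]
    rw [hFT, smul_eq_mul, Complex.re_mul_ofReal, Complex.exp_ofReal_mul_I_re, mul_comm,
      real_inner_comm]
  · refine hint.mono ?_ ?_
    · have : Continuous fun ξ : V => Complex.exp (↑(2 * π * inner ℝ ξ x) * Complex.I) := by fun_prop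
      exact this.aestronglyMeasurable.smul hint.aestronglyMeasurable
    · refine Eventually.of_forall fun ξ => ?_
      rw [norm_smul, Complex.norm_exp_ofReal_mul_I, one_mul]

end RadialFourier

section Energy
variable {V : Type*} [NormedAddCommGroup V] [MeasurableSpace V]

/-- The Riesz energy `∬ |x - y| ^ (-s) dρ x dρ y`. -/
noncomputable def rieszEnergy (s : ℝ) (ρ : Measure V) : ℝ≥0∞ :=
  ∫⁻ x, ∫⁻ y, edist x y ^ (-s) ∂ρ ∂ρ

/-- On a set of diameter `R`, lowering the exponent of the energy from `s` to `σ` gains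
`R ^ (s - σ)`. -/
lemma rieszEnergy_le_of_dist_le {s σ R : ℝ} (hR : 0 < R) (hs : 0 < s) (h : σ ≤ s)
    {ρ : Measure V} (hd : ∀ᵐ x ∂ρ, ∀ᵐ y ∂ρ, dist x y ≤ R) :
    rieszEnergy σ ρ ≤ ENNReal.ofReal (R ^ (s - σ)) * rieszEnergy s ρ := by
  rw [rieszEnergy, rieszEnergy, ← lintegral_const_mul' _ _ ENNReal.ofReal_ne_top]
  refine lintegral_mono_ae ?_
  filter_upwards [hd] with x hx
  rw [← lintegral_const_mul' _ _ ENNReal.ofReal_ne_top]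
  refine lintegral_mono_ae ?_
  filter_upwards [hx] with y hy
  -- on the diagonal the right-hand side is infinite
  rcases eq_or_ne x y with rfl | hxy
  · rw [edist_self, ENNReal.zero_rpow_of_neg (y := -s) (by linarith), ENNReal.mul_top]
    · exact le_top
    · simpa using rpow_pos_of_pos hR _
  have h0 : 0 < dist x y := dist_pos.2 hxy
  rw [edist_dist, ENNReal.ofReal_rpow_of_pos h0, ENNReal.ofReal_rpow_of_pos h0,
    ← ENNReal.ofReal_mul (by positivity)]
  refine ENNReal.ofReal_le_ofReal ?_
  calc dist x y ^ (-σ) = dist x y ^ (s - σ) * dist x y ^ (-s) := by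
        rw [← rpow_add h0]; congr 1; ring
    _ ≤ _ := by gcongr

variable [BorelSpace V]

/-- Schur's test for the Riesz kernel: a bounded potential gives a bound of the energy of `f μ` by
the `L²(μ)` norm of `f`. -/
lemma rieszEnergy_withDensity_le [SecondCountableTopology V] {s : ℝ} {μ : Measure V} [SFinite μ]
    {D : ℝ≥0∞} (hD : ∀ᵐ y ∂μ, ∫⁻ x, edist y x ^ (-s) ∂μ ≤ D) {f : V → ℝ≥0∞} (hf : Measurable f) :
    rieszEnergy s (μ.withDensity f) ≤ 2 * D * ∫⁻ x, f x ^ 2 ∂μ := by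
  have hk : Measurable (fun p : V × V => edist p.1 p.2 ^ (-s)) := by fun_prop
  have h1 : ∀ u v : ℝ≥0∞, u * v ≤ u ^ 2 + v ^ 2 := by
    intro u v
    rcases le_total u v with h | h
    · calc u * v ≤ v * v := by gcongr
        _ = v ^ 2 := (sq v).symm
        _ ≤ _ := le_add_self
    · calc u * v ≤ u * u := by gcongr
        _ = u ^ 2 := (sq u).symm
        _ ≤ _ := le_self_add
  have h2 : ∫⁻ x, ∫⁻ y, f x ^ 2 * edist x y ^ (-s) ∂μ ∂μ ≤ D * ∫⁻ x, f x ^ 2 ∂μ := by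
    rw [mul_comm, ← lintegral_mul_const _ (by fun_prop)]
    refine lintegral_mono_ae ?_
    filter_upwards [hD] with x hx
    rw [lintegral_const_mul _ (by fun_prop)]
    gcongr
  calc rieszEnergy s (μ.withDensity f) = ∫⁻ x, ∫⁻ y, f x * f y * edist x y ^ (-s) ∂μ ∂μ := by
        rw [rieszEnergy, lintegral_withDensity_eq_lintegral_mul _ hf]
        · refine lintegral_congr fun x => ?_
          rw [Pi.mul_apply, lintegral_withDensity_eq_lintegral_mul _ hf (by fun_prop),
            ← lintegral_const_mul _ (by fun_prop)]
          refine lintegral_congr fun y => ?_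
          rw [Pi.mul_apply, mul_assoc]
        · exact Measurable.lintegral_prod_right' (f := fun p : V × V => edist p.1 p.2 ^ (-s)) hk
    _ ≤ ∫⁻ x, ∫⁻ y, (f x ^ 2 * edist x y ^ (-s) + f y ^ 2 * edist x y ^ (-s)) ∂μ ∂μ := by
        refine lintegral_mono fun x => lintegral_mono fun y => ?_
        simp only
        rw [← add_mul]
        gcongr
        exact h1 _ _
    _ = ∫⁻ x, ∫⁻ y, f x ^ 2 * edist x y ^ (-s) ∂μ ∂μ +
        ∫⁻ x, ∫⁻ y, f y ^ 2 * edist x y ^ (-s) ∂μ ∂μ := by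
        simp_rw [fun x => lintegral_add_left (μ := μ)
          (f := fun y => f x ^ 2 * edist x y ^ (-s)) (by fun_prop)]
        rw [lintegral_add_left]
        exact Measurable.lintegral_prod_right'
          (f := fun p : V × V => f p.1 ^ 2 * edist p.1 p.2 ^ (-s)) (by fun_prop)
    _ = ∫⁻ x, ∫⁻ y, f x ^ 2 * edist x y ^ (-s) ∂μ ∂μ +
        ∫⁻ x, ∫⁻ y, f x ^ 2 * edist x y ^ (-s) ∂μ ∂μ := by
        congr 1
        rw [lintegral_lintegral_swap (by fun_prop)]
        simp_rw [edist_comm]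
    _ ≤ _ := by
        grw [h2, mul_assoc, two_mul]

end Energy
end VCSpheres

/-! ### Spherical averages of a pair of measures -/

namespace VCSpheres

open MeasureTheory Real Set Filter Topology
open scoped ENNReal NNReal FourierTransform ComplexConjugate ContDiff

section SphericalForm
variable {n : ℕ}

/-- The density at `r`, up to a constant and the weight `r ^ (n + 1)`, of the distribution of
`‖x - y‖` under `ρ₁ × ρ₂`, defined on the Fourier side. It is meaningful if `mixedEnergy n ρ₁ ρ₂`
is finite; otherwise the integral may be `0` by convention. -/
noncomputable def sphericalForm (n : ℕ) (ρ₁ ρ₂ : Measure (EuclideanSpace ℝ (Fin (n + 2)))) (r : ℝ) :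
    ℝ :=
  ∫ ξ, besselInt n (2 * π * ‖ξ‖ * r) * (measureFT ρ₁ ξ * conj (measureFT ρ₂ ξ)).re

/-- The integral which dominates `sphericalForm`, through the decay of `besselInt`. -/
noncomputable def mixedEnergy (n : ℕ) (ρ₁ ρ₂ : Measure (EuclideanSpace ℝ (Fin (n + 2)))) : ℝ≥0∞ :=
  ∫⁻ ξ, ENNReal.ofReal (‖ξ‖ ^ (-((n + 1 : ℝ) / 2)) * (‖measureFT ρ₁ ξ‖ * ‖measureFT ρ₂ ξ‖))

/-- Cauchy-Schwarz splits the mixed energy into Riesz energies of orders `s` and `d + 1 - s`,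
`d = n + 2`. -/
lemma exists_mixedEnergy_le {s : ℝ} (h1 : 1 < s) (h2 : s < n + 2) :
    ∃ C : ℝ≥0∞, C ≠ ⊤ ∧ ∀ (ρ₁ ρ₂ : Measure (EuclideanSpace ℝ (Fin (n + 2))))
      [IsFiniteMeasure ρ₁] [IsFiniteMeasure ρ₂],
      mixedEnergy n ρ₁ ρ₂ ≤ C * (rieszEnergy s ρ₁ ^ (1 / 2 : ℝ) *
        rieszEnergy (n + 3 - s) ρ₂ ^ (1 / 2 : ℝ)) := by
  have hfr : (Module.finrank ℝ (EuclideanSpace ℝ (Fin (n + 2))) : ℝ) = n + 2 := by simp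
  obtain ⟨C₁, hC₁, hE₁⟩ := exists_lintegral_measureFT_le
    (V := EuclideanSpace ℝ (Fin (n + 2))) (a := n + 2 - s) (by linarith) (by rw [hfr]; linarith)
  obtain ⟨C₂, hC₂, hE₂⟩ := exists_lintegral_measureFT_le
    (V := EuclideanSpace ℝ (Fin (n + 2))) (a := s - 1) (by linarith) (by rw [hfr]; linarith)
  refine ⟨C₁ ^ (1 / 2 : ℝ) * C₂ ^ (1 / 2 : ℝ), ENNReal.mul_ne_top
    (ENNReal.rpow_ne_top_of_nonneg (by positivity) hC₁)
    (ENNReal.rpow_ne_top_of_nonneg (by positivity) hC₂), fun ρ₁ ρ₂ _ _ => ?_⟩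
  have hm₁ := measurable_measureFT ρ₁
  have hm₂ := measurable_measureFT ρ₂
  have key : ∀ (a : ℝ) (ρ : Measure (EuclideanSpace ℝ (Fin (n + 2)))) (ξ),
      ENNReal.ofReal (‖ξ‖ ^ (-(a / 2)) * ‖measureFT ρ ξ‖) ^ (2 : ℝ) =
        ENNReal.ofReal (‖ξ‖ ^ (-a) * ‖measureFT ρ ξ‖ ^ 2) := by
    intro a ρ ξ
    rw [ENNReal.ofReal_rpow_of_nonneg (by positivity) (by norm_num),
      mul_rpow (by positivity) (by positivity), ← rpow_mul (norm_nonneg _), rpow_two]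
    congr 3; ring
  calc mixedEnergy n ρ₁ ρ₂ ≤ ∫⁻ ξ, ((fun ξ => ENNReal.ofReal (‖ξ‖ ^ (-((n + 2 - s) / 2)) *
        ‖measureFT ρ₁ ξ‖)) *
        (fun ξ => ENNReal.ofReal (‖ξ‖ ^ (-((s - 1) / 2)) * ‖measureFT ρ₂ ξ‖))) ξ := by
        refine lintegral_mono fun ξ => ?_
        rw [Pi.mul_apply, ← ENNReal.ofReal_mul (by positivity)]
        refine ENNReal.ofReal_le_ofReal ?_
        rcases eq_or_ne ξ 0 with rfl | hξ
        · rw [norm_zero, zero_rpow (by have : (0:ℝ) ≤ n := n.cast_nonneg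
                                       linarith), zero_mul]
          positivity
        · have h0 : 0 < ‖ξ‖ := norm_pos_iff.2 hξ
          rw [show -((n + 1 : ℝ) / 2) = -((n + 2 - s) / 2) + -((s - 1) / 2) by ring, rpow_add h0]
          apply le_of_eq; ring
    _ ≤ (∫⁻ ξ, ENNReal.ofReal (‖ξ‖ ^ (-((n + 2 - s) / 2)) * ‖measureFT ρ₁ ξ‖) ^ (2:ℝ))
            ^ (1 / 2 : ℝ) *
        (∫⁻ ξ, ENNReal.ofReal (‖ξ‖ ^ (-((s - 1) / 2)) * ‖measureFT ρ₂ ξ‖) ^ (2:ℝ))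
            ^ (1 / 2 : ℝ) := by
        refine ENNReal.lintegral_mul_le_Lp_mul_Lq _ ?_ ?_ ?_
        · exact ⟨by norm_num, by norm_num, by norm_num⟩
        · exact (by fun_prop : Measurable _).aemeasurable
        · exact (by fun_prop : Measurable _).aemeasurable
    _ ≤ (C₁ * rieszEnergy s ρ₁) ^ (1 / 2 : ℝ) *
          (C₂ * rieszEnergy (n + 3 - s) ρ₂) ^ (1 / 2 : ℝ) := by
        simp_rw [key]
        gcongr
        · refine (hE₁ ρ₁).trans (le_of_eq ?_)
          rw [rieszEnergy, hfr, show (n:ℝ) + 2 - s - (n + 2) = -s by ring]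
        · refine (hE₂ ρ₂).trans (le_of_eq ?_)
          rw [rieszEnergy, hfr, show s - 1 - ((n:ℝ) + 2) = -(n + 3 - s) by ring]
    _ = _ := by
        rw [ENNReal.mul_rpow_of_nonneg _ _ (by norm_num),
          ENNReal.mul_rpow_of_nonneg _ _ (by norm_num)]
        ring

lemma abs_bessel_mul_re_le {ρ₁ ρ₂ : Measure (EuclideanSpace ℝ (Fin (n + 2)))} {C : ℝ}
    (hC : ∀ a : ℝ, 0 < a → |besselInt n a| ≤ C * a ^ (-((n + 1 : ℝ) / 2)))
    {r : ℝ} (hr : 0 < r) {ξ : EuclideanSpace ℝ (Fin (n + 2))} (hξ : ξ ≠ 0) :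
    |besselInt n (2 * π * ‖ξ‖ * r) * (measureFT ρ₁ ξ * conj (measureFT ρ₂ ξ)).re| ≤
      C * (2 * π * r) ^ (-((n + 1 : ℝ) / 2)) *
        (‖ξ‖ ^ (-((n + 1 : ℝ) / 2)) * (‖measureFT ρ₁ ξ‖ * ‖measureFT ρ₂ ξ‖)) := by
  have h0 : 0 < ‖ξ‖ := norm_pos_iff.2 hξ
  rw [abs_mul]
  calc _ ≤ (C * (2 * π * ‖ξ‖ * r) ^ (-((n + 1 : ℝ) / 2))) *
        (‖measureFT ρ₁ ξ‖ * ‖measureFT ρ₂ ξ‖) := by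
        have h3 := hC (2 * π * ‖ξ‖ * r) (by positivity)
        exact mul_le_mul h3 (abs_re_mul_conj_le _ _) (abs_nonneg _) ((abs_nonneg _).trans h3)
    _ = _ := by
        rw [show 2 * π * ‖ξ‖ * r = (2 * π * r) * ‖ξ‖ by ring, mul_rpow (by positivity) h0.le]
        ring

variable {ρ₁ ρ₂ : Measure (EuclideanSpace ℝ (Fin (n + 2)))}
  [IsFiniteMeasure ρ₁] [IsFiniteMeasure ρ₂]

lemma integrable_mixedEnergy (h : mixedEnergy n ρ₁ ρ₂ ≠ ⊤) :
    Integrable (fun ξ => ‖ξ‖ ^ (-((n + 1 : ℝ) / 2)) * (‖measureFT ρ₁ ξ‖ * ‖measureFT ρ₂ ξ‖)) := by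
  have hm₁ := measurable_measureFT ρ₁
  have hm₂ := measurable_measureFT ρ₂
  refine ⟨(by fun_prop : Measurable _).aestronglyMeasurable, ?_⟩
  rw [hasFiniteIntegral_iff_ofReal (Eventually.of_forall fun ξ => by positivity)]
  exact h.lt_top

lemma measurable_re_measureFT_mul_conj :
    Measurable (fun ξ => (measureFT ρ₁ ξ * conj (measureFT ρ₂ ξ)).re) := by
  have hm₁ := measurable_measureFT ρ₁
  have hm₂ := measurable_measureFT ρ₂
  exact Complex.measurable_re.comp (hm₁.mul (Complex.continuous_conj.measurable.comp hm₂))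

lemma exists_abs_sphericalForm_le (n : ℕ) : ∃ C : ℝ, 0 < C ∧
    ∀ (ρ₁ ρ₂ : Measure (EuclideanSpace ℝ (Fin (n + 2)))) [IsFiniteMeasure ρ₁] [IsFiniteMeasure ρ₂],
      mixedEnergy n ρ₁ ρ₂ ≠ ⊤ → ∀ r : ℝ, 0 < r →
      |sphericalForm n ρ₁ ρ₂ r| ≤ C * r ^ (-((n + 1 : ℝ) / 2)) * (mixedEnergy n ρ₁ ρ₂).toReal := by
  obtain ⟨C, hC, hJ⟩ := exists_abs_besselInt_le n
  refine ⟨C * (2 * π) ^ (-((n + 1 : ℝ) / 2)), by positivity, fun ρ₁ ρ₂ _ _ hfin r hr => ?_⟩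
  have h1 := integrable_mixedEnergy hfin
  have h2 : (mixedEnergy n ρ₁ ρ₂).toReal =
      ∫ ξ, ‖ξ‖ ^ (-((n + 1 : ℝ) / 2)) * (‖measureFT ρ₁ ξ‖ * ‖measureFT ρ₂ ξ‖) := by
    rw [integral_eq_lintegral_of_nonneg_ae (Eventually.of_forall fun ξ => by positivity)
      h1.aestronglyMeasurable]
    rfl
  rw [h2, mul_assoc C, ← mul_rpow (by positivity) hr.le, ← integral_const_mul]
  rw [sphericalForm, ← norm_eq_abs]
  refine norm_integral_le_of_norm_le (h1.const_mul _) ?_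
  filter_upwards [compl_mem_ae_iff.2 (measure_singleton (0 : EuclideanSpace ℝ (Fin (n + 2))))]
    with ξ hξ
  exact abs_bessel_mul_re_le hJ hr hξ

lemma continuousOn_sphericalForm (hfin : mixedEnergy n ρ₁ ρ₂ ≠ ⊤) :
    ContinuousOn (sphericalForm n ρ₁ ρ₂) (Ioi 0) := by
  obtain ⟨C, hC, hJ⟩ := exists_abs_besselInt_le n
  have h1 := integrable_mixedEnergy hfin
  have hm := measurable_re_measureFT_mul_conj (ρ₁ := ρ₁) (ρ₂ := ρ₂)
  have hcJ := continuous_besselInt n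
  intro r₀ hr₀
  have hr₀ : 0 < r₀ := hr₀
  refine ContinuousAt.continuousWithinAt ?_
  refine continuousAt_of_dominated (bound := fun ξ =>
      C * (2 * π * (r₀ / 2)) ^ (-((n + 1 : ℝ) / 2)) *
        (‖ξ‖ ^ (-((n + 1 : ℝ) / 2)) * (‖measureFT ρ₁ ξ‖ * ‖measureFT ρ₂ ξ‖))) ?_ ?_ ?_ ?_
  · refine Eventually.of_forall fun r => ?_
    exact ((by fun_prop : Continuous (fun ξ : EuclideanSpace ℝ (Fin (n + 2)) =>
      besselInt n (2 * π * ‖ξ‖ * r))).measurable.mul hm).aestronglyMeasurable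
  · filter_upwards [lt_mem_nhds (half_lt_self hr₀)] with r hr
    filter_upwards [compl_mem_ae_iff.2 (measure_singleton (0 : EuclideanSpace ℝ (Fin (n + 2))))]
      with ξ hξ
    refine (abs_bessel_mul_re_le hJ (by linarith) hξ).trans ?_
    gcongr ?_ * _
    refine mul_le_mul_of_nonneg_left (rpow_le_rpow_of_nonpos (by positivity) (by gcongr) ?_) hC.le
    have : (0:ℝ) ≤ n := n.cast_nonneg
    linarith
  · exact h1.const_mul _
  · refine Eventually.of_forall fun ξ => ?_
    exact (by fun_prop : Continuous (fun r : ℝ => besselInt n (2 * π * ‖ξ‖ * r) *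
      (measureFT ρ₁ ξ * conj (measureFT ρ₂ ξ)).re)).continuousAt

/-- Integrals of radial functions of `x - y` against `ρ₁ × ρ₂` are integrals of `sphericalForm`
over the radius. The condition at `0` keeps the bound for `sphericalForm` integrable. -/
lemma exists_integral_radial_prod (n : ℕ) : ∃ c : ℝ, 0 < c ∧ ∀ Φ : ℝ → ℝ, ContDiff ℝ ∞ Φ →
    HasCompactSupport Φ → ∀ a : ℝ, 0 < a → (∀ u < a, Φ u = 0) →
    ∀ (ρ₁ ρ₂ : Measure (EuclideanSpace ℝ (Fin (n + 2)))) [IsFiniteMeasure ρ₁] [IsFiniteMeasure ρ₂],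
      mixedEnergy n ρ₁ ρ₂ ≠ ⊤ →
      ∫ p, Φ (‖p.1 - p.2‖ ^ 2) ∂(ρ₁.prod ρ₂) =
        c * ∫ r in Ioi (0:ℝ), Φ (r ^ 2) * r ^ (n + 1) * sphericalForm n ρ₁ ρ₂ r := by
  obtain ⟨c, hc, hrad⟩ := exists_integral_radial_mul_cos n
  obtain ⟨C, hC, hJ⟩ := exists_abs_besselInt_le n
  refine ⟨c, hc, fun Φ hΦ hΦc a ha hΦa ρ₁ ρ₂ _ _ hfin => ?_⟩
  have h1 := integrable_mixedEnergy hfin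
  have hm := measurable_re_measureFT_mul_conj (ρ₁ := ρ₁) (ρ₂ := ρ₂)
  have hcJ := continuous_besselInt n
  have hΦcont := hΦ.continuous
  obtain ⟨hΨ, hinv⟩ := fourier_inversion_radial (V := EuclideanSpace ℝ (Fin (n + 2))) hΦ hΦc
  rw [integral_prod_eq_integral_fourier (ψ := fun x => Φ (‖x‖ ^ 2)) hΨ hinv]
  -- the constant is that of the radial Fourier transform; exchange `r` and `ξ`
  simp_rw [hrad Φ hΦcont hΦc, mul_assoc c, integral_const_mul, ← integral_mul_const]
  congr 1
  rw [integral_integral_swap]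
  · refine setIntegral_congr_fun measurableSet_Ioi fun r hr => ?_
    rw [sphericalForm, ← integral_const_mul]
    refine integral_congr_ae (Eventually.of_forall fun ξ => ?_)
    ring
  · set g : ℝ → ℝ := fun r => Φ (r ^ 2) * r ^ (n + 1) *
      (C * (2 * π * √a) ^ (-((n + 1 : ℝ) / 2))) with hg
    have hgi : Integrable g := by
      refine (by fun_prop : Continuous _).integrable_of_hasCompactSupport ?_
      have : HasCompactSupport (fun r : ℝ => Φ (r ^ 2)) := by
        simpa using hasCompactSupport_comp_norm_sq (E := ℝ) hΦc
      exact this.mul_right.mul_right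
    refine (h1.mul_prod (hgi.restrict (s := Ioi 0))).mono ?_ ?_
    · refine Measurable.aestronglyMeasurable ?_
      refine Measurable.mul ?_ (hm.comp measurable_fst)
      exact (by fun_prop : Continuous (fun p : EuclideanSpace ℝ (Fin (n + 2)) × ℝ =>
        Φ (p.2 ^ 2) * p.2 ^ (n + 1) * besselInt n (2 * π * ‖p.1‖ * p.2))).measurable
    · have hae : ∀ᵐ p ∂((volume : Measure (EuclideanSpace ℝ (Fin (n + 2)))).prod
          (volume.restrict (Ioi (0:ℝ)))), p.1 ≠ 0 ∧ 0 < p.2 := by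
        refine Eventually.and ?_ ?_
        · exact Measure.quasiMeasurePreserving_fst.ae
            (compl_mem_ae_iff.2 (measure_singleton (0 : EuclideanSpace ℝ (Fin (n + 2)))))
        · exact Measure.quasiMeasurePreserving_snd.ae (ae_restrict_mem measurableSet_Ioi)
      filter_upwards [hae] with p hp
      obtain ⟨hp1, hp2⟩ := hp
      simp only [Function.uncurry, hg, norm_eq_abs]
      by_cases hΦ0 : Φ (p.2 ^ 2) = 0
      · simp [hΦ0]
      have hpa : √a ≤ p.2 := by
        rw [sqrt_le_left hp2.le]
        by_contra! h
        exact hΦ0 (hΦa _ h)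
      have h5 := abs_bessel_mul_re_le (ρ₁ := ρ₁) (ρ₂ := ρ₂) hJ hp2 hp1
      have h6 : (2 * π * p.2) ^ (-((n + 1 : ℝ) / 2)) ≤ (2 * π * √a) ^ (-((n + 1 : ℝ) / 2)) := by
        refine rpow_le_rpow_of_nonpos (by positivity) (by gcongr) ?_
        have : (0:ℝ) ≤ n := n.cast_nonneg
        linarith
      calc _ = |Φ (p.2 ^ 2) * p.2 ^ (n + 1)| * |besselInt n (2 * π * ‖p.1‖ * p.2) *
            (measureFT ρ₁ p.1 * conj (measureFT ρ₂ p.1)).re| := by rw [← abs_mul, mul_assoc]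
        _ ≤ |Φ (p.2 ^ 2) * p.2 ^ (n + 1)| * |C * (2 * π * √a) ^ (-((n + 1 : ℝ) / 2)) *
            (‖p.1‖ ^ (-((n + 1 : ℝ) / 2)) * (‖measureFT ρ₁ p.1‖ * ‖measureFT ρ₂ p.1‖))| := by
            refine mul_le_mul_of_nonneg_left ?_ (abs_nonneg _)
            refine h5.trans ((le_abs_self _).trans' ?_)
            gcongr
        _ = _ := by
            rw [← abs_mul]; congr 1; ring

end SphericalForm
end VCSpheres

/-! ### Approximation of a sphere by thin shells; non-vanishing of the spherical averages -/

namespace VCSpheres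

open MeasureTheory Real Set Filter Topology
open scoped ENNReal NNReal ContDiff

/-- Bumps `Φ k` around `t ^ 2`, whose supports shrink, normalised so that `Φ k (r ^ 2)` has mass
one for the weight `c r ^ (n + 1)`. -/
lemma exists_bump_sequence (n : ℕ) {c t : ℝ} (hc : 0 < c) (ht : 0 < t) :
    ∃ Φ : ℕ → ℝ → ℝ, (∀ k, ContDiff ℝ ∞ (Φ k)) ∧ (∀ k, HasCompactSupport (Φ k)) ∧
      (∀ k u, 0 ≤ Φ k u) ∧ (∀ k u, Φ k u ≠ 0 → |u - t ^ 2| < t ^ 2 / 2 / (k + 1)) ∧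
      ∀ k, c * ∫ r in Ioi (0:ℝ), Φ k (r ^ 2) * r ^ (n + 1) = 1 := by
  have ht2 : 0 < t ^ 2 := by positivity
  let b : ℕ → ContDiffBump (t ^ 2) := fun k =>
    ⟨t ^ 2 / 2 / (k + 1) / 2, t ^ 2 / 2 / (k + 1), by positivity, half_lt_self (by positivity)⟩
  have hpos : ∀ k, 0 < ∫ r in Ioi (0:ℝ), b k (r ^ 2) * r ^ (n + 1) := by
    intro k
    have hcont : Continuous (fun r : ℝ => b k (r ^ 2) * r ^ (n + 1)) := by
      have := (b k).continuous
      fun_prop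
    have hcs : HasCompactSupport (fun r : ℝ => b k (r ^ 2) * r ^ (n + 1)) := by
      have : HasCompactSupport (fun r : ℝ => b k (r ^ 2)) := by
        simpa using hasCompactSupport_comp_norm_sq (E := ℝ) (b k).hasCompactSupport
      exact this.mul_right
    have hint := (hcont.integrable_of_hasCompactSupport (μ := volume) hcs).integrableOn (s := Ioi 0)
    rw [setIntegral_pos_iff_support_of_nonneg_ae _ hint]
    · have hopen : IsOpen (Function.support (fun r : ℝ => b k (r ^ 2) * r ^ (n + 1)) ∩ Ioi 0) :=
        (hcont.isOpen_support).inter isOpen_Ioi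
      refine hopen.measure_pos _ ⟨t, ?_, ht⟩
      rw [Function.mem_support]
      have : b k (t ^ 2) = 1 :=
        (b k).one_of_mem_closedBall (Metric.mem_closedBall_self (b k).rIn_pos.le)
      rw [this]; positivity
    · refine (ae_restrict_iff' measurableSet_Ioi).2 (Eventually.of_forall fun r hr => ?_)
      have hr : (0:ℝ) < r := hr
      exact mul_nonneg (b k).nonneg (by positivity)
  refine ⟨fun k u => (c * ∫ r in Ioi (0:ℝ), b k (r ^ 2) * r ^ (n + 1))⁻¹ * b k u,
    fun k => contDiff_const.mul (b k).contDiff, fun k => (b k).hasCompactSupport.mul_left,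
    fun k u => mul_nonneg (inv_nonneg.2 (mul_pos hc (hpos k)).le) (b k).nonneg, ?_, ?_⟩
  · intro k u hu
    have h1 : b k u ≠ 0 := right_ne_zero_of_mul hu
    have h2 : u ∈ Function.support (b k) := h1
    rw [(b k).support_eq, Metric.mem_ball, dist_eq] at h2
    exact h2
  · intro k
    have := (mul_pos hc (hpos k)).ne'
    simp_rw [mul_assoc, integral_const_mul]
    rw [← mul_assoc, mul_comm c, mul_assoc, inv_mul_cancel₀ this]

lemma abs_average_sub_le {n : ℕ} {c t : ℝ} (hc : 0 < c) (ht : 0 < t) {Φ : ℝ → ℝ}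
    (hΦ : Continuous Φ) (h0 : ∀ u, 0 ≤ Φ u) {ε : ℝ} (hε : ε ≤ t ^ 2 / 2)
    (hs : ∀ u, Φ u ≠ 0 → |u - t ^ 2| < ε)
    (h1 : c * ∫ r in Ioi (0:ℝ), Φ (r ^ 2) * r ^ (n + 1) = 1) {h : ℝ → ℝ}
    (hh : ContinuousOn h (Ioi 0)) {L δ : ℝ}
    (hδ : ∀ r, 0 < r → |r ^ 2 - t ^ 2| < ε → |h r - L| ≤ δ) :
    |c * (∫ r in Ioi (0:ℝ), Φ (r ^ 2) * r ^ (n + 1) * h r) - L| ≤ δ := by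
  have hint : ∀ g : ℝ → ℝ, ContinuousOn g (Ioi 0) →
      IntegrableOn (fun r => Φ (r ^ 2) * r ^ (n + 1) * g r) (Ioi 0) := by
    intro g hg
    have hK : ContinuousOn (fun r => Φ (r ^ 2) * r ^ (n + 1) * g r) (Icc (t / 2) (2 * t)) := by
      refine (by fun_prop : Continuous (fun r : ℝ => Φ (r ^ 2) * r ^ (n + 1))).continuousOn.mul
        (hg.mono fun r hr => ?_)
      have := hr.1
      exact lt_of_lt_of_le (by positivity) this
    refine (hK.integrableOn_compact (μ := volume) isCompact_Icc).of_forall_sdiff_eq_zero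
      measurableSet_Ioi ?_
    rintro r ⟨hr, hr2⟩
    have hr : (0:ℝ) < r := hr
    have : Φ (r ^ 2) = 0 := by
      by_contra hne
      have := (hs _ hne).trans_le hε
      rw [abs_lt] at this
      exact hr2 ⟨by nlinarith, by nlinarith⟩
    simp [this]
  have e1 : c * (∫ r in Ioi (0:ℝ), Φ (r ^ 2) * r ^ (n + 1) * h r) - L =
      c * ∫ r in Ioi (0:ℝ), Φ (r ^ 2) * r ^ (n + 1) * (h r - L) := by
    have e2 : ∀ r, Φ (r ^ 2) * r ^ (n + 1) * (h r - L) =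
      Φ (r ^ 2) * r ^ (n + 1) * h r - Φ (r ^ 2) * r ^ (n + 1) * L := fun r => by ring
    simp_rw [e2]
    rw [integral_sub (hint h hh) (hint _ continuousOn_const), integral_mul_const, mul_sub,
      ← mul_assoc, h1, one_mul]
  have h1' : δ = c * ∫ r in Ioi (0:ℝ), Φ (r ^ 2) * r ^ (n + 1) * δ := by
    rw [integral_mul_const, ← mul_assoc, h1, one_mul]
  rw [e1, abs_mul, abs_of_pos hc, h1']
  refine mul_le_mul_of_nonneg_left ?_ hc.le
  rw [← norm_eq_abs]
  refine norm_integral_le_of_norm_le (hint _ continuousOn_const) ?_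
  refine (ae_restrict_iff' measurableSet_Ioi).2 (Eventually.of_forall fun r hr => ?_)
  have hr : (0:ℝ) < r := hr
  have hnn : 0 ≤ Φ (r ^ 2) * r ^ (n + 1) := mul_nonneg (h0 _) (by positivity)
  rw [norm_mul, norm_of_nonneg hnn]
  by_cases hne : Φ (r ^ 2) = 0
  · simp [hne]
  · exact mul_le_mul_of_nonneg_left (hδ r hr (hs _ hne)) hnn

lemma tendsto_average {n : ℕ} {c t : ℝ} (hc : 0 < c) (ht : 0 < t) {Φ : ℕ → ℝ → ℝ}
    (hΦ : ∀ k, Continuous (Φ k)) (h0 : ∀ k u, 0 ≤ Φ k u)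
    (hs : ∀ k u, Φ k u ≠ 0 → |u - t ^ 2| < t ^ 2 / 2 / (k + 1))
    (h1 : ∀ k, c * ∫ r in Ioi (0:ℝ), Φ k (r ^ 2) * r ^ (n + 1) = 1) {h : ℝ → ℝ}
    (hh : ContinuousOn h (Ioi 0)) :
    Tendsto (fun k => c * ∫ r in Ioi (0:ℝ), Φ k (r ^ 2) * r ^ (n + 1) * h r) atTop (𝓝 (h t)) := by
  rw [Metric.tendsto_atTop]
  intro δ hδ
  have hcont : ContinuousAt h t := hh.continuousAt (Ioi_mem_nhds ht)
  obtain ⟨η, hη, hηδ⟩ := Metric.continuousAt_iff.1 hcont (δ / 2) (half_pos hδ)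
  obtain ⟨N, hN⟩ := exists_nat_gt (t / η)
  refine ⟨N, fun k hk => ?_⟩
  have hk1 : (0:ℝ) < k + 1 := by positivity
  have hk2 : t < η * (k + 1) := by
    rw [div_lt_iff₀ hη] at hN
    have : (N:ℝ) ≤ k := by exact_mod_cast hk
    nlinarith
  refine lt_of_le_of_lt ?_ (half_lt_self hδ)
  rw [dist_eq]
  refine abs_average_sub_le hc ht (hΦ k) (h0 k) ?_ (hs k) (h1 k) hh ?_
  · exact div_le_self (by positivity) (by linarith [(Nat.cast_nonneg k : (0:ℝ) ≤ k)])
  · intro r hr hrt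
    have h3 : dist r t < η := by
      rw [dist_eq]
      have h4 : |r ^ 2 - t ^ 2| = |r - t| * (r + t) := by
        rw [← abs_of_pos (by positivity : 0 < r + t), ← abs_mul]; congr 1
        ring
      rw [h4, div_div, lt_div_iff₀ (by positivity)] at hrt
      by_contra! hcon
      have h5 : η * t ≤ |r - t| * (r + t) := by
        apply mul_le_mul hcon (by linarith) ht.le (abs_nonneg _)
      have h6 : η * t * (2 * (k + 1)) ≤ |r - t| * (r + t) * (2 * (k + 1)) := by gcongr
      nlinarith
    exact (hηδ h3).le

section Measures
variable {n : ℕ}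

/-- The mixed energy of `f μ` and `g μ`, with the gain `R ^ ((2 s - d - 1) / 2)` from the diameter
`R` of the support of `g`. -/
lemma exists_mixedEnergy_withDensity_le {s : ℝ} (h1 : (n + 3) / 2 < s) (h2 : s < n + 2)
    {μ : Measure (EuclideanSpace ℝ (Fin (n + 2)))} [IsFiniteMeasure μ] {D : ℝ≥0∞} (hDt : D ≠ ⊤)
    (hD : ∀ᵐ y ∂μ, ∫⁻ x, edist y x ^ (-s) ∂μ ≤ D) :
    ∃ C : ℝ≥0∞, C ≠ ⊤ ∧ ∀ f g : EuclideanSpace ℝ (Fin (n + 2)) → ℝ≥0∞, Measurable f → Measurable g →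
      IsFiniteMeasure (μ.withDensity f) → IsFiniteMeasure (μ.withDensity g) →
      ∀ R : ℝ, 0 < R → (∀ᵐ x ∂(μ.withDensity g), ∀ᵐ y ∂(μ.withDensity g), dist x y ≤ R) →
      mixedEnergy n (μ.withDensity f) (μ.withDensity g) ≤
        C * ENNReal.ofReal (R ^ ((2 * s - (n + 3)) / 2)) *
          ((∫⁻ x, f x ^ 2 ∂μ) ^ (1 / 2 : ℝ) * (∫⁻ x, g x ^ 2 ∂μ) ^ (1 / 2 : ℝ)) := by
  have hn : (0:ℝ) ≤ n := n.cast_nonneg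
  obtain ⟨C, hC, h⟩ := exists_mixedEnergy_le (n := n) (s := s) (by linarith) h2
  refine ⟨C * (2 * D), by finiteness, fun f g hf hg _ _ R hR hd => ?_⟩
  refine (h _ _).trans ?_
  have e1 := rieszEnergy_withDensity_le hD hf
  have e2 := (rieszEnergy_le_of_dist_le (σ := n + 3 - s) hR (by linarith) (by linarith) hd).trans
    (mul_le_mul_right (rieszEnergy_withDensity_le hD hg) _)
  grw [e1, e2]
  apply le_of_eq
  generalize 2 * D = G
  have hh : (0:ℝ) ≤ 1 / 2 := by norm_num
  rw [ENNReal.mul_rpow_of_nonneg _ _ hh, ENNReal.mul_rpow_of_nonneg _ _ hh,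
    ENNReal.mul_rpow_of_nonneg _ _ hh, ENNReal.ofReal_rpow_of_nonneg (by positivity) hh,
    ← rpow_mul hR.le, show (s - (n + 3 - s)) * (1 / 2) = (2 * s - (n + 3)) / 2 by ring]
  have e3 : G ^ (1 / 2 : ℝ) * G ^ (1 / 2 : ℝ) = G := by
    rw [← ENNReal.rpow_add_of_nonneg _ _ hh hh]; norm_num
  conv_rhs => rw [← e3]
  ring

lemma mixedEnergy_self_ne_top {s : ℝ} (h1 : (n + 3) / 2 < s) (h2 : s < n + 2)
    {μ : Measure (EuclideanSpace ℝ (Fin (n + 2)))} [IsFiniteMeasure μ] {D : ℝ≥0∞} (hDt : D ≠ ⊤)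
    (hD : ∀ᵐ y ∂μ, ∫⁻ x, edist y x ^ (-s) ∂μ ≤ D) {R : ℝ} (hR : 0 < R)
    (hd : ∀ᵐ x ∂μ, ∀ᵐ y ∂μ, dist x y ≤ R) : mixedEnergy n μ μ ≠ ⊤ := by
  obtain ⟨C, hC, h⟩ := exists_mixedEnergy_withDensity_le h1 h2 hDt hD
  have h3 := h 1 1 measurable_one measurable_one (by rw [withDensity_one]; infer_instance)
    (by rw [withDensity_one]; infer_instance) R hR (by rw [withDensity_one]; exact hd)
  rw [withDensity_one] at h3
  refine ne_top_of_le_ne_top ?_ h3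
  simp only [Pi.one_apply, one_pow, lintegral_one]
  have : (μ univ) ^ (1 / 2 : ℝ) ≠ ⊤ :=
    ENNReal.rpow_ne_top_of_nonneg (by norm_num) (measure_ne_top _ _)
  finiteness

lemma measure_singleton_eq_zero_of_lintegral_edist_ne_top {V : Type*} [MetricSpace V]
    [MeasurableSpace V] [BorelSpace V] {s : ℝ} (hs : 0 < s) {μ : Measure V} {y : V}
    (h : ∫⁻ x, edist y x ^ (-s) ∂μ ≠ ⊤) : μ {y} = 0 := by
  have h1 := ae_lt_top (by fun_prop) h
  rw [measure_eq_zero_iff_ae_notMem]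
  filter_upwards [h1] with x hx hxy
  rw [mem_singleton_iff] at hxy
  subst hxy
  rw [edist_self, ENNReal.zero_rpow_of_neg (by linarith)] at hx
  exact absurd hx (lt_irrefl _)

/-- If `sphericalForm n μ μ` vanished identically, then `μ × μ` would live on the diagonal, and `μ`
would have atoms. -/
lemma exists_sphericalForm_ne_zero
    {μ : Measure (EuclideanSpace ℝ (Fin (n + 2)))} [IsFiniteMeasure μ] (hμ : μ ≠ 0)
    (hat : ∀ᵐ y ∂μ, μ {y} = 0) (hfin : mixedEnergy n μ μ ≠ ⊤) :
    ∃ t : ℝ, 0 < t ∧ sphericalForm n μ μ t ≠ 0 := by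
  by_contra! hcon
  obtain ⟨c, hc, h⟩ := exists_integral_radial_prod n
  have h1 : ∀ k : ℕ, ∀ᵐ p ∂(μ.prod μ),
      ¬ (1 / (k + 2 : ℝ) < ‖p.1 - p.2‖ ^ 2 ∧ ‖p.1 - p.2‖ ^ 2 < k + 2) := by
    intro k
    have hk : (1:ℝ) / (k + 2) < k + 2 := by
      rw [div_lt_iff₀ (by positivity)]
      nlinarith [(Nat.cast_nonneg k : (0:ℝ) ≤ k)]
    -- a bump whose support is exactly the interval `(1 / (k + 2), k + 2)`
    let b : ContDiffBump ((1 / (k + 2 : ℝ) + (k + 2)) / 2) :=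
      ⟨((k + 2 : ℝ) - 1 / (k + 2)) / 4, ((k + 2 : ℝ) - 1 / (k + 2)) / 2, by linarith, by linarith⟩
    have hb : ∀ u, b u ≠ 0 ↔ 1 / (k + 2 : ℝ) < u ∧ u < k + 2 := by
      intro u
      rw [← Function.mem_support, b.support_eq, Metric.mem_ball, dist_eq, abs_lt]
      change -(((k + 2 : ℝ) - 1 / (k + 2)) / 2) < _ ∧ _ < ((k + 2 : ℝ) - 1 / (k + 2)) / 2 ↔ _
      constructor
      · rintro ⟨h1, h2⟩; constructor <;> linarith
      · rintro ⟨h1, h2⟩; constructor <;> linarith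
    have h2 := h b b.contDiff b.hasCompactSupport (1 / (k + 2)) (by positivity) (fun u hu => by
      by_contra hne
      exact absurd ((hb u).1 hne).1 (not_lt.2 hu.le)) μ μ hfin
    have h3 : ∫ r in Ioi (0:ℝ), b (r ^ 2) * r ^ (n + 1) * sphericalForm n μ μ r = 0 := by
      rw [setIntegral_congr_fun (g := fun _ => (0:ℝ)) measurableSet_Ioi]
      · simp
      · intro r hr
        simp [hcon r hr]
    rw [h3, mul_zero, integral_eq_zero_iff_of_nonneg (fun p => b.nonneg)] at h2
    · filter_upwards [h2] with p hp hp2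
      exact (hb _).2 hp2 hp
    · refine Integrable.of_bound (C := 1) ?_ (Eventually.of_forall fun p => ?_)
      · have := b.continuous
        exact (by fun_prop : Continuous _).aestronglyMeasurable
      · rw [norm_of_nonneg b.nonneg]; exact b.le_one
  have h2 : ∀ᵐ p ∂(μ.prod μ), p.1 = p.2 := by
    filter_upwards [ae_all_iff.2 h1] with p hp
    by_contra hne
    have h0 : 0 < ‖p.1 - p.2‖ ^ 2 := by
      have := norm_pos_iff.2 (sub_ne_zero.2 hne)
      positivity
    obtain ⟨N, hN⟩ := exists_nat_gt (max (‖p.1 - p.2‖ ^ 2) (1 / ‖p.1 - p.2‖ ^ 2))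
    refine hp N ⟨?_, ?_⟩
    · rw [one_div_lt (by positivity) h0]
      linarith [le_max_right (‖p.1 - p.2‖ ^ 2) (1 / ‖p.1 - p.2‖ ^ 2)]
    · linarith [le_max_left (‖p.1 - p.2‖ ^ 2) (1 / ‖p.1 - p.2‖ ^ 2)]
  have h3 := Measure.ae_ae_of_ae_prod h2
  apply hμ
  rw [← ae_eq_bot, ← Filter.empty_mem_iff_bot]
  have : ∀ᵐ x ∂μ, False := by
    filter_upwards [h3, hat] with x hx hx0
    have h4 : ∀ᵐ y ∂μ, y ≠ x := by
      have := measure_eq_zero_iff_ae_notMem.1 hx0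
      filter_upwards [this] with y hy; simpa using hy
    have h5 : ∀ᵐ y ∂μ, False := by
      filter_upwards [hx, h4] with y h6 h7
      exact h7 h6.symm
    have h6 : ae μ = ⊥ := by
      rw [← Filter.empty_mem_iff_bot]; exact h5
    exact hμ (ae_eq_bot.1 h6)
  exact this

end Measures
end VCSpheres

/-! ### The measure on pairs of points at distance `t` -/

namespace VCSpheres

open MeasureTheory Real Set Filter Topology
open scoped ENNReal NNReal ContDiff BoundedContinuousFunction

variable {n : ℕ}

/-- The Euclidean space of dimension `n + 2`. -/
abbrev Space (n : ℕ) := EuclideanSpace ℝ (Fin (n + 2))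

/-- The measures `Φ k (‖x - y‖ ^ 2) dμ x dμ y`, for bumps `Φ k` that concentrate at `t ^ 2`, have a
weak limit along an ultrafilter. It is symmetric, is carried by the pairs of points of `E` at
distance `t`, is nonzero as `sphericalForm n μ μ t ≠ 0`, and inherits the `L²` bound of the mixed
energies. -/
theorem exists_pair_measure {s : ℝ} (h1 : (n + 3) / 2 < s) (h2 : s < n + 2)
    {E : Set (Space n)} (hE : IsCompact E)
    {μ : Measure (Space n)} [IsFiniteMeasure μ] (hμE : μ Eᶜ = 0)
    {D : ℝ≥0∞} (hDt : D ≠ ⊤)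
    (hD : ∀ᵐ y ∂μ, ∫⁻ x, edist y x ^ (-s) ∂μ ≤ D) {t : ℝ} (ht : 0 < t)
    (hM : sphericalForm n μ μ t ≠ 0) :
    ∃ ν : Measure (Space n × Space n),
      IsFiniteMeasure ν ∧ ν ≠ 0 ∧ (∀ᵐ p ∂ν, p.1 ∈ E ∧ p.2 ∈ E ∧ ‖p.1 - p.2‖ = t) ∧
      ν.map Prod.swap = ν ∧
      ∃ C : ℝ≥0∞, C ≠ ⊤ ∧ ∀ f g : Space n →ᵇ ℝ≥0, ∀ R : ℝ, 0 < R →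
        (∀ x y, g x ≠ 0 → g y ≠ 0 → dist x y ≤ R) →
        ∫⁻ p, (f p.1 * g p.2 : ℝ≥0) ∂ν ≤ C * ENNReal.ofReal (R ^ ((2 * s - (n + 3)) / 2)) *
          ((∫⁻ x, (f x : ℝ≥0∞) ^ 2 ∂μ) ^ (1 / 2 : ℝ) *
            (∫⁻ x, (g x : ℝ≥0∞) ^ 2 ∂μ) ^ (1 / 2 : ℝ)) := by
  have ht2 : 0 < t ^ 2 := by positivity
  obtain ⟨c, hc, hform⟩ := exists_integral_radial_prod n
  obtain ⟨Φ, hΦs, hΦc, hΦ0, hΦsupp, hΦ1⟩ := exists_bump_sequence n hc ht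
  have hΦcont : ∀ k, Continuous (Φ k) := fun k => (hΦs k).continuous
  have hε : ∀ k : ℕ, t ^ 2 / 2 / (k + 1) ≤ t ^ 2 / 2 := fun k =>
    div_le_self (by positivity) (by linarith [(Nat.cast_nonneg k : (0:ℝ) ≤ k)])
  have hΦa : ∀ k, ∀ u < t ^ 2 / 2, Φ k u = 0 := by
    intro k u hu
    by_contra hne
    have := abs_lt.1 ((hΦsupp k u hne).trans_le (hε k))
    linarith
  have hbd : ∀ k (ρ : Measure (Space n × Space n)) [IsFiniteMeasure ρ],
      Integrable (fun p : Space n × Space n => Φ k (‖p.1 - p.2‖ ^ 2)) ρ := by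
    intro k ρ _
    obtain ⟨B, hB⟩ := (hΦc k).exists_bound_of_continuous (hΦcont k)
    have := hΦcont k
    exact Integrable.of_bound (C := B) (by fun_prop : Continuous _).aestronglyMeasurable
      (Eventually.of_forall fun p => hB _)
  -- the approximating measures
  set w : ℕ → Space n × Space n → ℝ≥0∞ := fun k p => ENNReal.ofReal (Φ k (‖p.1 - p.2‖ ^ 2)) with hw
  have hwm : ∀ k, Measurable (w k) := fun k => by
    have := hΦcont k
    fun_prop
  have hfinν : ∀ k, IsFiniteMeasure ((μ.prod μ).withDensity (w k)) := fun k =>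
    isFiniteMeasure_withDensity_ofReal (hbd k _).hasFiniteIntegral
  let N : ℕ → FiniteMeasure (Space n × Space n) := fun k => ⟨(μ.prod μ).withDensity (w k), hfinν k⟩
  have hNf : ∀ k (f g : Space n → ℝ≥0∞), Measurable f → Measurable g →
      IsFiniteMeasure (μ.withDensity f) → IsFiniteMeasure (μ.withDensity g) →
      mixedEnergy n (μ.withDensity f) (μ.withDensity g) ≠ ⊤ →
      ∫⁻ p, f p.1 * g p.2 ∂((μ.prod μ).withDensity (w k)) =
        ENNReal.ofReal (c * ∫ r in Ioi (0:ℝ), Φ k (r ^ 2) * r ^ (n + 1) *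
          sphericalForm n (μ.withDensity f) (μ.withDensity g) r) := by
    intro k f g hf hg _ _ hfin
    rw [← hform (Φ k) (hΦs k) (hΦc k) (t ^ 2 / 2) (by positivity) (hΦa k) _ _ hfin,
      ofReal_integral_eq_lintegral_ofReal (hbd k _) (Eventually.of_forall fun p => hΦ0 k _),
      prod_withDensity hf hg, lintegral_withDensity_eq_lintegral_mul _ (hwm k) (by fun_prop),
      lintegral_withDensity_eq_lintegral_mul _ (by fun_prop) (hwm k)]
    refine lintegral_congr fun p => ?_
    simp only [Pi.mul_apply, hw]
    rw [mul_comm]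
  -- a bounded potential on a bounded set gives a finite energy
  obtain ⟨R₀, hR₀, hER⟩ : ∃ R₀ : ℝ, 0 < R₀ ∧ ∀ x ∈ E, ∀ y ∈ E, dist x y ≤ R₀ := by
    obtain ⟨R₀, h⟩ := Metric.isBounded_iff.1 hE.isBounded
    exact ⟨max R₀ 1, by positivity, fun x hx y hy => (h hx hy).trans (le_max_left _ _)⟩
  have hμE' : ∀ᵐ x ∂μ, x ∈ E := hμE
  have hself : mixedEnergy n μ μ ≠ ⊤ := mixedEnergy_self_ne_top h1 h2 hDt hD hR₀ (by
    filter_upwards [hμE'] with x hx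
    filter_upwards [hμE'] with y hy using hER x hx y hy)
  -- the total masses of the approximating measures
  set m : ℕ → ℝ := fun k => c * ∫ r in Ioi (0:ℝ), Φ k (r ^ 2) * r ^ (n + 1) *
    sphericalForm n μ μ r with hm
  have hmass : ∀ k, (μ.prod μ).withDensity (w k) univ = ENNReal.ofReal (m k) := by
    intro k
    have := hNf k 1 1 measurable_one measurable_one (by rw [withDensity_one]; infer_instance)
      (by rw [withDensity_one]; infer_instance) (by rwa [withDensity_one])
    simpa [withDensity_one] using this
  have hm0 : ∀ k, 0 ≤ m k := fun k => by
    rw [hm]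
    simp only
    rw [← hform (Φ k) (hΦs k) (hΦc k) (t ^ 2 / 2) (by positivity) (hΦa k) _ _ hself]
    exact integral_nonneg fun p => hΦ0 k _
  have hmlim : Tendsto m atTop (𝓝 (sphericalForm n μ μ t)) :=
    tendsto_average hc ht hΦcont hΦ0 hΦsupp hΦ1 (continuousOn_sphericalForm hself)
  have hMpos : 0 < sphericalForm n μ μ t :=
    lt_of_le_of_ne (ge_of_tendsto' hmlim hm0) hM.symm
  obtain ⟨A, hA⟩ := hmlim.bddAbove_range
  -- support of the approximations
  have hNE : ∀ k, ((μ.prod μ).withDensity (w k)) (E ×ˢ E)ᶜ = 0 := by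
    intro k
    apply withDensity_absolutelyContinuous
    change ∀ᵐ p ∂(μ.prod μ), p ∈ E ×ˢ E
    filter_upwards [Measure.quasiMeasurePreserving_fst.ae hμE',
      Measure.quasiMeasurePreserving_snd.ae hμE'] with p hp1 hp2 using ⟨hp1, hp2⟩
  have hcomp := isCompact_setOfPred_finiteMeasure_le_of_isCompact
    (E := Space n × Space n) A.toNNReal (hE.prod hE)
  let F : Ultrafilter ℕ := hyperfilter ℕ
  obtain ⟨ν, ⟨-, hνE⟩, hνlim⟩ := isCompact_iff_ultrafilter_le_nhds.1 hcomp (F.map N) (by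
    rw [le_principal_iff, Ultrafilter.coe_map, mem_map]
    refine univ_mem' fun k => ⟨?_, ?_⟩
    · rw [← ENNReal.coe_le_coe, FiniteMeasure.ennreal_mass]
      change (μ.prod μ).withDensity (w k) univ ≤ ENNReal.ofReal A
      rw [hmass]
      exact ENNReal.ofReal_le_ofReal (hA (mem_range_self k))
    · rw [← ENNReal.coe_eq_zero, FiniteMeasure.ennreal_coeFn_eq_coeFn_toMeasure]
      exact hNE k)
  have hlim : Tendsto N F (𝓝 ν) := hνlim
  have hF : (F : Filter ℕ) ≤ atTop := Nat.hyperfilter_le_atTop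
  have htest : ∀ f : Space n × Space n →ᵇ ℝ≥0,
      Tendsto (fun k => ∫⁻ p, f p ∂((μ.prod μ).withDensity (w k))) F
      (𝓝 (∫⁻ p, f p ∂(ν : Measure (Space n × Space n)))) :=
    FiniteMeasure.tendsto_iff_forall_lintegral_tendsto.1 hlim
  refine ⟨ν, inferInstance, ?_, ?_, ?_, ?_⟩
  · -- the total mass converges to `sphericalForm n μ μ t`
    intro h0
    have h3 := htest (BoundedContinuousFunction.const _ 1)
    simp only [BoundedContinuousFunction.const_apply, ENNReal.coe_one, lintegral_one, hmass,
      h0] at h3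
    have h4 := (ENNReal.tendsto_ofReal hmlim).mono_left hF
    have h5 := tendsto_nhds_unique h3 h4
    simp at h5
    linarith
  · -- the truncation of `|‖x - y‖ ^ 2 - t ^ 2|` has vanishing integral in the limit
    have hνE' : ∀ᵐ p ∂(ν : Measure (Space n × Space n)), p ∈ E ×ˢ E := by
      rw [← ENNReal.coe_eq_zero, FiniteMeasure.ennreal_coeFn_eq_coeFn_toMeasure] at hνE
      exact hνE
    let G : Space n × Space n →ᵇ ℝ≥0 := BoundedContinuousFunction.mkOfBound
      ⟨fun p => min (Real.toNNReal |‖p.1 - p.2‖ ^ 2 - t ^ 2|) 1, by fun_prop⟩ 1 (fun p q => by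
        rw [NNReal.dist_eq, abs_le]
        have e1 : ∀ p : Space n × Space n,
            ((min (Real.toNNReal |‖p.1 - p.2‖ ^ 2 - t ^ 2|) 1 : ℝ≥0) : ℝ) ≤ 1 :=
          fun p => by exact_mod_cast min_le_right _ _
        have e2 : ∀ p : Space n × Space n,
            0 ≤ ((min (Real.toNNReal |‖p.1 - p.2‖ ^ 2 - t ^ 2|) 1 : ℝ≥0) : ℝ) :=
          fun p => NNReal.coe_nonneg _
        have e3 := e1 p
        have e4 := e1 q
        have e5 := e2 p
        have e6 := e2 q
        simp only [ContinuousMap.coe_mk]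
        constructor <;> linarith)
    have hG : ∀ p, G p = min (Real.toNNReal |‖p.1 - p.2‖ ^ 2 - t ^ 2|) 1 := fun p => rfl
    have h3 : ∀ k, ∫⁻ p, G p ∂((μ.prod μ).withDensity (w k)) ≤
        ENNReal.ofReal (t ^ 2 / 2 / (k + 1)) * ENNReal.ofReal A := by
      intro k
      calc _ ≤ ∫⁻ p, ENNReal.ofReal (t ^ 2 / 2 / (k + 1)) ∂((μ.prod μ).withDensity (w k)) := by
            rw [lintegral_withDensity_eq_lintegral_mul _ (hwm k) (by fun_prop),
              lintegral_withDensity_eq_lintegral_mul _ (hwm k) (by fun_prop)]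
            refine lintegral_mono fun p => ?_
            simp only [Pi.mul_apply]
            by_cases hne : Φ k (‖p.1 - p.2‖ ^ 2) = 0
            · simp [hw, hne]
            · gcongr
              have := (hΦsupp k _ hne).le
              rw [hG]
              refine le_trans (ENNReal.coe_le_coe.2 (min_le_left _ _)) ?_
              exact ENNReal.ofReal_le_ofReal this
        _ ≤ _ := by
            rw [lintegral_const, hmass]
            gcongr
            exact hA (mem_range_self k)
    have h4 : Tendsto (fun k : ℕ => ENNReal.ofReal (t ^ 2 / 2 / (k + 1)) * ENNReal.ofReal A) F
        (𝓝 0) := by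
      have h5 : Tendsto (fun k : ℕ => t ^ 2 / 2 / ((k : ℝ) + 1)) atTop (𝓝 0) :=
        tendsto_const_div_atTop_nhds_zero_nat (t ^ 2 / 2) |>.comp (tendsto_add_atTop_nat 1) |>.congr
          fun k => by simp
      have h6 := ENNReal.Tendsto.mul_const (ENNReal.tendsto_ofReal h5)
        (Or.inr (ENNReal.ofReal_ne_top (r := A)))
      rw [ENNReal.ofReal_zero, zero_mul] at h6
      exact h6.mono_left hF
    have h5 : ∫⁻ p, G p ∂(ν : Measure (Space n × Space n)) = 0 := by
      rw [← nonpos_iff_eq_zero]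
      exact le_of_tendsto_of_tendsto' (htest G) h4 h3
    rw [lintegral_eq_zero_iff (by fun_prop)] at h5
    filter_upwards [hνE', h5] with p hp1 hp2
    refine ⟨hp1.1, hp1.2, ?_⟩
    have h6 : G p = 0 := ENNReal.coe_eq_zero.1 hp2
    rw [hG] at h6
    have h7 : Real.toNNReal |‖p.1 - p.2‖ ^ 2 - t ^ 2| = 0 := by
      rcases min_choice (Real.toNNReal |‖p.1 - p.2‖ ^ 2 - t ^ 2|) 1 with h | h
      · rw [← h, h6]
      · rw [h] at h6; exact absurd h6 one_ne_zero
    rw [Real.toNNReal_eq_zero] at h7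
    have h8 : ‖p.1 - p.2‖ ^ 2 = t ^ 2 := by
      have := abs_nonpos_iff.1 h7
      linarith
    exact (pow_left_inj₀ (norm_nonneg _) ht.le two_ne_zero).1 h8
  · -- the approximating measures are symmetric
    have hswap : ∀ k, (N k).map Prod.swap = N k := by
      intro k
      apply FiniteMeasure.toMeasure_injective
      rw [FiniteMeasure.toMeasure_map]
      change ((μ.prod μ).withDensity (w k)).map Prod.swap = (μ.prod μ).withDensity (w k)
      ext S hS
      rw [Measure.map_apply measurable_swap hS, withDensity_apply _ hS,
        withDensity_apply _ (measurable_swap hS), ← lintegral_indicator (measurable_swap hS),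
        ← lintegral_indicator hS, ← lintegral_prod_swap (S.indicator (w k))]
      refine lintegral_congr fun p => ?_
      simp only [indicator, hw, Prod.fst_swap, Prod.snd_swap, norm_sub_rev p.2 p.1]
      rfl
    have h3 := FiniteMeasure.tendsto_map_of_tendsto_of_continuous N ν hlim continuous_swap
    simp_rw [hswap] at h3
    have h4 := tendsto_nhds_unique h3 hlim
    have h5 := congrArg
      (fun x : FiniteMeasure (Space n × Space n) => (x : Measure (Space n × Space n))) h4
    simpa [FiniteMeasure.toMeasure_map] using h5
  · -- on the support of `Φ k`, the radius is at least `t / 2`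
    obtain ⟨C, hC, hbound⟩ := exists_mixedEnergy_withDensity_le h1 h2 hDt hD
    obtain ⟨C', hC', hform'⟩ := exists_abs_sphericalForm_le n
    refine ⟨ENNReal.ofReal (C' * (t / 2) ^ (-((n + 1 : ℝ) / 2))) * C, by finiteness,
      fun f g R hR hg => ?_⟩
    let fg : Space n × Space n →ᵇ ℝ≥0 :=
      (f.compContinuous ⟨Prod.fst, continuous_fst⟩) * (g.compContinuous ⟨Prod.snd, continuous_snd⟩)
    have hfin : ∀ f : Space n →ᵇ ℝ≥0, ∫⁻ x, (f x : ℝ≥0∞) ∂μ ≠ ⊤ := fun f =>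
      (f.lintegral_lt_top_of_nnreal μ).ne
    have hfin2 : ∀ f : Space n →ᵇ ℝ≥0, ∫⁻ x, (f x : ℝ≥0∞) ^ 2 ∂μ ≠ ⊤ := fun f => by
      have := hfin (f * f)
      simpa [sq] using this
    have hIf : IsFiniteMeasure (μ.withDensity fun x => (f x : ℝ≥0∞)) :=
      isFiniteMeasure_withDensity (hfin f)
    have hIg : IsFiniteMeasure (μ.withDensity fun x => (g x : ℝ≥0∞)) :=
      isFiniteMeasure_withDensity (hfin g)
    have hgm : Measurable (fun x => (g x : ℝ≥0∞)) := by fun_prop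
    have hfm : Measurable (fun x => (f x : ℝ≥0∞)) := by fun_prop
    have h3 := hbound (fun x => (f x : ℝ≥0∞)) (fun x => (g x : ℝ≥0∞)) hfm hgm hIf hIg R hR (by
      have : ∀ᵐ x ∂(μ.withDensity fun x => (g x : ℝ≥0∞)), g x ≠ 0 := by
        rw [ae_withDensity_iff hgm]
        exact Eventually.of_forall fun x hx => by simpa using hx
      filter_upwards [this] with x hx
      filter_upwards [this] with y hy using hg x y hx hy)
    have h4 : mixedEnergy n (μ.withDensity fun x => (f x : ℝ≥0∞))
        (μ.withDensity fun x => (g x : ℝ≥0∞)) ≠ ⊤ := by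
      refine ne_top_of_le_ne_top ?_ h3
      have e1 := ENNReal.rpow_ne_top_of_nonneg (y := 1 / 2) (by norm_num) (hfin2 f)
      have e2 := ENNReal.rpow_ne_top_of_nonneg (y := 1 / 2) (by norm_num) (hfin2 g)
      finiteness
    refine le_of_tendsto' (htest fg) fun k => ?_
    have h5 := hNf k _ _ hfm hgm hIf hIg h4
    have h6 : ∀ p, (fg p : ℝ≥0∞) = (f p.1 : ℝ≥0∞) * (g p.2 : ℝ≥0∞) := fun p => by
      rw [← ENNReal.coe_mul]; rfl
    simp_rw [h6]
    rw [h5, mul_assoc (ENNReal.ofReal _ * C), mul_assoc (ENNReal.ofReal _), ← mul_assoc C]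
    grw [← h3]
    rw [← ENNReal.ofReal_toReal h4, ← ENNReal.ofReal_mul (by positivity)]
    refine ENNReal.ofReal_le_ofReal ?_
    have h7 := abs_average_sub_le hc ht (hΦcont k) (hΦ0 k) (hε k) (hΦsupp k) (hΦ1 k)
      (continuousOn_sphericalForm h4) (L := 0) (δ := C' * (t / 2) ^ (-((n + 1 : ℝ) / 2)) *
        (mixedEnergy n (μ.withDensity fun x => (f x : ℝ≥0∞))
        (μ.withDensity fun x => (g x : ℝ≥0∞))).toReal) (by
        intro r hr hrt
        rw [sub_zero]
        refine (hform' _ _ h4 r hr).trans ?_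
        have h8 := abs_lt.1 (hrt.trans_le (hε k))
        have : (0:ℝ) ≤ n := n.cast_nonneg
        gcongr ?_ * _
        refine mul_le_mul_of_nonneg_left (rpow_le_rpow_of_nonpos (by positivity) ?_
          (by linarith)) hC'.le
        nlinarith)
    rw [sub_zero] at h7
    exact (le_abs_self _).trans h7

end VCSpheres

/-! ### Measures that do not charge sets of small dimension; densities in `L²` -/

namespace VCSpheres

open MeasureTheory Real Set Filter Topology
open scoped ENNReal NNReal BoundedContinuousFunction

section Hausdorff
variable {V : Type*} [MetricSpace V] [MeasurableSpace V] [BorelSpace V]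

/-- A form of the mass distribution principle: where dyadic balls have measure at most `M r ^ β`, a
multiple of `κ` is dominated by the Hausdorff measure of dimension `β`. -/
lemma measure_eq_zero_of_forall_closedBall_le (κ : Measure V) [IsFiniteMeasure κ] {β : ℝ≥0}
    (hβ : 0 < β) {M : ℝ≥0} {G : Set V} (hG : MeasurableSet G)
    (h : ∀ y ∈ G, ∀ j : ℕ, κ (Metric.closedBall y ((1 / 2) ^ j)) ≤
      M * ENNReal.ofReal (((1 / 2 : ℝ) ^ j) ^ (β : ℝ)))
    {A : Set V} (hA : dimH A < β) : κ (A ∩ G) = 0 := by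
  have hβ' : (0:ℝ) < β := hβ
  -- `M + 1` in place of `M` keeps the constant nonzero; `2 ^ β` accounts for the dyadic radii
  set c : ℝ≥0∞ := (M + 1) * ENNReal.ofReal (2 ^ (β : ℝ)) with hc
  have hc0 : c ≠ 0 := mul_ne_zero (by simp) (by simp; positivity)
  have hct : c ≠ ⊤ := by finiteness
  have hle : c⁻¹ • κ.restrict G ≤ Measure.hausdorffMeasure (β : ℝ) := by
    refine Measure.le_hausdorffMeasure _ _ 1 one_pos fun s hs => ?_
    rw [Measure.smul_apply, smul_eq_mul, Measure.restrict_apply' hG,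
      ENNReal.inv_mul_le_iff hc0 hct]
    rcases (s ∩ G).eq_empty_or_nonempty with h0 | ⟨y, hys, hyG⟩
    · simp [h0]
    have hdt : Metric.ediam s ≠ ⊤ := ne_top_of_le_ne_top ENNReal.one_ne_top hs
    have hsub : s ∩ G ⊆ Metric.closedBall y (Metric.ediam s).toReal := fun x hx => by
      rw [Metric.mem_closedBall, dist_edist]
      exact ENNReal.toReal_mono hdt (Metric.edist_le_ediam_of_mem hx.1 hys)
    rcases eq_or_ne (Metric.ediam s) 0 with hd0 | hd0
    · -- a set of diameter zero is a point, and points of `G` are null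
      have : κ (s ∩ G) ≤ 0 := by
        have hlim : Tendsto (fun j : ℕ => (M : ℝ≥0∞) * ENNReal.ofReal (((1 / 2 : ℝ) ^ j) ^ (β : ℝ)))
            atTop (𝓝 0) := by
          have h1 : Tendsto (fun j : ℕ => ((1 / 2 : ℝ) ^ j) ^ (β : ℝ)) atTop (𝓝 0) := by
            have := (tendsto_pow_atTop_nhds_zero_of_lt_one (r := (1 / 2 : ℝ)) (by norm_num)
              (by norm_num)).rpow_const (p := (β : ℝ)) (Or.inr hβ'.le)
            rwa [zero_rpow hβ'.ne'] at this
          have h2 := ENNReal.Tendsto.const_mul (a := (M : ℝ≥0∞)) (ENNReal.tendsto_ofReal h1)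
            (Or.inr ENNReal.coe_ne_top)
          rwa [ENNReal.ofReal_zero, mul_zero] at h2
        refine ge_of_tendsto' hlim fun j => (measure_mono ?_).trans (h y hyG j)
        refine hsub.trans (Metric.closedBall_subset_closedBall ?_)
        rw [hd0]; simp
      exact this.trans zero_le
    · have hd : 0 < (Metric.ediam s).toReal := ENNReal.toReal_pos hd0 hdt
      have hd1 : (Metric.ediam s).toReal ≤ 1 := by
        rw [← ENNReal.toReal_one]; exact ENNReal.toReal_mono ENNReal.one_ne_top hs
      obtain ⟨j, hj1, hj2⟩ := exists_nat_pow_near_of_lt_one hd hd1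
        (by norm_num : (0:ℝ) < 1 / 2) (by norm_num)
      calc κ (s ∩ G) ≤ M * ENNReal.ofReal (((1 / 2 : ℝ) ^ j) ^ (β : ℝ)) :=
            (measure_mono (hsub.trans (Metric.closedBall_subset_closedBall hj2))).trans (h y hyG j)
        _ ≤ (M + 1) * ENNReal.ofReal (2 ^ (β : ℝ) * (Metric.ediam s).toReal ^ (β : ℝ)) := by
            gcongr
            · exact le_self_add
            · rw [← mul_rpow (by norm_num) hd.le]
              refine rpow_le_rpow (by positivity) ?_ hβ'.le
              rw [pow_succ] at hj1
              linarith
        _ = c * Metric.ediam s ^ (β : ℝ) := by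
            rw [ENNReal.ofReal_mul (by positivity), ← ENNReal.ofReal_rpow_of_pos hd,
              ENNReal.ofReal_toReal hdt, hc, mul_assoc]
  have h0 := hle A
  rw [hausdorffMeasure_of_dimH_lt hA, Measure.smul_apply, Measure.restrict_apply' hG,
    smul_eq_mul, nonpos_iff_eq_zero, mul_eq_zero] at h0
  exact h0.resolve_left (ENNReal.inv_ne_zero.2 hct)

variable [SecondCountableTopology V]

lemma measurable_measure_closedBall (κ : Measure V) [SFinite κ] (r : ℝ) :
    Measurable (fun y => κ (Metric.closedBall y r)) := by
  have h : MeasurableSet {p : V × V | dist p.2 p.1 ≤ r} :=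
    measurableSet_le (by fun_prop) measurable_const
  exact measurable_measure_prodMk_left h

/-- A measure with a finite dyadic energy of order `β` does not charge the sets of dimension less
than `β`. -/
lemma measure_eq_zero_of_tsum_closedBall_ne_top (κ : Measure V) [IsFiniteMeasure κ] {β : ℝ≥0}
    (hβ : 0 < β)
    (h : ∑' j : ℕ, ENNReal.ofReal (((1 / 2 : ℝ) ^ j) ^ (-(β : ℝ))) *
      ∫⁻ y, κ (Metric.closedBall y ((1 / 2) ^ j)) ∂κ ≠ ⊤)
    {A : Set V} (hA : dimH A < β) : κ A = 0 := by
  have hm := fun j : ℕ => measurable_measure_closedBall κ ((1 / 2) ^ j)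
  have h1 : ∫⁻ y, ∑' j : ℕ, ENNReal.ofReal (((1 / 2 : ℝ) ^ j) ^ (-(β : ℝ))) *
      κ (Metric.closedBall y ((1 / 2) ^ j)) ∂κ ≠ ⊤ := by
    rw [lintegral_tsum fun j => ((hm j).const_mul _).aemeasurable]
    refine ne_of_eq_of_ne (tsum_congr fun j => lintegral_const_mul _ (hm j)) h
  have h2 := ae_lt_top (Measurable.tsum fun j => (hm j).const_mul _) h1
  set G : ℕ → Set V := fun M => {y | ∀ j : ℕ, κ (Metric.closedBall y ((1 / 2) ^ j)) ≤
    (M : ℝ≥0) * ENNReal.ofReal (((1 / 2 : ℝ) ^ j) ^ (β : ℝ))} with hGdef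
  have hGm : ∀ M, MeasurableSet (G M) := fun M => by
    rw [hGdef]
    simp only [Set.ofPred_forall]
    exact MeasurableSet.iInter fun j => measurableSet_le (hm j) measurable_const
  have hcov : ∀ᵐ y ∂κ, y ∈ ⋃ M, G M := by
    filter_upwards [h2] with y hy
    obtain ⟨M, hM⟩ := ENNReal.exists_nat_gt hy.ne
    refine mem_iUnion.2 ⟨M, fun j => ?_⟩
    have h3 := (ENNReal.le_tsum j).trans hM.le
    have hpos : (0:ℝ) < (1 / 2) ^ j := by positivity
    rw [rpow_neg hpos.le, ENNReal.ofReal_inv_of_pos (by positivity),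
      ENNReal.inv_mul_le_iff (by simp; positivity) ENNReal.ofReal_ne_top, mul_comm] at h3
    exact_mod_cast h3
  have h4 : κ A ≤ κ (⋃ M, A ∩ G M) := by
    refine measure_mono_ae ?_
    filter_upwards [hcov] with y hy hyA
    obtain ⟨M, hM⟩ := mem_iUnion.1 hy
    exact mem_iUnion.2 ⟨M, hyA, hM⟩
  refine le_antisymm (h4.trans ?_) zero_le
  refine (measure_iUnion_le _).trans (le_of_eq ?_)
  rw [ENNReal.tsum_eq_zero]
  exact fun M => measure_eq_zero_of_forall_closedBall_le κ hβ (hGm M) (fun y hy => hy) hA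

end Hausdorff

section Density
variable {V : Type*} [MetricSpace V] [MeasurableSpace V] [BorelSpace V]

/-- By density, an `L²` bound against continuous functions extends to bounded measurable ones. -/
lemma lintegral_le_of_forall_boundedContinuous {ρ μ : Measure V} [IsFiniteMeasure ρ]
    [IsFiniteMeasure μ] {K : ℝ≥0∞} (hK : K ≠ ⊤)
    (h : ∀ f : V →ᵇ ℝ≥0, ∫⁻ x, f x ∂ρ ≤ K * (∫⁻ x, (f x : ℝ≥0∞) ^ 2 ∂μ) ^ (1 / 2 : ℝ))
    {f : V → ℝ≥0} (hf : Measurable f) {B : ℝ≥0} (hB : ∀ x, f x ≤ B) :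
    ∫⁻ x, f x ∂ρ ≤ K * (∫⁻ x, (f x : ℝ≥0∞) ^ 2 ∂μ) ^ (1 / 2 : ℝ) := by
  have hnorm : ∀ (g : V → ℝ≥0), (∫⁻ x, (g x : ℝ≥0∞) ^ 2 ∂μ) ^ (1 / 2 : ℝ) =
      eLpNorm (fun x => (g x : ℝ)) 2 μ := by
    intro g
    rw [eLpNorm_eq_lintegral_rpow_enorm_toReal (by norm_num) (by norm_num)]
    simp
  have hfL : MemLp (fun x => (f x : ℝ)) 2 (μ + ρ) := by
    refine MemLp.of_bound (by fun_prop : Measurable _).aestronglyMeasurable B ?_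
    exact Eventually.of_forall fun x => by simpa using hB x
  have key : ∀ ε : ℝ≥0, 0 < ε → ∫⁻ x, f x ∂ρ ≤
      K * ((∫⁻ x, (f x : ℝ≥0∞) ^ 2 ∂μ) ^ (1 / 2 : ℝ) + ε) + ε * (ρ univ) ^ (1 / 2 : ℝ) := by
    intro ε hε
    obtain ⟨g, hg, -⟩ := hfL.exists_boundedContinuous_eLpNorm_sub_le (by norm_num)
      (ε := (ε : ℝ≥0∞)) (by simpa using hε.ne')
    set g' : V →ᵇ ℝ≥0 := g.nnrealPart with hg'
    have hgg : ∀ x, |(f x : ℝ) - g' x| ≤ |(f x : ℝ) - g x| := by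
      intro x
      have : ((g' x : ℝ≥0) : ℝ) = max (g x) 0 := rfl
      rw [this]
      have h0 : (0:ℝ) ≤ f x := (f x).coe_nonneg
      calc |(f x : ℝ) - max (g x) 0| = |max (f x : ℝ) 0 - max (g x) 0| := by
            rw [max_eq_left h0]
        _ ≤ _ := abs_max_sub_max_le_abs _ _ _
    have hgg' : ∀ m : Measure V, m ≤ μ + ρ →
        eLpNorm (fun x => (f x : ℝ) - g' x) 2 m ≤ ε := fun m hm =>
      ((eLpNorm_mono fun x => hgg x).trans (eLpNorm_mono_measure _ hm)).trans hg
    have hμ := hgg' μ (Measure.le_add_right le_rfl)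
    have hρ := hgg' ρ (Measure.le_add_left le_rfl)
    have hmeas : Measurable (fun x => (f x : ℝ) - g' x) := by fun_prop
    calc ∫⁻ x, f x ∂ρ ≤ ∫⁻ x, (g' x + ‖(f x : ℝ) - g' x‖ₑ) ∂ρ := by
          refine lintegral_mono fun x => ?_
          have e1 : (f x : ℝ≥0∞) = ‖(f x : ℝ)‖ₑ := by simp
          have e2 : (g' x : ℝ≥0∞) = ‖(g' x : ℝ)‖ₑ := by simp
          rw [e1, e2]
          calc ‖(f x : ℝ)‖ₑ = ‖(g' x : ℝ) + ((f x : ℝ) - g' x)‖ₑ := by congr 1; ring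
            _ ≤ _ := enorm_add_le _ _
      _ = ∫⁻ x, g' x ∂ρ + ∫⁻ x, ‖(f x : ℝ) - g' x‖ₑ ∂ρ :=
          lintegral_add_left (by fun_prop) _
      _ ≤ K * eLpNorm (fun x => (g' x : ℝ)) 2 μ + ε * (ρ univ) ^ (1 / 2 : ℝ) := by
          gcongr
          · rw [← hnorm]; exact h g'
          · rw [← eLpNorm_one_eq_lintegral_enorm]
            have e3 := eLpNorm_le_eLpNorm_mul_rpow_measure_univ (p := 1) (q := 2) (by norm_num)
              (hmeas.aestronglyMeasurable (μ := ρ))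
            refine e3.trans ?_
            norm_num
            gcongr
      _ ≤ _ := by
          gcongr
          rw [hnorm]
          calc eLpNorm (fun x => (g' x : ℝ)) 2 μ
              = eLpNorm ((fun x => (f x : ℝ)) - fun x => ((f x : ℝ) - g' x)) 2 μ := by
                congr 1; ext x; simp
            _ ≤ eLpNorm (fun x => (f x : ℝ)) 2 μ + eLpNorm (fun x => (f x : ℝ) - g' x) 2 μ :=
                eLpNorm_sub_le (by fun_prop : Measurable _).aestronglyMeasurable
                  hmeas.aestronglyMeasurable (by norm_num)
            _ ≤ _ := by gcongr
  set L := (∫⁻ x, (f x : ℝ≥0∞) ^ 2 ∂μ) ^ (1 / 2 : ℝ) with hL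
  have hρt : (ρ univ) ^ (1 / 2 : ℝ) ≠ ⊤ :=
    ENNReal.rpow_ne_top_of_nonneg (by norm_num) (measure_ne_top _ _)
  have hlim : Tendsto (fun ε : ℝ≥0 => K * (L + ε) + ε * (ρ univ) ^ (1 / 2 : ℝ)) (𝓝[>] 0)
      (𝓝 (K * (L + (0 : ℝ≥0)) + (0 : ℝ≥0) * (ρ univ) ^ (1 / 2 : ℝ))) := by
    have h1 : Tendsto (fun ε : ℝ≥0 => (ε : ℝ≥0∞)) (𝓝[>] 0) (𝓝 (0 : ℝ≥0)) :=
      (ENNReal.continuous_coe.tendsto 0).mono_left nhdsWithin_le_nhds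
    exact (ENNReal.Tendsto.const_mul (tendsto_const_nhds.add h1) (Or.inr hK)).add
      (ENNReal.Tendsto.mul_const h1 (Or.inr hρt))
  have := ge_of_tendsto hlim (by
    filter_upwards [self_mem_nhdsWithin] with ε hε using key ε hε)
  simpa using this

lemma absolutelyContinuous_of_forall_boundedContinuous {ρ μ : Measure V} [IsFiniteMeasure ρ]
    [IsFiniteMeasure μ] {K : ℝ≥0∞} (hK : K ≠ ⊤)
    (h : ∀ f : V →ᵇ ℝ≥0, ∫⁻ x, f x ∂ρ ≤ K * (∫⁻ x, (f x : ℝ≥0∞) ^ 2 ∂μ) ^ (1 / 2 : ℝ)) :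
    ρ ≪ μ := by
  refine Measure.AbsolutelyContinuous.mk fun S hS h0 => ?_
  have h1 := lintegral_le_of_forall_boundedContinuous hK h (f := S.indicator 1) (B := 1)
    (measurable_one.indicator hS) (fun x => indicator_le_self' (by simp) x)
  have e1 : ∀ x, ((S.indicator (1 : V → ℝ≥0) x : ℝ≥0) : ℝ≥0∞) = S.indicator 1 x := fun x => by
    by_cases hx : x ∈ S <;> simp [hx]
  have e2 : ∀ x, (S.indicator (1 : V → ℝ≥0∞) x) ^ 2 = S.indicator 1 x := fun x => by
    by_cases hx : x ∈ S <;> simp [hx]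
  simp_rw [e1, e2] at h1
  rw [lintegral_indicator_one hS, lintegral_indicator_one hS, h0,
    ENNReal.zero_rpow_of_pos (by norm_num), mul_zero] at h1
  exact le_antisymm h1 zero_le

/-- The converse of the Cauchy-Schwarz inequality: a density that is bounded as a functional on
`L²` lies in `L²`. Test against the truncations of `φ`. -/
lemma lintegral_sq_le_of_forall_boundedContinuous {μ : Measure V} [IsFiniteMeasure μ]
    {φ : V → ℝ≥0∞} (hφ : Measurable φ) [IsFiniteMeasure (μ.withDensity φ)]
    {K : ℝ≥0∞} (hK : K ≠ ⊤)
    (h : ∀ f : V →ᵇ ℝ≥0, ∫⁻ x, f x ∂(μ.withDensity φ) ≤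
      K * (∫⁻ x, (f x : ℝ≥0∞) ^ 2 ∂μ) ^ (1 / 2 : ℝ)) :
    ∫⁻ x, φ x ^ 2 ∂μ ≤ K ^ 2 := by
  have hN : ∀ N : ℕ, ∫⁻ x, (min (φ x) N) ^ 2 ∂μ ≤ K ^ 2 := by
    intro N
    have hne : ∀ x, min (φ x) (N : ℝ≥0∞) ≠ ⊤ := fun x =>
      ne_top_of_le_ne_top (ENNReal.natCast_ne_top N) (min_le_right _ _)
    have h1 := lintegral_le_of_forall_boundedContinuous hK h
      (f := fun x => (min (φ x) (N : ℝ≥0∞)).toNNReal) (B := N) (by fun_prop) (fun x => by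
        rw [← ENNReal.coe_le_coe, ENNReal.coe_toNNReal (hne x)]
        exact_mod_cast min_le_right _ _)
    simp_rw [ENNReal.coe_toNNReal (hne _)] at h1
    rw [lintegral_withDensity_eq_lintegral_mul _ hφ (by fun_prop)] at h1
    set I := ∫⁻ x, (min (φ x) (N : ℝ≥0∞)) ^ 2 ∂μ with hI
    have hIt : I ≠ ⊤ := by
      refine ne_top_of_le_ne_top (b := (N : ℝ≥0∞) ^ 2 * μ univ) (by finiteness) ?_
      rw [← lintegral_const]
      refine lintegral_mono fun x => ?_
      simp only
      gcongr
      exact min_le_right _ _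
    have h2 : I ≤ K * I ^ (1 / 2 : ℝ) := by
      refine le_trans ?_ h1
      refine lintegral_mono fun x => ?_
      simp only [Pi.mul_apply]
      rw [sq]
      gcongr
      exact min_le_left _ _
    rcases eq_or_ne I 0 with h0 | h0
    · rw [h0]; exact zero_le
    have h3 : I = I ^ (1 / 2 : ℝ) * I ^ (1 / 2 : ℝ) := by
      rw [← ENNReal.rpow_add_of_nonneg _ _ (by norm_num) (by norm_num)]; norm_num
    have h4 : I ^ (1 / 2 : ℝ) ≠ 0 := by
      intro h5; rw [h5] at h3; simp at h3; exact h0 h3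
    have h5 : I ^ (1 / 2 : ℝ) ≠ ⊤ := ENNReal.rpow_ne_top_of_nonneg (by norm_num) hIt
    have h6 : I ^ (1 / 2 : ℝ) ≤ K := by
      rw [h3] at h2
      conv at h2 => rhs; rw [← h3]
      exact (ENNReal.mul_le_mul_iff_left h4 h5).1 h2
    rw [h3, sq]
    exact mul_le_mul' h6 h6
  have hsup : ∀ x, φ x ^ 2 = ⨆ N : ℕ, (min (φ x) N) ^ 2 := by
    intro x
    have hmono : Monotone fun N : ℕ => min (φ x) (N : ℝ≥0∞) := fun a b hab =>
      min_le_min le_rfl (by exact_mod_cast hab)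
    have h1 : Tendsto (fun N : ℕ => min (φ x) (N : ℝ≥0∞)) atTop (𝓝 (φ x)) := by
      have := tendsto_atTop_iSup hmono
      rwa [← inf_iSup_eq, ENNReal.iSup_natCast, inf_top_eq] at this
    have h2 := (ENNReal.continuous_pow 2).tendsto (φ x) |>.comp h1
    refine tendsto_nhds_unique h2 (tendsto_atTop_iSup fun a b hab => ?_)
    exact pow_le_pow_left' (hmono hab) 2
  rw [lintegral_congr hsup, lintegral_iSup]
  · exact iSup_le hN
  · exact fun N => by fun_prop
  · intro a b hab x
    exact pow_le_pow_left' (min_le_min le_rfl (by exact_mod_cast hab)) 2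

end Density
end VCSpheres

/-! ### Dimension of the fibres of the pair measure -/

namespace VCSpheres

open MeasureTheory ProbabilityTheory Real Set Filter Topology
open scoped ENNReal NNReal BoundedContinuousFunction

/-- A continuous bump that is `1` on a ball and vanishes outside the concentric ball of twice the
radius. -/
lemma exists_boundedContinuous_bump {V : Type*} [PseudoMetricSpace V] (z : V) {r : ℝ} (hr : 0 < r) :
    ∃ g : V →ᵇ ℝ≥0, (∀ x, g x ≤ 1) ∧ (∀ x ∈ Metric.closedBall z r, g x = 1) ∧
      ∀ x, g x ≠ 0 → x ∈ Metric.closedBall z (2 * r) := by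
  have hle : ∀ x, Real.toNNReal (min 1 (2 - dist x z / r)) ≤ 1 := fun x => by
    rw [Real.toNNReal_le_one]; exact min_le_left _ _
  refine ⟨BoundedContinuousFunction.mkOfBound
    ⟨fun x => Real.toNNReal (min 1 (2 - dist x z / r)), by fun_prop⟩ 1 fun x y => ?_,
    hle, fun x hx => ?_, fun x hx => ?_⟩
  · have h1 : ∀ x, ((Real.toNNReal (min 1 (2 - dist x z / r)) : ℝ≥0) : ℝ) ≤ 1 := fun x => by
      exact_mod_cast hle x
    rw [NNReal.dist_eq, abs_le]
    have := h1 x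
    have := h1 y
    constructor <;> simp only [ContinuousMap.coe_mk] <;>
      linarith [NNReal.coe_nonneg (Real.toNNReal (min 1 (2 - dist x z / r))),
        NNReal.coe_nonneg (Real.toNNReal (min 1 (2 - dist y z / r)))]
  · change Real.toNNReal (min 1 (2 - dist x z / r)) = 1
    have : dist x z / r ≤ 1 := (div_le_one hr).2 hx
    rw [min_eq_left (by linarith), Real.toNNReal_one]
  · change Real.toNNReal (min 1 (2 - dist x z / r)) ≠ 0 at hx
    rw [Ne, Real.toNNReal_eq_zero, not_le, lt_min_iff] at hx
    rw [Metric.mem_closedBall, ← div_le_iff₀ hr]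
    linarith

section
variable {V : Type*} [MetricSpace V] [MeasurableSpace V] [BorelSpace V] [SecondCountableTopology V]

/-- The averages over all centres `z` of `κ (closedBall z (2 * r)) ^ 2` bound the correlation
integral of `κ` at scale `r`, as a ball around `y` lies in the balls of twice the radius around its
points. -/
lemma le_lintegral_measure_closedBall_sq (κ lam : Measure V) [SFinite κ] [SFinite lam] {r : ℝ}
    {v : ℝ≥0∞} (hv : ∀ y, lam (Metric.closedBall y r) = v) :
    v * ∫⁻ y, κ (Metric.closedBall y r) ∂κ ≤ ∫⁻ z, κ (Metric.closedBall z (2 * r)) ^ 2 ∂lam := by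
  have hm := measurable_measure_closedBall κ (2 * r)
  have hm' := measurable_measure_closedBall κ r
  have hS : MeasurableSet {p : V × V | dist p.1 p.2 ≤ 2 * r} :=
    measurableSet_le (by fun_prop) measurable_const
  calc v * ∫⁻ y, κ (Metric.closedBall y r) ∂κ
      = ∫⁻ y, ∫⁻ z in Metric.closedBall y r, κ (Metric.closedBall y r) ∂lam ∂κ := by
        rw [← lintegral_const_mul _ hm']
        refine lintegral_congr fun y => ?_
        rw [setLIntegral_const, hv, mul_comm]
    _ ≤ ∫⁻ y, ∫⁻ z, {p : V × V | dist p.1 p.2 ≤ 2 * r}.indicator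
          (fun p => κ (Metric.closedBall p.2 (2 * r))) (y, z) ∂lam ∂κ := by
        refine lintegral_mono fun y => ?_
        rw [← lintegral_indicator Metric.isClosed_closedBall.measurableSet]
        refine lintegral_mono fun z => ?_
        by_cases hz : z ∈ Metric.closedBall y r
        · have hr : 0 ≤ r := dist_nonneg.trans hz
          have hz' : dist z y ≤ r := hz
          have h1 : (y, z) ∈ {p : V × V | dist p.1 p.2 ≤ 2 * r} := by
            change dist y z ≤ 2 * r
            rw [dist_comm]; linarith
          rw [indicator_of_mem hz, indicator_of_mem h1]
          refine measure_mono (Metric.closedBall_subset_closedBall' ?_)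
          rw [dist_comm]; linarith
        · rw [indicator_of_notMem hz]; exact zero_le
    _ = ∫⁻ z, ∫⁻ y, {p : V × V | dist p.1 p.2 ≤ 2 * r}.indicator
          (fun p => κ (Metric.closedBall p.2 (2 * r))) (y, z) ∂κ ∂lam := by
        refine lintegral_lintegral_swap ?_
        exact ((hm.comp measurable_snd).indicator hS).aemeasurable
    _ = _ := by
        refine lintegral_congr fun z => ?_
        have : ∀ y, {p : V × V | dist p.1 p.2 ≤ 2 * r}.indicator
          (fun p => κ (Metric.closedBall p.2 (2 * r))) (y, z) =
          (Metric.closedBall z (2 * r)).indicator (fun _ => κ (Metric.closedBall z (2 * r))) y :=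
          fun y => by by_cases hy : dist y z ≤ 2 * r <;> simp [indicator, hy]
        simp_rw [this]
        rw [lintegral_indicator_const Metric.isClosed_closedBall.measurableSet, sq]

end

variable {n : ℕ}

/-- Almost every fibre of the pair measure gives measure zero to the sets of dimension less than
`β < b`. Tested with a bump `g` at scale `r`, the `L²` bound says that the function `x ↦ ∫ g dκ_x`,
times the density `p` of the first marginal, has an `L²(μ)` norm of order `r ^ (b / 2) ‖g‖`.
Integrating over the centres of the bumps gives
`∫ p ^ 2 (∫ κ_x (closedBall y r) dκ_x y) dμ x ≲ r ^ b`, which is summable over the dyadic scales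
after multiplication by `r ^ (-β)`. -/
theorem ae_condKernel_eq_zero_of_dimH_lt {b : ℝ} {E : Set (Space n)} (hE : IsCompact E)
    {μ : Measure (Space n)} [IsFiniteMeasure μ] {ν : Measure (Space n × Space n)}
    [IsFiniteMeasure ν] (hνE : ∀ᵐ p ∂ν, p.2 ∈ E) {C : ℝ≥0∞} (hC : C ≠ ⊤)
    (hν : ∀ f g : Space n →ᵇ ℝ≥0, ∀ R : ℝ, 0 < R →
        (∀ x y, g x ≠ 0 → g y ≠ 0 → dist x y ≤ R) →
        ∫⁻ p, (f p.1 * g p.2 : ℝ≥0) ∂ν ≤ C * ENNReal.ofReal (R ^ (b / 2)) *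
          ((∫⁻ x, (f x : ℝ≥0∞) ^ 2 ∂μ) ^ (1 / 2 : ℝ) *
            (∫⁻ x, (g x : ℝ≥0∞) ^ 2 ∂μ) ^ (1 / 2 : ℝ)))
    {β : ℝ≥0} (hβ : 0 < β) (hβb : β < b) :
    ∀ᵐ x ∂ν.fst, ∀ A : Set (Space n), dimH A < β → ν.condKernel x A = 0 := by
  set κ := ν.condKernel with hκ
  have hdis : ∀ F : Space n × Space n → ℝ≥0∞, Measurable F →
      ∫⁻ p, F p ∂ν = ∫⁻ x, ∫⁻ y, F (x, y) ∂κ x ∂ν.fst := fun F hF => by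
    conv_lhs => rw [← ν.disintegrate κ]
    rw [Measure.lintegral_compProd hF]
  -- absolute continuity of the first marginal
  have hac : ν.fst ≪ μ := by
    -- test the second variable against a bump which is `1` on `E`
    obtain ⟨r, hr⟩ := hE.isBounded.subset_closedBall (0 : Space n)
    obtain ⟨g, hg1, hgE, hg2⟩ := exists_boundedContinuous_bump (0 : Space n)
      (r := max r 1) (by positivity)
    have hR : (0:ℝ) < 4 * max r 1 := by positivity
    have hgt : (∫⁻ x, (g x : ℝ≥0∞) ^ 2 ∂μ) ^ (1 / 2 : ℝ) ≠ ⊤ := by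
      refine ENNReal.rpow_ne_top_of_nonneg (by norm_num) ?_
      refine ne_top_of_le_ne_top (measure_ne_top μ univ) ?_
      rw [← lintegral_one]
      refine lintegral_mono fun x => pow_le_one₀ zero_le ?_
      exact ENNReal.coe_le_one_iff.2 (hg1 x)
    refine absolutelyContinuous_of_forall_boundedContinuous (K := C *
      ENNReal.ofReal ((4 * max r 1) ^ (b / 2)) * (∫⁻ x, (g x : ℝ≥0∞) ^ 2 ∂μ) ^ (1 / 2 : ℝ))
      (by finiteness) fun f => ?_
    have h1 := hν f g _ hR fun x y hx hy => by
      have := Metric.mem_closedBall.1 (hg2 x hx)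
      have := Metric.mem_closedBall.1 (hg2 y hy)
      linarith [dist_triangle_right x y (0 : Space n)]
    have h2 : ∫⁻ p, (f p.1 * g p.2 : ℝ≥0) ∂ν = ∫⁻ x, f x ∂ν.fst := by
      rw [Measure.fst, lintegral_map (by fun_prop) measurable_fst]
      refine lintegral_congr_ae ?_
      filter_upwards [hνE] with p hp
      rw [hgE _ (Metric.closedBall_subset_closedBall (le_max_left _ _) (hr hp)), mul_one]
    rw [h2] at h1
    refine h1.trans (le_of_eq ?_)
    ring
  set p := ν.fst.rnDeriv μ with hp
  have hpm : Measurable p := Measure.measurable_rnDeriv _ _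
  have hpμ : μ.withDensity p = ν.fst := Measure.withDensity_rnDeriv_eq _ _ hac
  have hballm : ∀ r : ℝ, Measurable fun q : Space n × Space n =>
      κ q.1 (Metric.closedBall q.2 r) := fun r => by
    have hS : MeasurableSet {q : (Space n × Space n) × Space n | dist q.2 q.1.2 ≤ r} :=
      measurableSet_le (by fun_prop) measurable_const
    exact Kernel.measurable_kernel_prodMk_left (κ := κ.prodMkRight (Space n)) hS
  -- balls with a fixed centre
  have hball : ∀ r : ℝ, 0 < r → ∀ z, ∫⁻ x, p x ^ 2 * κ x (Metric.closedBall z r) ^ 2 ∂μ ≤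
      C ^ 2 * ENNReal.ofReal ((4 * r) ^ b) * μ (Metric.closedBall z (2 * r)) := by
    intro r hr z
    obtain ⟨g, hg1, hgE, hg2⟩ := exists_boundedContinuous_bump z hr
    have hg3 : ∫⁻ x, (g x : ℝ≥0∞) ^ 2 ∂μ ≤ μ (Metric.closedBall z (2 * r)) := by
      rw [← lintegral_indicator_one Metric.isClosed_closedBall.measurableSet]
      refine lintegral_mono fun x => ?_
      by_cases hx : g x = 0
      · simp [hx]
      · rw [indicator_of_mem (hg2 x hx)]
        refine pow_le_one₀ zero_le ?_
        exact ENNReal.coe_le_one_iff.2 (hg1 x)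
    have hgt : ∫⁻ x, (g x : ℝ≥0∞) ^ 2 ∂μ ≠ ⊤ := ne_top_of_le_ne_top (measure_ne_top _ _) hg3
    set h : Space n → ℝ≥0∞ := fun x => ∫⁻ y, g y ∂κ x with hh
    have hhm : Measurable h := Measurable.lintegral_kernel (by fun_prop)
    have hwd : μ.withDensity (p * h) = ν.fst.withDensity h := by
      rw [withDensity_mul _ hpm hhm, hpμ]
    have hh1 : ∀ x, h x ≤ 1 := fun x => by
      calc h x ≤ ∫⁻ _, 1 ∂κ x := lintegral_mono fun y => ENNReal.coe_le_one_iff.2 (hg1 y)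
        _ = 1 := by simp
    have hfin : IsFiniteMeasure (μ.withDensity (p * h)) := by
      rw [hwd]
      refine isFiniteMeasure_withDensity (ne_top_of_le_ne_top (measure_ne_top ν.fst univ) ?_)
      rw [← lintegral_one]
      exact lintegral_mono hh1
    have hgt' : (∫⁻ x, (g x : ℝ≥0∞) ^ 2 ∂μ) ^ (1 / 2 : ℝ) ≠ ⊤ :=
      ENNReal.rpow_ne_top_of_nonneg (by norm_num) hgt
    have hsq := lintegral_sq_le_of_forall_boundedContinuous (μ := μ) (φ := p * h)
      (hpm.mul hhm) (K := C * ENNReal.ofReal ((4 * r) ^ (b / 2)) *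
        (∫⁻ x, (g x : ℝ≥0∞) ^ 2 ∂μ) ^ (1 / 2 : ℝ)) (by finiteness) fun f => by
      have h1 := hν f g (4 * r) (by positivity) fun x y hx hy => by
        have := Metric.mem_closedBall.1 (hg2 x hx)
        have := Metric.mem_closedBall.1 (hg2 y hy)
        linarith [dist_triangle_right x y z]
      rw [hwd, lintegral_withDensity_eq_lintegral_mul _ hhm (by fun_prop)]
      rw [hdis _ (by fun_prop)] at h1
      refine le_trans (le_of_eq ?_) (h1.trans (le_of_eq (by ring)))
      refine lintegral_congr fun x => ?_
      simp only [Pi.mul_apply, ENNReal.coe_mul]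
      rw [lintegral_const_mul _ (by fun_prop), mul_comm]
    calc ∫⁻ x, p x ^ 2 * κ x (Metric.closedBall z r) ^ 2 ∂μ
        ≤ ∫⁻ x, (p * h) x ^ 2 ∂μ := by
          refine lintegral_mono fun x => ?_
          simp only [Pi.mul_apply]
          rw [mul_pow]
          gcongr
          rw [← lintegral_indicator_one Metric.isClosed_closedBall.measurableSet]
          refine lintegral_mono fun y => ?_
          by_cases hy : y ∈ Metric.closedBall z r
          · simp [hy, hgE y hy]
          · simp [hy]
      _ ≤ _ := hsq
      _ = C ^ 2 * ENNReal.ofReal ((4 * r) ^ b) * ∫⁻ x, (g x : ℝ≥0∞) ^ 2 ∂μ := by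
          rw [mul_pow, mul_pow, ← ENNReal.ofReal_pow (by positivity), ← rpow_natCast,
            ← rpow_mul (by positivity), ← ENNReal.rpow_natCast, ← ENNReal.rpow_natCast,
            ← ENNReal.rpow_mul]
          norm_num
      _ ≤ _ := by gcongr
  -- integration over the centres
  have hρ : ∀ ρ : ℝ, 0 < ρ →
      ∫⁻ x, p x ^ 2 * ∫⁻ y, κ x (Metric.closedBall y ρ) ∂κ x ∂μ ≤
      C ^ 2 * ENNReal.ofReal ((8 * ρ) ^ b) * (μ univ * ENNReal.ofReal (4 ^ (n + 2))) := by
    intro ρ hρ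
    have hvol : ∀ (y : Space n), volume (Metric.closedBall y ρ) =
        volume (Metric.closedBall (0 : Space n) ρ) := fun y =>
      Measure.addHaar_closedBall_center _ _ _
    have hv4 : ∀ y : Space n, volume (Metric.closedBall y (4 * ρ)) =
        ENNReal.ofReal (4 ^ (n + 2)) * volume (Metric.closedBall (0 : Space n) ρ) := fun y => by
      rw [Measure.addHaar_closedBall_mul _ _ (by norm_num) hρ.le]
      simp
    set v := volume (Metric.closedBall (0 : Space n) ρ) with hv
    have hv0 : v ≠ 0 := (Metric.measure_closedBall_pos _ _ hρ).ne'
    have hvt : v ≠ ⊤ := measure_closedBall_lt_top.ne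
    have hI : Measurable fun x => ∫⁻ y, κ x (Metric.closedBall y ρ) ∂κ x := by
      exact Measurable.lintegral_kernel_prod_right' (hballm ρ)
    have hμb := measurable_measure_closedBall μ (2 * (2 * ρ))
    have key : v * ∫⁻ x, p x ^ 2 * ∫⁻ y, κ x (Metric.closedBall y ρ) ∂κ x ∂μ ≤
        v * (C ^ 2 * ENNReal.ofReal ((8 * ρ) ^ b) * (μ univ * ENNReal.ofReal (4 ^ (n + 2)))) := by
      calc v * ∫⁻ x, p x ^ 2 * ∫⁻ y, κ x (Metric.closedBall y ρ) ∂κ x ∂μ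
          = ∫⁻ x, p x ^ 2 * (v * ∫⁻ y, κ x (Metric.closedBall y ρ) ∂κ x) ∂μ := by
            rw [← lintegral_const_mul _ (by fun_prop)]
            refine lintegral_congr fun x => by ring
        _ ≤ ∫⁻ x, p x ^ 2 * ∫⁻ z, κ x (Metric.closedBall z (2 * ρ)) ^ 2 ∂volume ∂μ := by
            gcongr with x
            exact le_lintegral_measure_closedBall_sq _ _ hvol
        _ = ∫⁻ x, ∫⁻ z, p x ^ 2 * κ x (Metric.closedBall z (2 * ρ)) ^ 2 ∂volume ∂μ := by
            refine lintegral_congr fun x => ?_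
            rw [lintegral_const_mul _ ((measurable_measure_closedBall _ _).pow_const 2)]
        _ = ∫⁻ z, ∫⁻ x, p x ^ 2 * κ x (Metric.closedBall z (2 * ρ)) ^ 2 ∂μ := by
            refine lintegral_lintegral_swap ?_
            exact (((hpm.comp measurable_fst).pow_const 2).mul
              ((hballm (2 * ρ)).pow_const 2)).aemeasurable
        _ ≤ ∫⁻ z, C ^ 2 * ENNReal.ofReal ((4 * (2 * ρ)) ^ b) *
              μ (Metric.closedBall z (2 * (2 * ρ))) :=
            lintegral_mono fun z => hball _ (by positivity) z
        _ = C ^ 2 * ENNReal.ofReal ((8 * ρ) ^ b) *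
              ∫⁻ z, μ (Metric.closedBall z (4 * ρ)) := by
            rw [lintegral_const_mul _ hμb, ← mul_assoc, ← mul_assoc]; norm_num
        _ = C ^ 2 * ENNReal.ofReal ((8 * ρ) ^ b) *
              ∫⁻ x, volume (Metric.closedBall x (4 * ρ)) ∂μ := by
            congr 1
            have hS : MeasurableSet {q : Space n × Space n | dist q.1 q.2 ≤ 4 * ρ} :=
              measurableSet_le (by fun_prop) measurable_const
            have := (Measure.prod_apply_symm (μ := μ) (ν := (volume : Measure (Space n)))
              hS).symm.trans (Measure.prod_apply hS)
            refine Eq.trans this ?_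
            refine lintegral_congr fun x => ?_
            congr 1
            ext y
            simp [dist_comm]
        _ = _ := by
            simp_rw [hv4]
            rw [lintegral_const]
            ring
    exact (ENNReal.mul_le_mul_iff_right hv0 hvt).1 key
  -- summation over dyadic radii
  have hI : ∀ ρ : ℝ, Measurable fun x => ∫⁻ y, κ x (Metric.closedBall y ρ) ∂κ x := fun ρ =>
    Measurable.lintegral_kernel_prod_right' (hballm ρ)
  set S : Space n → ℝ≥0∞ := fun x => ∑' j : ℕ, ENNReal.ofReal (((1 / 2 : ℝ) ^ j) ^ (-(β : ℝ))) *
      ∫⁻ y, κ x (Metric.closedBall y ((1 / 2) ^ j)) ∂κ x with hS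
  have hSm : Measurable S := Measurable.tsum fun j => (hI _).const_mul _
  have hfin : ∫⁻ x, p x ^ 2 * S x ∂μ ≠ ⊤ := by
    set q : ℝ := (1 / 2 : ℝ) ^ (b - β) with hq
    have hq1 : q < 1 := rpow_lt_one (by norm_num) (by norm_num) (by linarith)
    have hq0 : 0 ≤ q := by positivity
    refine ne_top_of_le_ne_top (b := ∑' j : ℕ, C ^ 2 * ENNReal.ofReal (8 ^ b) *
      (μ univ * ENNReal.ofReal (4 ^ (n + 2))) * ENNReal.ofReal q ^ j) ?_ ?_
    · rw [ENNReal.tsum_mul_left, ENNReal.tsum_geometric]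
      have : (1 - ENNReal.ofReal q)⁻¹ ≠ ⊤ := by
        rw [Ne, ENNReal.inv_eq_top, tsub_eq_zero_iff_le, not_le]
        simpa using hq1
      finiteness
    · simp_rw [hS, ← ENNReal.tsum_mul_left]
      rw [lintegral_tsum fun j => by
        have := hI ((1 / 2) ^ j)
        fun_prop]
      refine ENNReal.tsum_le_tsum fun j => ?_
      have hj : (0:ℝ) < (1 / 2) ^ j := by positivity
      calc ∫⁻ x, p x ^ 2 * (ENNReal.ofReal (((1 / 2 : ℝ) ^ j) ^ (-(β : ℝ))) *
            ∫⁻ y, κ x (Metric.closedBall y ((1 / 2) ^ j)) ∂κ x) ∂μ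
          = ENNReal.ofReal (((1 / 2 : ℝ) ^ j) ^ (-(β : ℝ))) * ∫⁻ x, p x ^ 2 *
            ∫⁻ y, κ x (Metric.closedBall y ((1 / 2) ^ j)) ∂κ x ∂μ := by
            rw [← lintegral_const_mul _ (by have := hI ((1 / 2) ^ j); fun_prop)]
            exact lintegral_congr fun x => by ring
        _ ≤ ENNReal.ofReal (((1 / 2 : ℝ) ^ j) ^ (-(β : ℝ))) * (C ^ 2 *
            ENNReal.ofReal ((8 * (1 / 2) ^ j) ^ b) *
              (μ univ * ENNReal.ofReal (4 ^ (n + 2)))) := by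
            gcongr
            exact hρ _ hj
        _ = _ := by
            have : ENNReal.ofReal q ^ j = ENNReal.ofReal (((1 / 2 : ℝ) ^ j) ^ (-(β : ℝ))) *
                ENNReal.ofReal (((1 / 2 : ℝ) ^ j) ^ b) := by
              rw [← ENNReal.ofReal_mul (by positivity), ← rpow_add hj, ← ENNReal.ofReal_pow hq0, hq,
                ← rpow_natCast, ← rpow_natCast, ← rpow_mul (by norm_num),
                ← rpow_mul (by norm_num)]
              congr 2; ring
            rw [mul_rpow (by norm_num) hj.le, ENNReal.ofReal_mul (by positivity), this]
            ring
  have hae := ae_lt_top (by fun_prop) hfin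
  filter_upwards [hac.ae_le hae, Measure.rnDeriv_pos hac] with x hx1 hx2 A hA
  refine measure_eq_zero_of_tsum_closedBall_ne_top _ hβ ?_ hA
  exact (ENNReal.lt_top_of_mul_ne_top_right hx1.ne (pow_ne_zero _ hx2.ne')).ne

end VCSpheres

/-! ### Spheres, affine subspaces and shattering -/

namespace VCSpheres

open MeasureTheory Set Filter Topology Module
open scoped ENNReal NNReal RealInnerProductSpace

section
variable {V : Type*} [NormedAddCommGroup V] [InnerProductSpace ℝ V] [FiniteDimensional ℝ V]

/-- Away from a pole, stereographic projection parametrises the sphere by a smooth map on a space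
of dimension one less. -/
lemma dimH_unit_sphere_le {k : ℕ} (hk : finrank ℝ V ≤ k + 1) :
    dimH (Metric.sphere (0 : V) 1) ≤ k := by
  rcases (Metric.sphere (0 : V) 1).eq_empty_or_nonempty with h0 | ⟨v, hv⟩
  · simp [h0]
  have hv1 : ‖v‖ = 1 := by simpa using hv
  have hsub : Metric.sphere (0 : V) 1 ⊆
      {v} ∪ range fun w : (ℝ ∙ v)ᗮ => stereoInvFunAux v (w : V) := by
    intro x hx
    rcases eq_or_ne x v with h | h
    · exact Or.inl h
    · refine Or.inr ⟨stereoToFun v x, ?_⟩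
      exact congrArg Subtype.val (stereo_left_inv hv1 (x := ⟨x, hx⟩) h)
  refine (dimH_mono hsub).trans ?_
  rw [dimH_union, dimH_singleton, max_eq_right zero_le]
  refine (ContDiff.dimH_range_le ((contDiff_stereoInvFunAux (m := 1)).comp
    (ℝ ∙ v)ᗮ.subtypeL.contDiff)).trans ?_
  have h1 := (ℝ ∙ v).finrank_add_finrank_orthogonal
  rw [finrank_span_singleton (by rintro rfl; simp at hv1)] at h1
  have : finrank ℝ (ℝ ∙ v)ᗮ ≤ k := by omega
  exact_mod_cast this

lemma dimH_sphere_le {k : ℕ} (hk : finrank ℝ V ≤ k + 1) (q : V) (ρ : ℝ) :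
    dimH (Metric.sphere q ρ) ≤ k := by
  -- a sphere of radius zero is a point, which has dimension zero
  rcases lt_trichotomy ρ 0 with h | h | h
  · rw [Metric.sphere_eq_empty_of_neg h]; simp
  · subst h; simp
  have hlip : LipschitzWith ‖ρ‖₊ fun u : V => q + ρ • u := by
    refine LipschitzWith.of_dist_le_mul fun u v => ?_
    rw [dist_add_left, dist_smul₀, coe_nnnorm]
  have hsub : Metric.sphere q ρ ⊆ (fun u : V => q + ρ • u) '' Metric.sphere 0 1 := by
    intro x hx
    rw [mem_sphere_iff_norm] at hx
    refine ⟨ρ⁻¹ • (x - q), ?_, ?_⟩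
    · rw [mem_sphere_iff_norm, sub_zero, norm_smul, hx, norm_inv, Real.norm_of_nonneg h.le,
        inv_mul_cancel₀ h.ne']
    · simp only [smul_inv_smul₀ h.ne']
      abel
  exact (dimH_mono hsub).trans ((hlip.dimH_image_le _).trans (dimH_unit_sphere_le hk))

/-- Within an affine subspace, a sphere becomes a sphere around the projection of its centre. -/
lemma dimH_affine_inter_sphere_le {k : ℕ} {W : AffineSubspace ℝ V}
    (hW : finrank ℝ W.direction ≤ k + 1) (x : V) (t : ℝ) :
    dimH ((W : Set V) ∩ Metric.sphere x t) ≤ k := by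
  rcases ((W : Set V) ∩ Metric.sphere x t).eq_empty_or_nonempty with h0 | ⟨p, hpW, -⟩
  · simp [h0]
  set q : W.direction := W.direction.orthogonalProjectionOnto (x - p) with hq
  have hsub : (W : Set V) ∩ Metric.sphere x t ⊆ (fun u : W.direction => (u : V) + p) ''
      Metric.sphere q (Real.sqrt (t ^ 2 - ‖(q : V) - (x - p)‖ ^ 2)) := by
    rintro y ⟨hyW, hyt⟩
    rw [mem_sphere_iff_norm] at hyt
    refine ⟨⟨y - p, AffineSubspace.vsub_mem_direction hyW hpW⟩, ?_, by simp⟩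
    set u : W.direction := ⟨y - p, AffineSubspace.vsub_mem_direction hyW hpW⟩ with hu
    have horth : ⟪((u - q : W.direction) : V), (q : V) - (x - p)⟫ = 0 := by
      rw [← neg_sub (x - p), inner_neg_right, neg_eq_zero]
      exact Submodule.inner_right_of_mem_orthogonal (u - q).2
        (Submodule.sub_starProjection_mem_orthogonal _)
    have h1 : ‖((u - q : W.direction) : V) + ((q : V) - (x - p))‖ ^ 2 =
        ‖((u - q : W.direction) : V)‖ ^ 2 + ‖(q : V) - (x - p)‖ ^ 2 := by
      rw [norm_add_sq_real, horth]; ring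
    have h2 : ((u - q : W.direction) : V) + ((q : V) - (x - p)) = y - x := by
      simp only [hu, AddSubgroupClass.coe_sub]; abel
    rw [h2, hyt] at h1
    rw [mem_sphere_iff_norm, h1, add_sub_cancel_right, Real.sqrt_sq (norm_nonneg _)]
    rfl
  have hlip : LipschitzWith 1 fun u : W.direction => (u : V) + p :=
    LipschitzWith.of_dist_le_mul fun u v => by rw [dist_add_right]; simp [Subtype.dist_eq]
  refine (dimH_mono hsub).trans ((hlip.dimH_image_le _).trans (dimH_sphere_le hW _ _))

/-- Suppose that neither `A` nor the spheres `{y ∈ E | ‖x - y‖ = t}`, `x ∈ A`, lie in an affine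
subspace of dimension `k`, and that the dimension of `V` is less than `2 (k + 1)`. Then two of
these spheres are not comparable for inclusion. If all were comparable, the smallest one, `N`,
among those around an affine basis of `A` would lie in all of them; two spheres of equal radius
meet in the hyperplane of points equidistant from the centres, so the directions of the affine
spans of `A` and `N`, both of dimension at least `k + 1`, would be orthogonal. -/
lemma exists_not_subset_of_not_subset_affine {k : ℕ} (hk : finrank ℝ V < 2 * (k + 1))
    {E A : Set V} {t : ℝ}
    (hA : ∀ W : AffineSubspace ℝ V, finrank ℝ W.direction ≤ k → ¬ A ⊆ W)
    (hN : ∀ x ∈ A, ∀ W : AffineSubspace ℝ V, finrank ℝ W.direction ≤ k →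
      ¬ {y ∈ E | ‖x - y‖ = t} ⊆ W) :
    ∃ x₁ ∈ A, ∃ x₂ ∈ A, ¬ {y ∈ E | ‖x₁ - y‖ = t} ⊆ {y ∈ E | ‖x₂ - y‖ = t} ∧
      ¬ {y ∈ E | ‖x₂ - y‖ = t} ⊆ {y ∈ E | ‖x₁ - y‖ = t} := by
  by_contra! hcon
  set N : V → Set V := fun x => {y ∈ E | ‖x - y‖ = t} with hNdef
  have hrank : ∀ B : Set V, (∀ W : AffineSubspace ℝ V, finrank ℝ W.direction ≤ k → ¬ B ⊆ W) →
      k + 1 ≤ finrank ℝ (vectorSpan ℝ B) := by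
    intro B hB
    by_contra! h
    refine hB (affineSpan ℝ B) ?_ (subset_affineSpan ℝ B)
    rw [direction_affineSpan]; omega
  obtain ⟨F, hFA, hFspan, hFind⟩ := exists_affineIndependent ℝ V A
  have hFfin : F.Finite := finite_set_of_fin_dim_affineIndependent ℝ hFind
  have hFrank : k + 1 ≤ finrank ℝ (vectorSpan ℝ F) := by
    rw [← direction_affineSpan, hFspan, direction_affineSpan]; exact hrank A hA
  have hFne : F.Nonempty := by
    rw [nonempty_iff_ne_empty]
    rintro rfl
    rw [vectorSpan_empty, finrank_bot] at hFrank
    omega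
  obtain ⟨m, hmF, hmin⟩ := hFfin.exists_minimalFor N F hFne
  have hsub : ∀ x ∈ F, N m ⊆ N x := by
    intro x hx
    by_contra h
    exact h (hmin hx (hcon m (hFA hmF) x (hFA hx) h))
  have horth : vectorSpan ℝ F ⟂ vectorSpan ℝ (N m) := by
    rw [vectorSpan_eq_span_vsub_set_right ℝ hmF, vectorSpan_def, Submodule.isOrtho_span]
    rintro _ ⟨x, hx, rfl⟩ _ ⟨z, hz, z', hz', rfl⟩
    -- `z` and `z'` lie on the spheres of radius `t` around both `x` and `m`
    have h1 := (hsub x hx hz).2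
    have h2 := (hsub x hx hz').2
    have h3 := hz.2
    have h4 := hz'.2
    have e : ∀ a b : V, ‖a - b‖ = t → ⟪a, b⟫ = (‖a‖ ^ 2 + ‖b‖ ^ 2 - t ^ 2) / 2 := by
      intro a b h
      rw [← h, norm_sub_sq_real]; ring
    simp only [vsub_eq_sub, inner_sub_left, inner_sub_right]
    rw [e _ _ h1, e _ _ h2, e _ _ h3, e _ _ h4]
    ring
  have h1 := Submodule.finrank_mono horth
  have h2 := (vectorSpan ℝ (N m)).finrank_add_finrank_orthogonal
  have h3 := hrank (N m) (hN m (hFA hmF))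
  omega

end

/-- The indicators of the spheres around `y`, `z₁`, `z₂`, `y₀` shatter the pair `{x₁, x₂}`. -/
lemma two_le_vcDim_sphereClass {d : ℕ} {E : Set (EuclideanSpace ℝ (Fin d))} {t : ℝ}
    {x₁ x₂ y z₁ z₂ y₀ : EuclideanSpace ℝ (Fin d)} (hx₁ : x₁ ∈ E) (hx₂ : x₂ ∈ E)
    (hy : y ∈ E) (hz₁ : z₁ ∈ E) (hz₂ : z₂ ∈ E) (hy₀ : y₀ ∈ E)
    (h1 : ‖x₁ - y‖ = t) (h2 : ‖x₂ - y‖ = t)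
    (h3 : ‖x₁ - z₁‖ = t) (h4 : ‖x₂ - z₁‖ ≠ t) (h5 : ‖x₁ - z₂‖ ≠ t) (h6 : ‖x₂ - z₂‖ = t)
    (h7 : ‖x₁ - y₀‖ ≠ t) (h8 : ‖x₂ - y₀‖ ≠ t) : 2 ≤ vcDim (sphereClass E t) := by
  classical
  have hne : (⟨x₁, hx₁⟩ : E) ≠ ⟨x₂, hx₂⟩ := fun h => by
    rw [Subtype.mk.injEq] at h
    rw [h] at h3; exact h4 h3
  set C : Finset E := {⟨x₁, hx₁⟩, ⟨x₂, hx₂⟩} with hC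
  have hcard : C.card = 2 := Finset.card_pair hne
  have hsh : Shatters (sphereClass E t) C := by
    intro g
    have key : ∀ w ∈ E, (‖x₁ - w‖ = t ↔ g ⟨⟨x₁, hx₁⟩, by simp [hC]⟩ = 1) →
        (‖x₂ - w‖ = t ↔ g ⟨⟨x₂, hx₂⟩, by simp [hC]⟩ = 1) →
        ∃ h ∈ sphereClass E t, ∀ x : C, h x = g x := by
      intro w hw e1 e2
      refine ⟨sphereIndicator E t w, ⟨w, hw, rfl⟩, ?_⟩
      have e : ∀ (x : C), (‖((x : E) : EuclideanSpace ℝ (Fin d)) - w‖ = t ↔ g x = 1) →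
          sphereIndicator E t w x = g x := by
        intro x hx
        unfold sphereIndicator
        split_ifs with h
        · exact (hx.1 h).symm
        · have := mt hx.2 h
          omega
      rintro ⟨x, hx⟩
      rcases Finset.mem_insert.1 hx with rfl | hx'
      · exact e _ e1
      · obtain rfl := Finset.mem_singleton.1 hx'
        exact e _ e2
    by_cases g1 : g ⟨⟨x₁, hx₁⟩, by simp [hC]⟩ = 1 <;>
      by_cases g2 : g ⟨⟨x₂, hx₂⟩, by simp [hC]⟩ = 1
    · exact key y hy (by simp [h1, g1]) (by simp [h2, g2])
    · exact key z₁ hz₁ (by simp [h3, g1]) (by simp [h4, g2])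
    · exact key z₂ hz₂ (by simp [h5, g1]) (by simp [h6, g2])
    · exact key y₀ hy₀ (by simp [h7, g1]) (by simp [h8, g2])
  calc (2 : ℕ∞) = (C.card : ℕ∞) := by rw [hcard]; rfl
    _ ≤ _ := le_iSup₂_of_le C hsh le_rfl

/-- Let `ν` be a symmetric measure on pairs of points of `E` at distance `t`, whose fibres do not
charge sets of dimension less than `β`, where `k < β`. Then almost every point is good: its sphere
is not contained in an affine subspace of dimension `k + 1`, as such a subspace meets a sphere in
dimension at most `k`. By symmetry almost every point of almost every fibre is good, and the same
argument applies to the good points within a fibre. -/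
lemma exists_not_subset_affine {V : Type*} [NormedAddCommGroup V] [InnerProductSpace ℝ V]
    [FiniteDimensional ℝ V] [MeasurableSpace V] [BorelSpace V] {E : Set V}
    {t : ℝ} {ν : Measure (V × V)} [IsFiniteMeasure ν] (hν0 : ν ≠ 0)
    (hν : ∀ᵐ p ∂ν, p.1 ∈ E ∧ p.2 ∈ E ∧ ‖p.1 - p.2‖ = t) (hswap : ν.map Prod.swap = ν)
    {k : ℕ} {β : ℝ≥0} (hkβ : (k : ℝ≥0) < β)
    (hβ : ∀ᵐ x ∂ν.fst, ∀ A : Set V, dimH A < β → ν.condKernel x A = 0) :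
    ∃ y ∈ E, ∃ A ⊆ {x ∈ E | ‖y - x‖ = t},
      (∀ W : AffineSubspace ℝ V, finrank ℝ W.direction ≤ k + 1 → ¬ A ⊆ W) ∧
      ∀ x ∈ A, ∀ W : AffineSubspace ℝ V, finrank ℝ W.direction ≤ k + 1 →
        ¬ {z ∈ E | ‖x - z‖ = t} ⊆ W := by
  -- a set of full fibre measure in the sphere is not contained in a small affine subspace
  have hfib : ∀ x, (∀ A : Set V, dimH A < β → ν.condKernel x A = 0) → ∀ A ⊆ {z ∈ E | ‖x - z‖ = t},
      (∀ᵐ y ∂ν.condKernel x, y ∈ A) → ∀ W : AffineSubspace ℝ V,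
      finrank ℝ W.direction ≤ k + 1 → ¬ A ⊆ W := by
    intro x hx A hA hAe W hW hAW
    have h1 : dimH A < β := by
      refine (dimH_mono (t := (W : Set V) ∩ Metric.sphere x t) fun y hy => ⟨hAW hy, ?_⟩).trans_lt
        ((dimH_affine_inter_sphere_le hW x t).trans_lt (by exact_mod_cast hkβ))
      rw [mem_sphere_iff_norm, norm_sub_rev]; exact (hA hy).2
    have h2 : ν.condKernel x univ = 0 := by
      refine le_antisymm ?_ zero_le
      calc ν.condKernel x univ ≤ ν.condKernel x A + ν.condKernel x Aᶜ := by
            rw [← union_compl_self A]; exact measure_union_le _ _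
        _ = 0 := by rw [hx A h1, zero_add]; exact hAe
    simp at h2
  have hdis : ∀ P : V × V → Prop, (∀ᵐ p ∂ν, P p) →
      ∀ᵐ x ∂ν.fst, ∀ᵐ y ∂ν.condKernel x, P (x, y) := fun P hP => by
    rw [← ν.disintegrate ν.condKernel] at hP
    exact Measure.ae_ae_of_ae_compProd hP
  have hsnd : ν.fst = ν.snd := by
    conv_lhs => rw [← hswap]
    rw [Measure.fst_map_swap]
  set Good : V → Prop := fun x => ∀ W : AffineSubspace ℝ V, finrank ℝ W.direction ≤ k + 1 →
    ¬ {z ∈ E | ‖x - z‖ = t} ⊆ W with hGood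
  have hG : ∀ᵐ x ∂ν.fst, Good x := by
    filter_upwards [hβ, hdis _ hν] with x hx hx2
    exact hfib x hx _ Subset.rfl (by filter_upwards [hx2] with y hy using hy.2)
  have hG2 : ∀ᵐ p ∂ν, Good p.2 := by
    rw [hsnd] at hG
    exact ae_of_ae_map measurable_snd.aemeasurable hG
  have hne : ν.fst ≠ 0 := fun h => hν0 (by
    rw [← Measure.measure_univ_eq_zero, ← Measure.fst_univ, h]; simp)
  have : NeBot (ae ν.fst) := ae_neBot.2 hne
  have hE : ∀ᵐ x ∂ν.fst, x ∈ E := by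
    filter_upwards [hdis _ hν] with x hx
    obtain ⟨y, hy⟩ := hx.exists
    exact hy.1
  obtain ⟨y, hyβ, hyE, hy⟩ := (hβ.and (hE.and (hdis _ (hν.and hG2)))).exists
  refine ⟨y, hyE, {x ∈ E | ‖y - x‖ = t} ∩ {x | Good x}, inter_subset_left, ?_, fun x hx => hx.2⟩
  exact hfib y hyβ _ inter_subset_left (by filter_upwards [hy] with x hx using ⟨hx.1.2, hx.2⟩)

/-- The theorem in dimension `d = n + 2`. The interval consists of distances at which
`sphericalForm n μ μ` does not vanish. -/
theorem exists_interval_two_le_vcDim {n : ℕ} {E : Set (Space n)} (hE : IsCompact E)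
    (hdim : ENNReal.ofReal (max (((n + 2 : ℕ) + 1 : ℝ) / 2) ((n + 2 : ℕ) - 1 : ℝ)) < dimH E) :
    ∃ a b : ℝ, 0 < a ∧ a < b ∧ ∀ t ∈ Icc a b, 2 ≤ vcDim (sphereClass E t) := by
  push_cast at hdim
  obtain ⟨s', hs1, hs2⟩ := ENNReal.lt_iff_exists_nnreal_btwn.1 hdim
  obtain ⟨s, rfl⟩ : ∃ s : ℝ≥0, s = s' := ⟨s', rfl⟩
  rw [← ENNReal.ofReal_coe_nnreal, ENNReal.ofReal_lt_ofReal_iff_of_nonneg (by positivity),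
    max_lt_iff] at hs1
  have h1 : ((n : ℝ) + 3) / 2 < s := by linarith [hs1.1]
  have h1' : (n : ℝ) + 1 < s := by linarith [hs1.2]
  have h2 : (s : ℝ) < n + 2 := by
    have h3 : dimH E ≤ (n + 2 : ℕ) := by
      refine (dimH_mono (subset_univ E)).trans ?_
      rw [Real.dimH_univ_eq_finrank]; simp
    have := hs2.trans_le h3
    exact_mod_cast this
  have hs0 : (0:ℝ) < s := by linarith [(Nat.cast_nonneg n : (0:ℝ) ≤ n)]
  obtain ⟨μ, hμf, hμ0, hμE, D, hDt, hD⟩ := exists_frostman_measure hE hs0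
    (by rwa [ENNReal.ofReal_coe_nnreal])
  have hμE' : ∀ᵐ x ∂μ, x ∈ E := hμE
  have hD' : ∀ᵐ y ∂μ, ∫⁻ x, edist y x ^ (-(s : ℝ)) ∂μ ≤ D := by
    filter_upwards [hμE'] with y hy using hD y hy
  obtain ⟨R, hR⟩ := Metric.isBounded_iff.1 hE.isBounded
  have hfin : mixedEnergy n μ μ ≠ ⊤ :=
    mixedEnergy_self_ne_top h1 h2 hDt hD' (R := max R 1) (by positivity) (by
      filter_upwards [hμE'] with x hx
      filter_upwards [hμE'] with y hy using (hR hx hy).trans (le_max_left _ _))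
  obtain ⟨t₀, ht₀, hne⟩ := exists_sphericalForm_ne_zero hμ0 (by
    filter_upwards [hD'] with y hy
    exact measure_singleton_eq_zero_of_lintegral_edist_ne_top hs0
      (ne_top_of_le_ne_top hDt hy)) hfin
  have hcont := (continuousOn_sphericalForm hfin).continuousAt (Ioi_mem_nhds ht₀)
  have hev : ∀ᶠ t in 𝓝 t₀, 0 < t ∧ sphericalForm n μ μ t ≠ 0 :=
    (eventually_gt_nhds ht₀).and (hcont.eventually_ne hne)
  obtain ⟨ε, hε, hball⟩ := Metric.eventually_nhds_iff_ball.1 hev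
  have hmem : ∀ t ∈ Icc t₀ (t₀ + ε / 2), t ∈ Metric.ball t₀ ε := fun t ht => by
    rw [Metric.mem_ball, Real.dist_eq, abs_of_nonneg (by linarith [ht.1])]
    linarith [ht.2]
  refine ⟨t₀, t₀ + ε / 2, ht₀, by linarith, fun t ht => ?_⟩
  obtain ⟨htpos, hM⟩ := hball t (hmem t ht)
  obtain ⟨ν, hνf, hν0, hνE, hswap, C, hC, hν⟩ :=
    exists_pair_measure h1 h2 hE hμE hDt hD' htpos hM
  -- the dimension `2 s - d - 1` of the fibres exceeds `⌊d / 2⌋ - 1 = n / 2`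
  have hkb : ((n / 2 : ℕ) : ℝ) < 2 * (s : ℝ) - (n + 3) := by
    rcases Nat.lt_or_ge n 2 with hn | hn
    · have : n / 2 = 0 := by omega
      rw [this]; push_cast; linarith
    · have : n / 2 + 1 ≤ n := by omega
      have : ((n / 2 : ℕ) : ℝ) + 1 ≤ n := by exact_mod_cast this
      linarith
  obtain ⟨β', hβ1, hβ2⟩ := exists_between hkb
  lift β' to ℝ≥0 using (Nat.cast_nonneg _).trans hβ1.le
  have hkβ : ((n / 2 : ℕ) : ℝ≥0) < β' := by exact_mod_cast hβ1
  have hfib := ae_condKernel_eq_zero_of_dimH_lt hE (hνE.mono fun p hp => hp.2.1) hC hν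
    (zero_le.trans_lt hkβ) hβ2
  obtain ⟨y, hy, A, hA, hAW, hAN⟩ := exists_not_subset_affine hν0 hνE hswap hkβ hfib
  obtain ⟨x₁, hx₁, x₂, hx₂, h12, h21⟩ := exists_not_subset_of_not_subset_affine
    (by simp; omega) hAW hAN
  obtain ⟨z₁, hz₁, hz₁'⟩ := not_subset.1 h12
  obtain ⟨z₂, hz₂, hz₂'⟩ := not_subset.1 h21
  -- the two spheres have dimension `n + 1 < s < dimH E`
  have hnot : ¬ E ⊆ Metric.sphere x₁ t ∪ Metric.sphere x₂ t := by
    intro hsub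
    have h3 := dimH_mono hsub
    rw [dimH_union] at h3
    have h4 : ∀ x : EuclideanSpace ℝ (Fin (n + 2)), dimH (Metric.sphere x t) ≤ (n + 1 : ℕ) :=
      fun x => dimH_sphere_le (by simp) x t
    have h5 := hs2.trans_le (h3.trans (max_le (h4 x₁) (h4 x₂)))
    have h6 : (s : ℝ) < n + 1 := by exact_mod_cast h5
    linarith
  obtain ⟨y₀, hy₀, hy₀'⟩ := not_subset.1 hnot
  simp only [mem_union, mem_sphere_iff_norm, not_or, norm_sub_rev y₀] at hy₀'
  exact two_le_vcDim_sphereClass (hA hx₁).1 (hA hx₂).1 hy hz₁.1 hz₂.1 hy₀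
    (by rw [norm_sub_rev]; exact (hA hx₁).2) (by rw [norm_sub_rev]; exact (hA hx₂).2)
    hz₁.2 (fun h => hz₁' ⟨hz₁.1, h⟩) (fun h => hz₂' ⟨hz₂.1, h⟩) hz₂.2 hy₀'.1 hy₀'.2

end VCSpheres

theorem theorem2 (d : ℕ) (hd : 2 ≤ d) (E : Set (EuclideanSpace ℝ (Fin d))) (hE : IsCompact E)
    (hdim : ENNReal.ofReal (max (((d : ℝ) + 1) / 2) ((d : ℝ) - 1)) < dimH E) :
    ∃ a b : ℝ, 0 < a ∧ a < b ∧
      ∀ t ∈ Set.Icc a b, 2 ≤ VCSpheres.vcDim (VCSpheres.sphereClass E t) := by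
  obtain ⟨n, rfl⟩ := Nat.exists_eq_add_of_le' hd
  exact VCSpheres.exists_interval_two_le_vcDim hE hdim
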